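/- Let $N$ be a squarefree positive integer. Let $\mathrm{Sp}_2(\mathbb R)=\{M\in\mathbb R^{4\times4}: M'JM=J\}$, $J=\begin{pmatrix}0&-E\\E&0\end{pmatrix}$, be the real symplectic group of degree $2$, and let $$\mathbb G=\Big\{\tfrac1{\sqrt m}M\in \mathrm{Sp}_2(\mathbb R)\;:\; M\in\mathbb Z^{4\times 4},\ m\in\mathbb N\Big\}.$$ Let $\Sigma_N$ be the paramodular group, consisting of all matrices in $\mathrm{Sp}_2(\mathbb R)$ of the form $$(\ast)\qquad\begin{pmatrix} a_1&a_2N&b_1&b_2\\ a_3&a_4&b_3&b_4/N\\ c_1&c_2N&d_1&d_2\\ c_3N&c_4N&d_3N&d_4\end{pmatrix},\qquad a_i,b_i,c_i,d_i\in\mathbb Z ,$$ and let $\Sigma_N^*\subseteq\mathbb G$ be the extended paramodular group, generated by $\Sigma_N$ and the matrices $$W_d=\begin{pmatrix}V_d&0\\0&V_d'^{-1}\end{pmatrix},\quad V_d=\tfrac1{\sqrt d}\begin{pmatrix}\alpha d&\beta N\\ \gamma&\delta d\end{pmatrix},\quad \alpha,\beta,\gamma,\delta\in\mathbb Z,\ \det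 V_d=1,\qquad d\mid N .$$ Then $(\Sigma_N^*,\mathbb G)$ is a Hecke pair, i.e. every double coset $\Sigma_N^*g\Sigma_N^*$, $g\in\mathbb G$, is a finite union of right cosets $\Sigma_N^*h$. Let $\mathcal H(\Sigma_N^*,\mathbb G)$ be its Hecke algebra over $\mathbb Z$, i.e. the ring of all finite $\mathbb Z$-linear combinations $\sum_i t_i\,\Sigma_N^*g_i$ of right cosets that are invariant under right multiplication by $\Sigma_N^*$, with the product $\big(\sum_i t_i\Sigma_N^*g_i\big)\big(\sum_j s_j\Sigma_N^*h_j\big)=\sum_{i,j}t_is_j\Sigma_N^*g_ih_j$; a double coset is identified with the sum of the right cosets it contains. For a prime $p$ let $\mathbb G^*_{p}$ be the subgroup of $\mathbb G$ generated by $\Sigma_N^*$ and all $M\in\mathbb G$ such that $\sqrt{p^r}\,M$ has the form $(\ast)$ for some integer $r\ge0$, and let the $p$-primary component $\mathcal H(\Sigma_N^*,\mathbb G^*_{p})\subseteq \mathcal H(\Sigma_N^*,\mathbb G)$ be the subalgebra of the elements all of whose right cosets lie in $\mathbb G^*_{p}$. Put $$\mathcal T^*_{N,1}(p)=\Sigma_N^*\tfrac1{\sqrt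 p}\operatorname{diag}(1,1,p,p)\Sigma_N^*,\qquad \mathcal T^*_{N,2}(p)=\Sigma_N^*\tfrac1p\operatorname{diag}(1,p,p^2,p)\Sigma_N^* .$$ Then the Hecke algebra $\mathcal H(\Sigma_N^*,\mathbb G)$ is commutative and has no zero-divisors. It is the tensor product over $\mathbb Z$ of its primary components $\mathcal H(\Sigma_N^*,\mathbb G^*_{p})$, $p$ prime (that is, for any finitely many distinct primes multiplication maps the tensor product of the corresponding components injectively into $\mathcal H(\Sigma_N^*,\mathbb G)$, and the images of these maps exhaust $\mathcal H(\Sigma_N^*,\mathbb G)$). For every prime $p$ the primary component $\mathcal H(\Sigma_N^*,\mathbb G^*_{p})$ is the polynomial ring over $\mathbb Z$ in the algebraically independent elements $\mathcal T^*_{N,1}(p)$ and $\mathcal T^*_{N,2}(p)$. -/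

import Mathlib

noncomputable section

namespace Hecke

variable {G : Type*} [Group G]

/-- The space `U \ G` of right cosets `U g`. -/
abbrev RightCosets (U : Subgroup G) : Type _ := Quotient (QuotientGroup.rightRel U)

/-- The right coset `U g`. -/
def coset (U : Subgroup G) (g : G) : RightCosets U := Quotient.mk _ g

theorem coset_eq_iff (U : Subgroup G) (g h : G) : coset U g = coset U h ↔ h * g⁻¹ ∈ U := by
  unfold coset
  rw [Quotient.eq, QuotientGroup.rightRel_apply]

theorem coset_out (U : Subgroup G) (c : RightCosets U) : coset U c.out = c := Quotient.out_eq c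

/-- Right multiplication `U g ↦ U g h` on right cosets. -/
def mulRight (U : Subgroup G) (h : G) (c : RightCosets U) : RightCosets U :=
  Quotient.map (fun g : G => g * h) (by
    intro a b hab
    have hab' : b * a⁻¹ ∈ U := QuotientGroup.rightRel_apply.1 hab
    refine QuotientGroup.rightRel_apply.2 ?_
    simpa [mul_assoc] using hab') c

@[simp] theorem mulRight_coset (U : Subgroup G) (h g : G) :
    mulRight U h (coset U g) = coset U (g * h) := rfl

theorem mulRight_mulRight (U : Subgroup G) (h k : G) (c : RightCosets U) :
    mulRight U k (mulRight U h c) = mulRight U (h * k) c := by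
  rw [← coset_out U c]
  simp [mul_assoc]

theorem mulRight_one (U : Subgroup G) (c : RightCosets U) : mulRight U 1 c = c := by
  rw [← coset_out U c]
  simp

/-- Right translation `∑ tᵢ U gᵢ ↦ ∑ tᵢ U gᵢ h` on formal `ℤ`-linear combinations of
right cosets. -/
def translate (U : Subgroup G) (h : G) : (RightCosets U →₀ ℤ) →+ (RightCosets U →₀ ℤ) :=
  Finsupp.mapDomain.addMonoidHom (mulRight U h)

theorem translate_single (U : Subgroup G) (h g : G) (n : ℤ) :
    translate U h (Finsupp.single (coset U g) n) = Finsupp.single (coset U (g * h)) n := by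
  simp [translate, Finsupp.mapDomain_single]

theorem translate_translate (U : Subgroup G) (h k : G) (T : RightCosets U →₀ ℤ) :
    translate U k (translate U h T) = translate U (h * k) T := by
  simp only [translate, Finsupp.mapDomain.addMonoidHom_apply]
  rw [← Finsupp.mapDomain_comp]
  congr 1
  funext c
  exact mulRight_mulRight U h k c

/-- The underlying group of the Hecke algebra `ℋ(U, G)` over `ℤ`: the formal finite `ℤ`-linear
combinations of right cosets `U g` that are invariant under right multiplication by `U`. If
`(U, G)` is a Hecke pair, the double cosets `U g U`, read as the sums of the right cosets which
they contain, form a `ℤ`-basis. -/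
def heckeAddSubgroup (U : Subgroup G) : AddSubgroup (RightCosets U →₀ ℤ) where
  carrier := {T | ∀ u ∈ U, translate U u T = T}
  zero_mem' := fun u _ => map_zero _
  add_mem' := fun ha hb u hu => by rw [map_add, ha u hu, hb u hu]
  neg_mem' := fun ha u hu => by rw [map_neg, ha u hu]

/-- The Hecke algebra `ℋ(U, G)` over `ℤ`. -/
def HeckeAlgebra (U : Subgroup G) : Type _ := heckeAddSubgroup U

namespace HeckeAlgebra

variable {U : Subgroup G}

instance : AddCommGroup (HeckeAlgebra U) := inferInstanceAs (AddCommGroup (heckeAddSubgroup U))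

/-- The expansion of an element of the Hecke algebra as a combination of right cosets. -/
def expansion : HeckeAlgebra U →+ (RightCosets U →₀ ℤ) := (heckeAddSubgroup U).subtype

theorem expansion_injective : Function.Injective (expansion (U := U)) := Subtype.val_injective

/-- The element of the Hecke algebra given by an invariant combination of right cosets. -/
def mk (x : RightCosets U →₀ ℤ) (hx : ∀ u ∈ U, translate U u x = x) : HeckeAlgebra U := ⟨x, hx⟩

@[simp] theorem expansion_mk (x : RightCosets U →₀ ℤ) (hx : ∀ u ∈ U, translate U u x = x) :
    expansion (mk x hx) = x := rfl

theorem translate_expansion (T : HeckeAlgebra U) {u : G} (hu : u ∈ U) :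
    translate U u (expansion T) = expansion T := T.2 u hu

/-- The product with `T = ∑ tᵢ U gᵢ` on the left,
`∑ sⱼ U hⱼ ↦ ∑ tᵢ sⱼ U gᵢ hⱼ`. -/
def act (T : HeckeAlgebra U) : (RightCosets U →₀ ℤ) →+ (RightCosets U →₀ ℤ) :=
  Finsupp.liftAddHom fun c : RightCosets U =>
    zmultiplesHom (RightCosets U →₀ ℤ) (translate U c.out (expansion T))

theorem act_coset (T : HeckeAlgebra U) (g : G) (n : ℤ) :
    act T (Finsupp.single (coset U g) n) = n • translate U g (expansion T) := by
  have h : translate U (coset U g).out (expansion T) = translate U g (expansion T) := by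
    have hu : (coset U g).out * g⁻¹ ∈ U := (coset_eq_iff U _ _).1 (coset_out U (coset U g)).symm
    calc translate U (coset U g).out (expansion T)
        = translate U g (translate U ((coset U g).out * g⁻¹) (expansion T)) := by
          rw [translate_translate]; simp
      _ = _ := by rw [translate_expansion T hu]
  simp [act, h]

theorem hom_ext' {A : Type*} [AddCommGroup A] {f f' : (RightCosets U →₀ ℤ) →+ A}
    (h : ∀ g n, f (Finsupp.single (coset U g) n) = f' (Finsupp.single (coset U g) n)) :
    f = f' := by
  refine Finsupp.addHom_ext fun c n => ?_
  rw [← coset_out U c]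
  exact h _ n

theorem act_translate (T : HeckeAlgebra U) (h : G) (x : RightCosets U →₀ ℤ) :
    act T (translate U h x) = translate U h (act T x) := by
  have : (act T).comp (translate U h) = (translate U h).comp (act T) := by
    refine hom_ext' fun g n => ?_
    simp [translate_single, act_coset, translate_translate, map_zsmul]
  exact DFunLike.congr_fun this x

instance : One (HeckeAlgebra U) :=
  ⟨mk (Finsupp.single (coset U 1) 1) fun u hu => by
    rw [translate_single]
    congr 1
    rw [coset_eq_iff]
    simpa using U.inv_mem hu⟩

/-- The product `(∑ tᵢ U gᵢ) (∑ sⱼ U hⱼ) = ∑ tᵢ sⱼ U gᵢ hⱼ`. -/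
instance : Mul (HeckeAlgebra U) :=
  ⟨fun T S => mk (act T (expansion S)) fun u hu => by
    rw [← act_translate, translate_expansion S hu]⟩

theorem expansion_one : expansion (1 : HeckeAlgebra U) = Finsupp.single (coset U 1) 1 := rfl

theorem expansion_mul (T S : HeckeAlgebra U) : expansion (T * S) = act T (expansion S) := rfl

theorem act_one (T : HeckeAlgebra U) : act T (expansion 1) = expansion T := by
  rw [expansion_one, act_coset]
  have := translate_expansion T U.one_mem
  rw [this, one_smul]

theorem act_mul (T S : HeckeAlgebra U) (x : RightCosets U →₀ ℤ) :
    act (T * S) x = act T (act S x) := by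
  have : act (T * S) = (act T).comp (act S) := by
    refine hom_ext' fun g n => ?_
    simp [act_coset, map_zsmul, act_translate, expansion_mul]
  exact DFunLike.congr_fun this x

theorem act_add (T S : HeckeAlgebra U) (x : RightCosets U →₀ ℤ) :
    act (T + S) x = act T x + act S x := by
  have : act (T + S) = act T + act S := by
    refine hom_ext' fun g n => ?_
    simp [act_coset, map_add]
  exact DFunLike.congr_fun this x

theorem one_act (x : RightCosets U →₀ ℤ) : act (1 : HeckeAlgebra U) x = x := by
  have : act (1 : HeckeAlgebra U) = AddMonoidHom.id _ := by
    refine hom_ext' fun g n => ?_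
    simp [act_coset, expansion_one, translate_single]
  exact DFunLike.congr_fun this x

instance : Ring (HeckeAlgebra U) where
  __ := (inferInstance : AddCommGroup (HeckeAlgebra U))
  one := 1
  mul := (· * ·)
  mul_assoc a b c := expansion_injective (by
    show expansion (a * b * c) = expansion (a * (b * c))
    rw [expansion_mul, act_mul, expansion_mul, expansion_mul])
  one_mul a := expansion_injective (one_act _)
  mul_one a := expansion_injective (act_one a)
  left_distrib a b c := expansion_injective (by
    show expansion (a * (b + c)) = expansion (a * b + a * c)
    rw [map_add, expansion_mul, map_add, map_add]; rfl)
  right_distrib a b c := expansion_injective (by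
    show expansion ((a + b) * c) = expansion (a * c + b * c)
    rw [map_add, expansion_mul, act_add]; rfl)
  zero_mul a := expansion_injective (by
    show expansion ((0 : HeckeAlgebra U) * a) = expansion 0
    have h := act_add (0 : HeckeAlgebra U) 0 (expansion a)
    rw [add_zero] at h
    rw [expansion_mul, map_zero]
    exact left_eq_add.1 h)
  mul_zero a := expansion_injective (map_zero (act a))

end HeckeAlgebra

/-- The set of right cosets contained in the double coset `U g U`. -/
def cosetsIn (U : Subgroup G) (g : G) : Set (RightCosets U) := {c | ∃ u ∈ U, c = coset U (g * u)}

/-- `(U, G)` is a Hecke pair: every double coset `U g U` decomposes into finitely many right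
cosets. -/
def IsHeckePair (U : Subgroup G) : Prop := ∀ g : G, (cosetsIn U g).Finite

theorem image_cosetsIn (U : Subgroup G) (g : G) {u : G} (hu : u ∈ U) :
    mulRight U u '' cosetsIn U g = cosetsIn U g := by
  ext c
  constructor
  · rintro ⟨_, ⟨v, hv, rfl⟩, rfl⟩
    exact ⟨v * u, U.mul_mem hv hu, by simp [mul_assoc]⟩
  · rintro ⟨v, hv, rfl⟩
    exact ⟨_, ⟨v * u⁻¹, U.mul_mem hv (U.inv_mem hu), rfl⟩, by simp [mul_assoc]⟩

theorem translate_sum_cosetsIn (U : Subgroup G) (g : G) (h : (cosetsIn U g).Finite) {u : G}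
    (hu : u ∈ U) :
    translate U u (∑ c ∈ h.toFinset, Finsupp.single c 1) =
      ∑ c ∈ h.toFinset, Finsupp.single c 1 := by
  classical
  have hinj : Function.Injective (mulRight U u) := fun a b hab => by
    have := congrArg (mulRight U u⁻¹) hab
    simpa [mulRight_mulRight, mulRight_one] using this
  have himg : h.toFinset.image (mulRight U u) = h.toFinset := by
    apply Finset.coe_injective
    simpa using image_cosetsIn U g hu
  conv_rhs => rw [← himg]
  rw [Finset.sum_image fun a _ b _ hab => hinj hab, map_sum]
  refine Finset.sum_congr rfl fun c _ => ?_
  simp [translate, Finsupp.mapDomain_single]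

open Classical in
/-- The double coset `U g U` as an element of the Hecke algebra: the sum of the right cosets
contained in it (`0` by convention if there are infinitely many, which cannot occur for a Hecke
pair). -/
def doubleCoset (U : Subgroup G) (g : G) : HeckeAlgebra U :=
  if h : (cosetsIn U g).Finite then
    HeckeAlgebra.mk (∑ c ∈ h.toFinset, Finsupp.single c 1)
      fun _ hu => translate_sum_cosetsIn U g h hu
  else 0

theorem expansion_doubleCoset (U : Subgroup G) (g : G) (h : (cosetsIn U g).Finite) :
    HeckeAlgebra.expansion (doubleCoset U g) = ∑ c ∈ h.toFinset, Finsupp.single c 1 := by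
  rw [doubleCoset, dif_pos h, HeckeAlgebra.expansion_mk]

/-- For a subgroup `U ≤ P ≤ G`, the Hecke algebra `ℋ(U, P)` as a subalgebra of `ℋ(U, G)`: the
elements all of whose right cosets lie in `P`. -/
def heckeSubalgebra (U P : Subgroup G) (hUP : U ≤ P) : Subalgebra ℤ (HeckeAlgebra U) :=
  subalgebraOfSubring
  { carrier := {T | ∀ g : G, HeckeAlgebra.expansion T (coset U g) ≠ 0 → g ∈ P}
    zero_mem' := fun g hg => absurd rfl hg
    one_mem' := fun g hg => by
      rw [HeckeAlgebra.expansion_one] at hg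
      have h : coset U 1 = coset U g := by
        by_contra hne
        exact hg (Finsupp.single_eq_of_ne (Ne.symm hne))
      exact hUP (by simpa using (coset_eq_iff U 1 g).1 h)
    add_mem' := fun {a b} ha hb g hg => by
      by_contra hgP
      apply hg
      rw [map_add, Finsupp.add_apply, not_not.1 (mt (ha g) hgP), not_not.1 (mt (hb g) hgP),
        add_zero]
    neg_mem' := fun {a} ha g hg => ha g fun h0 => hg (by
      rw [map_neg, Finsupp.neg_apply, h0, neg_zero])
    mul_mem' := fun {a b} ha hb g hg => by
      classical
      by_contra hgP
      apply hg
      rw [HeckeAlgebra.expansion_mul,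
        ← Finsupp.sum_single (HeckeAlgebra.expansion b), Finsupp.sum, map_sum,
        Finsupp.finsetSum_apply]
      refine Finset.sum_eq_zero fun c hc => ?_
      have hcP : c.out ∈ P := hb _ (by
        rw [coset_out]
        exact Finsupp.mem_support_iff.1 hc)
      rw [← coset_out U c, HeckeAlgebra.act_coset, coset_out]
      have hz : translate U c.out (HeckeAlgebra.expansion a) (coset U g) = 0 := by
        by_contra hne
        have hmem := Finsupp.mapDomain_support (Finsupp.mem_support_iff.2 hne)
        obtain ⟨e, he, hec⟩ := Finset.mem_image.1 hmem
        have heP : e.out ∈ P := ha _ (by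
          rw [coset_out]
          exact Finsupp.mem_support_iff.1 he)
        rw [← coset_out U e, mulRight_coset, coset_eq_iff] at hec
        apply hgP
        have := P.mul_mem (hUP hec) (P.mul_mem heP hcP)
        rwa [inv_mul_cancel_right] at this
      rw [Finsupp.smul_apply, hz, smul_zero] }

end Hecke

section TensorProduct

open scoped TensorProduct

/-- The multiplication map `⨂ᵢ Bᵢ → A`, `⨂ᵢ bᵢ ↦ b₀ b₁ ⋯ bₙ₋₁`, of a finite sequence of
subalgebras of `A`. -/
def tensorMulMap {R A : Type*} [CommRing R] [Ring A] [Algebra R A] {n : ℕ}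
    (B : Fin n → Subalgebra R A) : (⨂[R] i, B i) →ₗ[R] A :=
  PiTensorProduct.lift
    ((MultilinearMap.mkPiAlgebraFin R n A).compLinearMap fun i => (B i).val.toLinearMap)

/-- `A` is the tensor product of the family `C` of subalgebras, in the sense of the (restricted)
tensor product of algebras over a possibly infinite index set, i.e. of the direct limit of the
tensor products of finitely many members: different members commute elementwise, the multiplication
map of every finite selection of different members is injective, and the images of these maps
exhaust `A`. -/
structure IsInternalTensorProduct {R A ι : Type*} [CommRing R] [Ring A] [Algebra R A]
    (C : ι → Subalgebra R A) : Prop where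
  commute : ∀ i j, i ≠ j → ∀ a ∈ C i, ∀ b ∈ C j, a * b = b * a
  injective : ∀ (n : ℕ) (s : Fin n → ι), Function.Injective s →
    Function.Injective (tensorMulMap fun k => C (s k))
  exhaust : ∀ a : A, ∃ (n : ℕ) (s : Fin n → ι), Function.Injective s ∧
    a ∈ LinearMap.range (tensorMulMap fun k => C (s k))

end TensorProduct

namespace Paramodular

open Matrix

/-- Real `4 × 4` matrices, written in blocks of size `2 × 2`. -/
abbrev Mat4 : Type := Matrix (Fin 2 ⊕ Fin 2) (Fin 2 ⊕ Fin 2) ℝ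

/-- The real symplectic group `Sp₂(ℝ)` of degree `2`. -/
abbrev Sp2 : Type := symplecticGroup (Fin 2) ℝ

/-- The matrix has integral entries. -/
def IsIntegral (M : Mat4) : Prop :=
  ∃ A : Matrix (Fin 2 ⊕ Fin 2) (Fin 2 ⊕ Fin 2) ℤ, M = A.map (fun z : ℤ => (z : ℝ))

theorem IsIntegral.mul {A B : Mat4} (hA : IsIntegral A) (hB : IsIntegral B) :
    IsIntegral (A * B) := by
  obtain ⟨A, rfl⟩ := hA
  obtain ⟨B, rfl⟩ := hB
  exact ⟨A * B, (Matrix.map_mul (f := Int.castRingHom ℝ)).symm⟩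

/-- The group `𝔾` of all `M ∈ Sp₂(ℝ)` of the form `(1 / √m) A` with `A` integral and `m` a
positive integer. -/
def bigG : Subgroup Sp2 where
  carrier := {M | ∃ m : ℕ, 0 < m ∧ IsIntegral (Real.sqrt m • (M : Mat4))}
  one_mem' := ⟨1, one_pos, 1, by
    ext i j
    simp [Matrix.one_apply]⟩
  mul_mem' := by
    rintro A B ⟨m, hm, hA⟩ ⟨n, hn, hB⟩
    refine ⟨m * n, Nat.mul_pos hm hn, ?_⟩
    have h := hA.mul hB
    rwa [Matrix.smul_mul, Matrix.mul_smul, smul_smul, ← Real.sqrt_mul (Nat.cast_nonneg m),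
      ← Nat.cast_mul] at h
  inv_mem' := by
    rintro A ⟨m, hm, B, hB⟩
    refine ⟨m, hm, (-J (Fin 2) ℤ) * Bᵀ * J (Fin 2) ℤ, ?_⟩
    have hJ : (J (Fin 2) ℤ).map (fun z : ℤ => (z : ℝ)) = J (Fin 2) ℝ :=
      Matrix.map_J (Fin 2) (Int.castRingHom ℝ)
    have hT : Bᵀ.map (fun z : ℤ => (z : ℝ)) = Real.sqrt m • (A : Mat4)ᵀ := by
      rw [Matrix.transpose_map, ← hB, Matrix.transpose_smul]
    have e1 : ((-J (Fin 2) ℤ) * Bᵀ * J (Fin 2) ℤ).map (fun z : ℤ => (z : ℝ)) =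
        (-J (Fin 2) ℤ).map (fun z : ℤ => (z : ℝ)) * Bᵀ.map (fun z : ℤ => (z : ℝ)) *
          (J (Fin 2) ℤ).map (fun z : ℤ => (z : ℝ)) := by
      have h1 := Matrix.map_mul (f := Int.castRingHom ℝ) (L := (-J (Fin 2) ℤ) * Bᵀ)
        (M := J (Fin 2) ℤ)
      have h2 := Matrix.map_mul (f := Int.castRingHom ℝ) (L := -J (Fin 2) ℤ) (M := Bᵀ)
      rw [h2] at h1
      exact h1
    have e2 : (-J (Fin 2) ℤ).map (fun z : ℤ => (z : ℝ)) = -J (Fin 2) ℝ := by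
      rw [← hJ]
      ext i j
      simp
    rw [e1, e2, hJ, hT, SymplecticGroup.coe_inv]
    simp

/-- The matrix has the shape of the elements of the paramodular group of level `N`. -/
def HasParamodularForm (N : ℕ) (M : Mat4) : Prop :=
  ∃ a₁ a₂ a₃ a₄ b₁ b₂ b₃ b₄ c₁ c₂ c₃ c₄ d₁ d₂ d₃ d₄ : ℤ,
    M = Matrix.fromBlocks
      !![(a₁ : ℝ), a₂ * N; a₃, a₄]
      !![(b₁ : ℝ), b₂; b₃, b₄ / N]
      !![(c₁ : ℝ), c₂ * N; c₃ * N, c₄ * N]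
      !![(d₁ : ℝ), d₂; d₃ * N, d₄]

/-- The paramodular group `Σ_N`, as a set. -/
def paramodular (N : ℕ) : Set Sp2 := {M | HasParamodularForm N (M : Mat4)}

/-- The matrices `W_d = diag(V_d, (V_d')⁻¹)`, `d ∣ N`, for all admissible choices of
`V_d = (1 / √d) (α d, β N; γ, δ d)` of determinant `1`. -/
def atkinLehner (N : ℕ) : Set Sp2 :=
  {M | ∃ (d : ℕ) (α β γ δ : ℤ) (V : Matrix (Fin 2) (Fin 2) ℝ), d ∣ N ∧
    V = (1 / Real.sqrt d) • !![(α : ℝ) * d, β * N; γ, δ * d] ∧ V.det = 1 ∧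
    (M : Mat4) = Matrix.fromBlocks V 0 0 (Vᵀ)⁻¹}

/-- The extended paramodular group `Σ*_N`, generated by `Σ_N` and the `W_d`, `d ∣ N`. -/
def extendedParamodular (N : ℕ) : Subgroup Sp2 :=
  Subgroup.closure (paramodular N ∪ atkinLehner N)

theorem extendedParamodular_le_bigG {N : ℕ} (hN : N ≠ 0) : extendedParamodular N ≤ bigG := by
  have hN' : (N : ℝ) ≠ 0 := Nat.cast_ne_zero.2 hN
  refine (Subgroup.closure_le _).2 ?_
  rintro M (⟨a₁, a₂, a₃, a₄, b₁, b₂, b₃, b₄, c₁, c₂, c₃, c₄, d₁, d₂, d₃, d₄, hM⟩ |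
    ⟨d, α, β, γ, δ, V, hd, rfl, hdet, hM⟩)
  · refine ⟨N ^ 2, by positivity, Matrix.fromBlocks
      !![N * a₁, N * (a₂ * N); N * a₃, N * a₄] !![N * b₁, N * b₂; N * b₃, b₄]
      !![N * c₁, N * (c₂ * N); N * (c₃ * N), N * (c₄ * N)]
      !![N * d₁, N * d₂; N * (d₃ * N), N * d₄], ?_⟩
    rw [hM, Nat.cast_pow, Real.sqrt_sq (Nat.cast_nonneg N)]
    ext i j
    rcases i with i | i <;> rcases j with j | j <;> fin_cases i <;> fin_cases j <;>
      simp
    field_simp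
  · have hd0 : 0 < d := Nat.pos_of_dvd_of_pos hd (Nat.pos_of_ne_zero hN)
    have hs : Real.sqrt d ≠ 0 := Real.sqrt_ne_zero'.2 (by exact_mod_cast hd0)
    refine ⟨d, hd0, Matrix.fromBlocks !![α * d, β * N; γ, δ * d] 0 0
      !![δ * d, -γ; -(β * N), α * d], ?_⟩
    rw [hM, Matrix.inv_def, Matrix.det_transpose, hdet]
    ext i j
    rcases i with i | i <;> rcases j with j | j <;> fin_cases i <;> fin_cases j <;>
      simp [Matrix.adjugate_fin_two, hs]

/-- `Σ*_N` as a subgroup of `𝔾`. -/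
abbrev SigmaStar (N : ℕ) : Subgroup bigG := (extendedParamodular N).subgroupOf bigG

/-- The matrix `(1 / √m) diag(a₁, a₂, d₁, d₂)` with `a₁ d₁ = a₂ d₂ = m`, as an element of `𝔾`. -/
def diagElement (m : ℕ) (hm : 0 < m) (a d : Fin 2 → ℤ) (h : ∀ i, a i * d i = m) : bigG :=
  ⟨⟨(1 / Real.sqrt m) • Matrix.fromBlocks (Matrix.diagonal fun i => (a i : ℝ)) 0 0
      (Matrix.diagonal fun i => (d i : ℝ)), by
    have hs : Real.sqrt m * Real.sqrt m = m := Real.mul_self_sqrt (Nat.cast_nonneg m)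
    have hm0 : (m : ℝ) ≠ 0 := by exact_mod_cast hm.ne'
    have hs0 : Real.sqrt m ≠ 0 := fun h0 => hm0 (by rw [← hs, h0, zero_mul])
    have hc : (1 / Real.sqrt m) * (1 / Real.sqrt m) * m = 1 := by
      field_simp
      rw [sq, hs]
    have h1 : (fun i => (a i : ℝ) * (d i : ℝ)) = fun _ => (m : ℝ) := by
      funext i
      exact_mod_cast h i
    have h2 : (fun i => (d i : ℝ) * (a i : ℝ)) = fun _ => (m : ℝ) := by
      rw [← h1]
      funext i
      exact mul_comm _ _
    rw [SymplecticGroup.mem_iff, J, Matrix.transpose_smul, Matrix.smul_mul, Matrix.smul_mul,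
      Matrix.mul_smul, smul_smul, Matrix.fromBlocks_transpose, Matrix.fromBlocks_multiply,
      Matrix.fromBlocks_multiply, Matrix.fromBlocks_smul]
    simp only [Matrix.transpose_zero, Matrix.diagonal_transpose, Matrix.mul_zero, Matrix.zero_mul,
      Matrix.mul_one, Matrix.mul_neg, Matrix.neg_mul, zero_add, add_zero, neg_zero, smul_zero,
      smul_neg, Matrix.diagonal_mul_diagonal, h1, h2]
    have h3 : ((1 / Real.sqrt m) * (1 / Real.sqrt m)) • Matrix.diagonal (fun _ : Fin 2 => (m : ℝ))
        = 1 := by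
      rw [← Matrix.diagonal_smul]
      simp only [Pi.smul_def, smul_eq_mul, hc]
      exact Matrix.diagonal_one
    rw [h3]⟩,
   ⟨m, hm, Matrix.fromBlocks (Matrix.diagonal a) 0 0 (Matrix.diagonal d), by
    have hs0 : Real.sqrt m ≠ 0 := Real.sqrt_ne_zero'.2 (by exact_mod_cast hm)
    rw [smul_smul, mul_one_div_cancel hs0, one_smul, Matrix.fromBlocks_map,
      Matrix.diagonal_map (by simp), Matrix.diagonal_map (by simp)]
    simp⟩⟩

/-- The Hecke algebra `ℋ(Σ*_N, 𝔾)` over `ℤ`. -/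
abbrev HeckeAlg (N : ℕ) : Type := Hecke.HeckeAlgebra (SigmaStar N)

/-- The double coset `T*_{N,1}(p) = Σ*_N (1 / √p) diag(1, 1, p, p) Σ*_N`. -/
def T1 (N : ℕ) (p : Nat.Primes) : HeckeAlg N :=
  Hecke.doubleCoset (SigmaStar N)
    (diagElement p p.2.pos ![1, 1] ![(p : ℕ), (p : ℕ)] (by
      intro i
      fin_cases i <;> simp))

/-- The double coset `T*_{N,2}(p) = Σ*_N (1 / p) diag(1, p, p², p) Σ*_N`. -/
def T2 (N : ℕ) (p : Nat.Primes) : HeckeAlg N :=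
  Hecke.doubleCoset (SigmaStar N)
    (diagElement ((p : ℕ) ^ 2) (pow_pos p.2.pos 2) ![1, (p : ℕ)] ![(p : ℕ) ^ 2, (p : ℕ)] (by
      intro i
      fin_cases i <;> simp [sq]))

/-- The `p`-primary part of `𝔾` with respect to `Σ*_N`: the subgroup generated by `Σ*_N` and all
`M ∈ 𝔾` for which some `√(p ^ r) M` has the shape of the elements of `Σ_N`. -/
def primaryGroup (N : ℕ) (p : Nat.Primes) : Subgroup bigG :=
  SigmaStar N ⊔ Subgroup.closure
    {M : bigG | ∃ r : ℕ, HasParamodularForm N (Real.sqrt ((p : ℕ) ^ r : ℕ) • ((M : Sp2) : Mat4))}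

/-- The `p`-primary component of `ℋ(Σ*_N, 𝔾)`. -/
def primaryComponent (N : ℕ) (p : Nat.Primes) : Subalgebra ℤ (HeckeAlg N) :=
  Hecke.heckeSubalgebra (SigmaStar N) (primaryGroup N p) le_sup_left

end Paramodular

end

noncomputable section

namespace Hecke

variable {G : Type*} [Group G] {U : Subgroup G}

theorem mulRight_injective (h : G) : Function.Injective (mulRight U h) := fun a b hab => by
  have := congrArg (mulRight U h⁻¹) hab
  simpa [mulRight_mulRight, mulRight_one] using this

/-- Right multiplication as a permutation of the right cosets. -/
def mulRightEquiv (h : G) : RightCosets U ≃ RightCosets U where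
  toFun := mulRight U h
  invFun := mulRight U h⁻¹
  left_inv c := by simp [mulRight_mulRight, mulRight_one]
  right_inv c := by simp [mulRight_mulRight, mulRight_one]

theorem translate_apply (h : G) (x : RightCosets U →₀ ℤ) (c : RightCosets U) :
    translate U h x (mulRight U h c) = x c :=
  Finsupp.mapDomain_apply (mulRight_injective h) x c

theorem translate_apply_coset (h k : G) (x : RightCosets U →₀ ℤ) :
    translate U h x (coset U k) = x (coset U (k * h⁻¹)) := by
  rw [← translate_apply h x, mulRight_coset, inv_mul_cancel_right]

/-- The coefficient of the right coset `U g`. -/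
def coeff (T : HeckeAlgebra U) (g : G) : ℤ := HeckeAlgebra.expansion T (coset U g)

theorem coset_mul_left {u : G} (hu : u ∈ U) (g : G) : coset U (u * g) = coset U g := by
  rw [coset_eq_iff]
  simpa using U.inv_mem hu

theorem coeff_mul_left (T : HeckeAlgebra U) {u : G} (hu : u ∈ U) (g : G) :
    coeff T (u * g) = coeff T g := by
  rw [coeff, coset_mul_left hu, coeff]

theorem coeff_mul_right (T : HeckeAlgebra U) {u : G} (hu : u ∈ U) (g : G) :
    coeff T (g * u) = coeff T g := by
  rw [coeff, ← HeckeAlgebra.translate_expansion T hu, translate_apply_coset,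
    mul_inv_cancel_right, coeff]

theorem coeff_out (T : HeckeAlgebra U) (c : RightCosets U) :
    coeff T c.out = HeckeAlgebra.expansion T c := by
  rw [coeff, coset_out]

theorem ext_coeff {T S : HeckeAlgebra U} (h : ∀ g, coeff T g = coeff S g) : T = S :=
  HeckeAlgebra.expansion_injective (Finsupp.ext fun c => by
    rw [← coeff_out, ← coeff_out, h])

/-- Additivity of the coefficients. -/
def coeffHom (g : G) : HeckeAlgebra U →+ ℤ :=
  (Finsupp.applyAddHom (coset U g)).comp HeckeAlgebra.expansion

theorem coeffHom_apply (g : G) (T : HeckeAlgebra U) : coeffHom g T = coeff T g := rfl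

theorem coeff_one [DecidablePred (· ∈ U)] (g : G) :
    coeff (1 : HeckeAlgebra U) g = if g ∈ U then 1 else 0 := by
  classical
  rw [coeff, HeckeAlgebra.expansion_one, Finsupp.single_apply]
  have : coset U 1 = coset U g ↔ g ∈ U := by simp [coset_eq_iff]
  simp only [this]

theorem coeff_product (T S : HeckeAlgebra U) (k : G) :
    coeff (T * S) k = ∑ c ∈ (HeckeAlgebra.expansion S).support,
      HeckeAlgebra.expansion S c * coeff T (k * c.out⁻¹) := by
  rw [coeff, HeckeAlgebra.expansion_mul]
  conv_lhs => rw [← Finsupp.sum_single (HeckeAlgebra.expansion S), Finsupp.sum, map_sum,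
    Finsupp.finsetSum_apply]
  refine Finset.sum_congr rfl fun c _ => ?_
  rw [← coset_out U c, HeckeAlgebra.act_coset, Finsupp.smul_apply, translate_apply_coset,
    smul_eq_mul, coset_out, coeff]

theorem coeff_product_finsum (T S : HeckeAlgebra U) (k : G) :
    coeff (T * S) k = ∑ᶠ c : RightCosets U, coeff S c.out * coeff T (k * c.out⁻¹) := by
  rw [coeff_product, finsum_eq_sum_of_support_subset _ (s := (HeckeAlgebra.expansion S).support)]
  · simp only [coeff_out]
  · intro c hc
    rw [Finset.mem_coe, Finsupp.mem_support_iff]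
    intro h
    apply hc
    simp [coeff_out, h]

/-- If `T` and `S` have non-zero coefficients at factors of `k` only for a single right coset
`U h`, the coefficient of the product at `k` is the product of the two coefficients. -/
theorem coeff_product_of_unique (T S : HeckeAlgebra U) (k h : G)
    (huniq : ∀ h', coeff S h' ≠ 0 → coeff T (k * h'⁻¹) ≠ 0 → h' * h⁻¹ ∈ U) :
    coeff (T * S) k = coeff S h * coeff T (k * h⁻¹) := by
  have hc : ∀ (A B : HeckeAlgebra U) (g g' : G), coset U g = coset U g' →
      coeff B g * coeff A (k * g⁻¹) = coeff B g' * coeff A (k * g'⁻¹) := by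
    intro A B g g' hg
    have hu := (coset_eq_iff U g g').1 hg
    have e1 : g' = (g' * g⁻¹) * g := by simp
    have e2 : k * g⁻¹ = (k * g'⁻¹) * (g' * g⁻¹) := by group
    rw [e2, coeff_mul_right A hu]
    congr 1
    conv_rhs => rw [e1, coeff_mul_left B hu]
  rw [coeff_product_finsum, finsum_eq_single _ (coset U h)]
  · exact hc T S _ _ (coset_out U _)
  · intro c hne
    by_contra h0
    obtain ⟨h1, h2⟩ := mul_ne_zero_iff.1 h0
    apply hne
    rw [← coset_out U c, eq_comm, coset_eq_iff]
    exact huniq _ h1 h2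

theorem exists_of_coeff_product_ne_zero {T S : HeckeAlgebra U} {k : G}
    (h : coeff (T * S) k ≠ 0) : ∃ h', coeff S h' ≠ 0 ∧ coeff T (k * h'⁻¹) ≠ 0 := by
  rw [coeff_product] at h
  obtain ⟨c, -, hc⟩ := Finset.exists_ne_zero_of_sum_ne_zero h
  obtain ⟨h1, h2⟩ := mul_ne_zero_iff.1 hc
  exact ⟨c.out, by rwa [coeff_out], h2⟩

/-- The Hecke algebra is commutative if inversion fixes all double cosets. -/
theorem mul_comm_of_inv_mem (hinv : ∀ g : G, ∃ u ∈ U, ∃ v ∈ U, g⁻¹ = u * g * v)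
    (T S : HeckeAlgebra U) : T * S = S * T := by
  have hc : ∀ (A : HeckeAlgebra U) (g : G), coeff A g⁻¹ = coeff A g := by
    intro A g
    obtain ⟨u, hu, v, hv, h⟩ := hinv g
    rw [h, coeff_mul_right A hv, coeff_mul_left A hu]
  refine ext_coeff fun k => ?_
  rw [← hc (S * T) k, coeff_product_finsum, coeff_product_finsum,
    ← finsum_comp_equiv (mulRightEquiv k)]
  refine finsum_congr fun c => ?_
  obtain ⟨u, hu, h⟩ : ∃ u ∈ U, (mulRightEquiv k c).out = u * (c.out * k) := by
    have h1 : coset U (mulRightEquiv k c).out = coset U (c.out * k) := by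
      rw [coset_out, ← mulRight_coset, coset_out]; rfl
    refine ⟨_, U.inv_mem ((coset_eq_iff U _ _).1 h1), by group⟩
  have e1 : k * (u * (c.out * k))⁻¹ = c.out⁻¹ * u⁻¹ := by group
  have e2 : k⁻¹ * c.out⁻¹ = (c.out * k)⁻¹ := by group
  rw [h, coeff_mul_left S hu, e1, coeff_mul_right T (U.inv_mem hu), hc T, e2, hc S, mul_comm]

open Classical in
theorem coeff_doubleCoset (hU : IsHeckePair U) (g h : G) :
    coeff (doubleCoset U g) h = if ∃ u ∈ U, ∃ v ∈ U, h = u * g * v then 1 else 0 := by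
  have hiff : coset U h ∈ (hU g).toFinset ↔ ∃ u ∈ U, ∃ v ∈ U, h = u * g * v := by
    rw [Set.Finite.mem_toFinset]
    constructor
    · rintro ⟨v, hv, hc⟩
      refine ⟨_, U.inv_mem ((coset_eq_iff U _ _).1 hc), v, hv, by group⟩
    · rintro ⟨u, hu, v, hv, rfl⟩
      exact ⟨v, hv, by rw [mul_assoc, coset_mul_left hu]⟩
  rw [coeff, expansion_doubleCoset U g (hU g), Finsupp.finsetSum_apply]
  simp only [Finsupp.single_apply, Finset.sum_ite_eq', hiff]

theorem mem_heckeSubalgebra {P : Subgroup G} (hUP : U ≤ P) (T : HeckeAlgebra U) :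
    T ∈ heckeSubalgebra U P hUP ↔ ∀ g, coeff T g ≠ 0 → g ∈ P := Iff.rfl

theorem finite_support_coeff (T : HeckeAlgebra U) {I : Type*} (D : I → G)
    (hD : Function.Injective fun i => coset U (D i)) : {i | coeff T (D i) ≠ 0}.Finite := by
  refine Set.Finite.of_finite_image (f := fun i => coset U (D i))
    ((HeckeAlgebra.expansion T).support.finite_toSet.subset ?_) hD.injOn
  rintro _ ⟨i, hi, rfl⟩
  exact Finsupp.mem_support_iff.2 hi

end Hecke

/-- A family which is unitriangular with respect to a family of coordinates of finite support is
linearly independent. -/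
theorem linearIndependent_of_unitriangular {A I : Type*} [AddCommGroup A] (ε : I → A →+ ℤ)
    (M : I → A) (f : I → ℕ) (hdiag : ∀ i, ε i (M i) = 1)
    (htri : ∀ i j, ε j (M i) ≠ 0 → j = i ∨ f j < f i) : LinearIndependent ℤ M := by
  rw [linearIndependent_iff]
  intro c hc
  by_contra hne
  obtain ⟨i, hi, hmax⟩ := c.support.exists_max_image f (Finsupp.support_nonempty_iff.2 hne)
  have h := congrArg (ε i) hc
  rw [Finsupp.linearCombination_apply, Finsupp.sum, map_sum, map_zero,
    Finset.sum_eq_single i] at h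
  · rw [map_zsmul, hdiag, smul_eq_mul, mul_one] at h
    exact Finsupp.mem_support_iff.1 hi h
  · intro j hj hji
    rw [map_zsmul]
    by_contra h0
    rcases htri j i (right_ne_zero_of_smul h0) with h1 | h1
    · exact hji h1.symm
    · exact absurd (hmax j hj) (not_le.2 h1)
  · exact fun h => absurd hi h

/-- The span of a unitriangular family. -/
theorem mem_of_unitriangular {A I : Type*} [AddCommGroup A] (ε : I → A →+ ℤ)
    (hfin : ∀ x, {i | ε i x ≠ 0}.Finite) (hinj : ∀ x, (∀ i, ε i x = 0) → x = 0)
    (M : I → A) (f : I → ℕ) (hdiag : ∀ i, ε i (M i) = 1)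
    (htri : ∀ i j, ε j (M i) ≠ 0 → j = i ∨ f j < f i) (P : I → Prop)
    (hP : ∀ i j, P i → ε j (M i) ≠ 0 → P j) (B : AddSubgroup A) (hB : ∀ i, P i → M i ∈ B)
    (x : A) (hx : ∀ i, ε i x ≠ 0 → P i) : x ∈ B := by
  obtain ⟨n, hn⟩ : ∃ n, ∀ i, ε i x ≠ 0 → f i < n := by
    obtain ⟨n, hn⟩ := ((hfin x).image f).bddAbove
    exact ⟨n + 1, fun i hi => Nat.lt_succ_of_le (hn ⟨i, hi, rfl⟩)⟩
  induction n generalizing x with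
  | zero =>
    rw [hinj x fun i => by
      by_contra h
      exact absurd (hn i h) (Nat.not_lt_zero _)]
    exact B.zero_mem
  | succ n ih =>
    set F := (hfin x).toFinset with hF
    have hy : ∑ i ∈ F, ε i x • M i ∈ B := B.sum_mem fun i hi =>
      B.zsmul_mem (hB i (hx i ((hfin x).mem_toFinset.1 hi))) _
    suffices h : x - ∑ i ∈ F, ε i x • M i ∈ B by simpa using B.add_mem h hy
    refine ih _ ?_ ?_
    · intro j hj
      by_contra hPj
      apply hj
      rw [map_sub, map_sum, not_not.1 (mt (hx j) hPj), Finset.sum_eq_zero, sub_zero]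
      intro i hi
      rw [map_zsmul, not_not.1 (mt (hP i j (hx i ((hfin x).mem_toFinset.1 hi))) hPj), smul_zero]
    · intro j hj
      by_contra hlt
      apply hj
      rw [map_sub, map_sum, Finset.sum_eq_single j]
      · rw [map_zsmul, hdiag, smul_eq_mul, mul_one, sub_self]
      · intro i hi hij
        rw [map_zsmul]
        by_contra h0
        have hi' := hn i ((hfin x).mem_toFinset.1 hi)
        rcases htri i j (right_ne_zero_of_smul h0) with h1 | h1
        · exact hij h1.symm
        · omega
      · intro h
        have h0 : ε j x = 0 := by
          by_contra h1
          exact h ((hfin x).mem_toFinset.2 h1)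
        rw [h0, zero_smul, map_zero]

section PolynomialRing

open MvPolynomial
open scoped TensorProduct

variable {ι K R : Type*} [CommRing K] [CommRing R] [Algebra K R]

theorem injective_of_linearIndependent_basis {M M' κ : Type*} [AddCommGroup M] [Module K M]
    [AddCommGroup M'] [Module K M'] (b : Module.Basis κ K M) (f : M →ₗ[K] M')
    (h : LinearIndependent K (f ∘ b)) : Function.Injective f := by
  intro x y hxy
  rw [← b.linearCombination_repr x, ← b.linearCombination_repr y,
    Finsupp.apply_linearCombination, Finsupp.apply_linearCombination] at hxy
  exact b.repr.injective (h hxy)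

/-- The restriction of an evaluation in doubly indexed variables to one first index. -/
theorem aeval_rename_prodMk {κ : Type*} (T : ι × κ → R) (p : ι) (P : MvPolynomial κ K) :
    aeval (fun i => T (p, i)) P = aeval T (rename (fun i => (p, i)) P) := by
  rw [aeval_rename]; rfl

theorem aeval_slice_injective {κ : Type*} (T : ι × κ → R)
    (hT : Function.Injective (aeval T : MvPolynomial (ι × κ) K →ₐ[K] R)) (p : ι) :
    Function.Injective (aeval (fun i => T (p, i)) : MvPolynomial κ K →ₐ[K] R) := by
  intro P Q h
  rw [aeval_rename_prodMk, aeval_rename_prodMk] at h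
  exact rename_injective _ (fun a b h => (Prod.mk.inj h).2) (hT h)

/-- The subalgebra generated by the algebraically independent elements `T (p, i)` for fixed `p` is a
polynomial ring. -/
def sliceEquiv {κ : Type*} (T : ι × κ → R)
    (hT : Function.Injective (aeval T : MvPolynomial (ι × κ) K →ₐ[K] R)) (p : ι) :
    MvPolynomial κ K ≃ₐ[K] (aeval (fun i => T (p, i)) : MvPolynomial κ K →ₐ[K] R).range :=
  AlgEquiv.ofInjective _ (aeval_slice_injective T hT p)

theorem coe_sliceEquiv {κ : Type*} (T : ι × κ → R)
    (hT : Function.Injective (aeval T : MvPolynomial (ι × κ) K →ₐ[K] R)) (p : ι)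
    (P : MvPolynomial κ K) : (sliceEquiv T hT p P : R) = aeval (fun i => T (p, i)) P := rfl

theorem tensorMulMap_tprod {A : Type*} [CommRing A] [Algebra K A] {n : ℕ}
    (B : Fin n → Subalgebra K A) (b : ∀ k, B k) :
    tensorMulMap B (⨂ₜ[K] k, b k) = ∏ k, (b k : A) := by
  rw [tensorMulMap, PiTensorProduct.lift.tprod, MultilinearMap.compLinearMap_apply,
    MultilinearMap.mkPiAlgebraFin_apply, List.prod_ofFn]
  rfl

/-- The exponent vector assembled from exponent vectors for finitely many first indices. -/
def assembleExponents {κ : Type*} {n : ℕ} (s : Fin n → ι) (d : Fin n → κ →₀ ℕ) : ι × κ →₀ ℕ :=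
  ∑ k, (d k).mapDomain fun i => (s k, i)

theorem assembleExponents_apply {κ : Type*} {n : ℕ} {s : Fin n → ι} (hs : Function.Injective s)
    (d : Fin n → κ →₀ ℕ) (k : Fin n) (i : κ) : assembleExponents s d (s k, i) = d k i := by
  rw [assembleExponents, Finsupp.finsetSum_apply, Finset.sum_eq_single k]
  · exact Finsupp.mapDomain_apply (f := fun i : κ => (s k, i)) (fun a b h => (Prod.mk.inj h).2) _ i
  · intro l _ hl
    refine Finsupp.mapDomain_of_notMem_range _ _ ?_
    rintro ⟨j, hj⟩
    exact hl (hs (Prod.mk.inj hj).1)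
  · simp

theorem assembleExponents_apply_of_notMem {κ : Type*} {n : ℕ} (s : Fin n → ι)
    (d : Fin n → κ →₀ ℕ) (p : ι) (hp : p ∉ Set.range s) (i : κ) :
    assembleExponents s d (p, i) = 0 := by
  rw [assembleExponents, Finsupp.finsetSum_apply]
  refine Finset.sum_eq_zero fun l _ => Finsupp.mapDomain_of_notMem_range _ _ ?_
  rintro ⟨j, hj⟩
  exact hp ⟨l, (Prod.mk.inj hj).1⟩

theorem prod_sliceEquiv_monomial {κ : Type*} (T : ι × κ → R)
    (hT : Function.Injective (aeval T : MvPolynomial (ι × κ) K →ₐ[K] R)) {n : ℕ} (s : Fin n → ι)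
    (d : Fin n → κ →₀ ℕ) :
    ∏ k, (sliceEquiv T hT (s k) (monomial (d k) 1) : R) =
      aeval T (monomial (assembleExponents s d) (1 : K)) := by
  rw [assembleExponents, monomial_sum_one, map_prod]
  refine Finset.prod_congr rfl fun k _ => ?_
  rw [coe_sliceEquiv, aeval_rename_prodMk, rename_monomial]

theorem isInternalTensorProduct_slices {κ : Type*} (T : ι × κ → R)
    (hT : Function.Bijective (aeval T : MvPolynomial (ι × κ) K →ₐ[K] R)) :
    IsInternalTensorProduct fun p : ι =>
      (aeval (fun i => T (p, i)) : MvPolynomial κ K →ₐ[K] R).range where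
  commute _ _ _ a _ b _ := mul_comm a b
  injective n s hs := by
    set b : ∀ k : Fin n, Module.Basis (κ →₀ ℕ) K
        (aeval (fun i => T (s k, i)) : MvPolynomial κ K →ₐ[K] R).range := fun k =>
      (basisMonomials κ K).map (sliceEquiv T hT.1 (s k)).toLinearEquiv with hb
    have hval : ∀ d, tensorMulMap (fun k : Fin n =>
        (aeval (fun i => T (s k, i)) : MvPolynomial κ K →ₐ[K] R).range)
        (Basis.piTensorProduct b d) = aeval T (monomial (assembleExponents s d) (1 : K)) := by
      intro d
      rw [Basis.piTensorProduct_apply, tensorMulMap_tprod, ← prod_sliceEquiv_monomial T hT.1]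
      simp [hb]
    have hli : LinearIndependent K fun e : ι × κ →₀ ℕ => aeval T (monomial e (1 : K)) := by
      have := (basisMonomials (ι × κ) K).linearIndependent.map'
        (aeval T : MvPolynomial (ι × κ) K →ₐ[K] R).toLinearMap (LinearMap.ker_eq_bot.2 hT.1)
      simpa [Function.comp_def] using this
    have hinj : Function.Injective (assembleExponents (κ := κ) s) := by
      intro d d' h
      funext k
      ext i
      rw [← assembleExponents_apply hs d, h, assembleExponents_apply hs]
    have hli' := hli.comp _ hinj
    refine injective_of_linearIndependent_basis (Basis.piTensorProduct b) _ ?_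
    simpa only [Function.comp_def, hval] using hli'
  exhaust a := by
    classical
    obtain ⟨P, rfl⟩ := hT.2 a
    set S : Finset ι := P.vars.image Prod.fst with hS
    refine ⟨S.card, fun k => (S.equivFin.symm k : ι),
      Subtype.val_injective.comp S.equivFin.symm.injective, ?_⟩
    set s : Fin S.card → ι := fun k => (S.equivFin.symm k : ι) with hs
    have hsinj : Function.Injective s := Subtype.val_injective.comp S.equivFin.symm.injective
    have hrange : ∀ p ∈ S, ∃ k, s k = p := fun p hp => ⟨S.equivFin ⟨p, hp⟩, by simp [hs]⟩
    rw [P.as_sum, map_sum]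
    refine Submodule.sum_mem _ fun e he => ?_
    have hmon : monomial e (P.coeff e) = P.coeff e • monomial e (1 : K) := by
      rw [smul_monomial, smul_eq_mul, mul_one]
    rw [hmon, map_smul]
    refine Submodule.smul_mem _ _ ?_
    set d : Fin S.card → κ →₀ ℕ := fun k =>
      e.comapDomain (fun i => (s k, i)) (fun a _ b _ h => (Prod.mk.inj h).2) with hd
    have hde : assembleExponents s d = e := by
      ext ⟨p, i⟩
      by_cases hp : p ∈ Set.range s
      · obtain ⟨k, rfl⟩ := hp
        rw [assembleExponents_apply hsinj]
        rfl
      · rw [assembleExponents_apply_of_notMem s d p hp]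
        by_contra h0
        apply hp
        refine hrange p (Finset.mem_image.2 ⟨(p, i), ?_, rfl⟩)
        exact (mem_vars_iff_mem_support _).2 ⟨e, he, Finsupp.mem_support_iff.2 (Ne.symm h0)⟩
    refine ⟨⨂ₜ[K] k, sliceEquiv T hT.1 (s k) (monomial (d k) 1), ?_⟩
    rw [tensorMulMap_tprod, prod_sliceEquiv_monomial, hde]

theorem aeval_bijective_of_monomials {σ : Type*} (T : σ → R)
    (hli : LinearIndependent K fun e : σ →₀ ℕ => aeval T (monomial e (1 : K)))
    (hspan : ∀ x : R, x ∈ (aeval T : MvPolynomial σ K →ₐ[K] R).range) :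
    Function.Bijective (aeval T : MvPolynomial σ K →ₐ[K] R) := by
  refine ⟨?_, fun x => hspan x⟩
  refine injective_of_linearIndependent_basis (basisMonomials σ K)
    (aeval T : MvPolynomial σ K →ₐ[K] R).toLinearMap ?_
  simpa [Function.comp_def] using hli

end PolynomialRing

namespace Paramodular

open Matrix

local notation "e₁" => (Sum.inl 0 : Fin 2 ⊕ Fin 2)
local notation "e₂" => (Sum.inl 1 : Fin 2 ⊕ Fin 2)
local notation "e₃" => (Sum.inr 0 : Fin 2 ⊕ Fin 2)
local notation "e₄" => (Sum.inr 1 : Fin 2 ⊕ Fin 2)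

section

theorem forall_index {P : Fin 2 ⊕ Fin 2 → Prop} : (∀ i, P i) ↔ P e₁ ∧ P e₂ ∧ P e₃ ∧ P e₄ := by
  simp [Sum.forall, Fin.forall_fin_two, and_assoc]

/-! ### Patterns of divisibility -/

/-- The multiplier of an index: the fourth coordinate is scaled by `N`. -/
def indexScale (N : ℕ) : Fin 2 ⊕ Fin 2 → ℝ := Sum.elim ![1, 1] ![1, N]

/-- The block of an index: `{1, 3}` or `{2, 4}`. -/
def indexBlock : Fin 2 ⊕ Fin 2 → Bool := Sum.elim ![false, true] ![false, true]

/-- The pattern `(d, N; 1, d)`. -/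
def blockWeight (N d : ℕ) : Bool → Bool → ℕ
  | false, true => N
  | true, false => 1
  | _, _ => d

/-- The weights of the entries of the integral matrices `√d M` with `M` in the coset of an
Atkin-Lehner matrix of index `d`. For `d = 1` this is the shape of the paramodular group. -/
def wt (N d : ℕ) (i j : Fin 2 ⊕ Fin 2) : ℝ :=
  indexScale N i / indexScale N j * blockWeight N d (indexBlock i) (indexBlock j)

/-- All entries are integral multiples of the weights `w`. -/
def InPattern (w : Fin 2 ⊕ Fin 2 → Fin 2 ⊕ Fin 2 → ℝ) (X : Mat4) : Prop :=
  ∀ i j, ∃ z : ℤ, X i j = z * w i j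

theorem InPattern.add {w} {X Y : Mat4} (hX : InPattern w X) (hY : InPattern w Y) :
    InPattern w (X + Y) := fun i j => by
  obtain ⟨x, hx⟩ := hX i j
  obtain ⟨y, hy⟩ := hY i j
  exact ⟨x + y, by rw [Matrix.add_apply, hx, hy]; push_cast; ring⟩

theorem InPattern.intSmul {w} {X : Mat4} (hX : InPattern w X) (n : ℤ) :
    InPattern w ((n : ℝ) • X) := fun i j => by
  obtain ⟨x, hx⟩ := hX i j
  exact ⟨n * x, by rw [Matrix.smul_apply, hx, smul_eq_mul]; push_cast; ring⟩

theorem InPattern.mul {w w' w''} {X Y : Mat4} (hX : InPattern w X) (hY : InPattern w' Y)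
    (h : ∀ i j k, ∃ z : ℤ, w i j * w' j k = z * w'' i k) : InPattern w'' (X * Y) := by
  intro i k
  choose x hx using hX
  choose y hy using hY
  choose z hz using h
  refine ⟨∑ j, x i j * y j k * z i j k, ?_⟩
  rw [Matrix.mul_apply]
  push_cast
  rw [Finset.sum_mul]
  refine Finset.sum_congr rfl fun j _ => ?_
  rw [hx, hy]
  linear_combination (x i j * y j k : ℝ) * hz i j k

theorem indexScale_ne_zero {N : ℕ} (hN : N ≠ 0) (i : Fin 2 ⊕ Fin 2) : indexScale N i ≠ 0 := by
  revert i
  simp [indexScale, hN]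

theorem wt_mul_wt {N : ℕ} (hN : N ≠ 0) (d d' : ℕ) (i j k : Fin 2 ⊕ Fin 2) :
    wt N d i j * wt N d' j k = indexScale N i / indexScale N k *
      ((blockWeight N d (indexBlock i) (indexBlock j) *
        blockWeight N d' (indexBlock j) (indexBlock k) : ℕ) : ℝ) := by
  have := indexScale_ne_zero hN j
  have := indexScale_ne_zero hN k
  rw [wt, wt]
  push_cast
  field_simp

theorem wt_mul_wt_one {N d : ℕ} (hN : N ≠ 0) (hd : d ∣ N) (i j k : Fin 2 ⊕ Fin 2) :
    ∃ z : ℤ, wt N d i j * wt N 1 j k = z * wt N d i k := by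
  obtain ⟨z, hz⟩ : ∃ z : ℕ, blockWeight N d (indexBlock i) (indexBlock j) *
      blockWeight N 1 (indexBlock j) (indexBlock k) =
        z * blockWeight N d (indexBlock i) (indexBlock k) := by
    obtain ⟨e, rfl⟩ := hd
    generalize indexBlock i = a
    generalize indexBlock j = b
    generalize indexBlock k = c
    cases a <;> cases b <;> cases c <;> simp only [blockWeight]
    exacts [⟨1, by ring⟩, ⟨d, by ring⟩, ⟨e, by ring⟩, ⟨1, by ring⟩, ⟨1, by ring⟩, ⟨e, by ring⟩,
      ⟨d, by ring⟩, ⟨1, by ring⟩]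
  refine ⟨z, ?_⟩
  rw [wt_mul_wt hN, hz, wt]
  push_cast
  ring

theorem wt_mul_wt_self {N d : ℕ} (hN : N ≠ 0) (hd : d ∣ N) (i j k : Fin 2 ⊕ Fin 2) :
    ∃ z : ℤ, wt N d i j * wt N d j k = z * (d * wt N 1 i k) := by
  obtain ⟨z, hz⟩ : ∃ z : ℕ, blockWeight N d (indexBlock i) (indexBlock j) *
      blockWeight N d (indexBlock j) (indexBlock k) =
        z * (d * blockWeight N 1 (indexBlock i) (indexBlock k)) := by
    obtain ⟨e, rfl⟩ := hd
    generalize indexBlock i = a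
    generalize indexBlock j = b
    generalize indexBlock k = c
    cases a <;> cases b <;> cases c <;> simp only [blockWeight]
    exacts [⟨d, by ring⟩, ⟨1, by ring⟩, ⟨e, by ring⟩, ⟨1, by ring⟩, ⟨1, by ring⟩, ⟨e, by ring⟩,
      ⟨1, by ring⟩, ⟨d, by ring⟩]
  refine ⟨z, ?_⟩
  rw [wt_mul_wt hN, hz, wt]
  push_cast
  ring

/-- The order of all matrices of paramodular shape. -/
abbrev InOrder (N : ℕ) (X : Mat4) : Prop := InPattern (wt N 1) X

theorem InOrder.mul {N : ℕ} (hN : N ≠ 0) {X Y : Mat4} (hX : InOrder N X) (hY : InOrder N Y) :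
    InOrder N (X * Y) := InPattern.mul hX hY (wt_mul_wt_one hN (one_dvd N))

theorem hasParamodularForm_iff {N : ℕ} (hN : N ≠ 0) {M : Mat4} :
    HasParamodularForm N M ↔ InOrder N M := by
  have hN' : (N : ℝ) ≠ 0 := Nat.cast_ne_zero.2 hN
  constructor
  · rintro ⟨a₁, a₂, a₃, a₄, b₁, b₂, b₃, b₄, c₁, c₂, c₃, c₄, d₁, d₂, d₃, d₄, rfl⟩
    simp only [InOrder, InPattern, forall_index]
    refine ⟨⟨⟨a₁, ?_⟩, ⟨a₂, ?_⟩, ⟨b₁, ?_⟩, ⟨b₂, ?_⟩⟩, ⟨⟨a₃, ?_⟩, ⟨a₄, ?_⟩, ⟨b₃, ?_⟩, ⟨b₄, ?_⟩⟩,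
      ⟨⟨c₁, ?_⟩, ⟨c₂, ?_⟩, ⟨d₁, ?_⟩, ⟨d₂, ?_⟩⟩, ⟨⟨c₃, ?_⟩, ⟨c₄, ?_⟩, ⟨d₃, ?_⟩, ⟨d₄, ?_⟩⟩⟩ <;>
      (simp [wt, indexScale, indexBlock, blockWeight, hN']; try field_simp)
  · intro h
    choose z hz using h
    refine ⟨z e₁ e₁, z e₁ e₂, z e₂ e₁, z e₂ e₂, z e₁ e₃, z e₁ e₄, z e₂ e₃, z e₂ e₄,
      z e₃ e₁, z e₃ e₂, z e₄ e₁, z e₄ e₂, z e₃ e₃, z e₃ e₄, z e₄ e₃, z e₄ e₄, ?_⟩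
    ext i j
    rw [hz]
    revert i j
    simp only [forall_index]
    simp [wt, indexScale, indexBlock, blockWeight, hN']
    field_simp

/-! ### Symplectic matrices -/

/-- The symplectic adjoint, which is the inverse for symplectic matrices. -/
def sympAdjoint (X : Mat4) : Mat4 := -J (Fin 2) ℝ * Xᵀ * J (Fin 2) ℝ

theorem coe_inv (g : Sp2) : ((g⁻¹ : Sp2) : Mat4) = sympAdjoint g := SymplecticGroup.coe_inv g

theorem sympAdjoint_eq (X : Mat4) : sympAdjoint X =
    fromBlocks !![X e₃ e₃, X e₄ e₃; X e₃ e₄, X e₄ e₄] !![-X e₁ e₃, -X e₂ e₃; -X e₁ e₄, -X e₂ e₄]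
      !![-X e₃ e₁, -X e₄ e₁; -X e₃ e₂, -X e₄ e₂] !![X e₁ e₁, X e₂ e₁; X e₁ e₂, X e₂ e₂] := by
  ext i j
  revert i j
  simp only [forall_index]
  simp [sympAdjoint, Matrix.mul_apply, J, Matrix.one_apply]

theorem sympAdjoint_smul (c : ℝ) (X : Mat4) : sympAdjoint (c • X) = c • sympAdjoint X := by
  simp [sympAdjoint]

theorem InPattern.sympAdjoint {N d : ℕ} (hN : N ≠ 0) {X : Mat4} (h : InPattern (wt N d) X) :
    InPattern (wt N d) (sympAdjoint X) := by
  have hN' : (N : ℝ) ≠ 0 := Nat.cast_ne_zero.2 hN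
  choose z hz using h
  rw [sympAdjoint_eq]
  simp only [InPattern, forall_index]
  refine ⟨⟨⟨z e₃ e₃, ?_⟩, ⟨z e₄ e₃, ?_⟩, ⟨-z e₁ e₃, ?_⟩, ⟨-z e₂ e₃, ?_⟩⟩,
    ⟨⟨z e₃ e₄, ?_⟩, ⟨z e₄ e₄, ?_⟩, ⟨-z e₁ e₄, ?_⟩, ⟨-z e₂ e₄, ?_⟩⟩,
    ⟨⟨-z e₃ e₁, ?_⟩, ⟨-z e₄ e₁, ?_⟩, ⟨z e₁ e₁, ?_⟩, ⟨z e₂ e₁, ?_⟩⟩,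
    ⟨⟨-z e₃ e₂, ?_⟩, ⟨-z e₄ e₂, ?_⟩, ⟨z e₁ e₂, ?_⟩, ⟨z e₂ e₂, ?_⟩⟩⟩ <;>
    simp [hz, wt, indexScale, indexBlock, blockWeight, hN']

theorem row_relation (g : Sp2) (i j : Fin 2 ⊕ Fin 2) :
    (g : Mat4) i e₃ * (g : Mat4) j e₁ + (g : Mat4) i e₄ * (g : Mat4) j e₂
      - (g : Mat4) i e₁ * (g : Mat4) j e₃ - (g : Mat4) i e₂ * (g : Mat4) j e₄ =
        J (Fin 2) ℝ i j := by
  have h := congrFun (congrFun (SymplecticGroup.mem_iff.1 g.2) i) j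
  rw [← h]
  simp [Matrix.mul_apply, J, Matrix.one_apply]
  ring

theorem column_relation (g : Sp2) (i j : Fin 2 ⊕ Fin 2) :
    (g : Mat4) e₃ i * (g : Mat4) e₁ j + (g : Mat4) e₄ i * (g : Mat4) e₂ j
      - (g : Mat4) e₁ i * (g : Mat4) e₃ j - (g : Mat4) e₂ i * (g : Mat4) e₄ j =
        J (Fin 2) ℝ i j := by
  have h := congrFun (congrFun (SymplecticGroup.mem_iff'.1 g.2) i) j
  rw [← h]
  simp [Matrix.mul_apply, J, Matrix.one_apply]
  ring

end

section

/-! ### Some elements of the extended paramodular group -/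

/-- `SL₂(ℤ)` embedded in the coordinates `1, 3`. -/
def special13 (α β γ δ : ℤ) (h : α * δ - β * γ = 1) : Sp2 :=
  ⟨fromBlocks !![(α : ℝ), 0; 0, 1] !![(β : ℝ), 0; 0, 0] !![(γ : ℝ), 0; 0, 0] !![(δ : ℝ), 0; 0, 1], by
    have h' : (α : ℝ) * δ - β * γ = 1 := by exact_mod_cast h
    rw [SymplecticGroup.mem_iff]
    ext i j
    revert i j
    simp only [forall_index]
    simp [Matrix.mul_apply, J, Matrix.one_apply]
    constructorm* _ ∧ _ <;> first | ring1 | linear_combination h' | linear_combination -h'⟩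

/-- A conjugate of `SL₂(ℤ)` embedded in the coordinates `2, 4`. -/
def special24 (N : ℕ) (hN : N ≠ 0) (α β γ δ : ℤ) (h : α * δ - β * γ = 1) : Sp2 :=
  ⟨fromBlocks !![1, 0; 0, (α : ℝ)] !![0, 0; 0, (β : ℝ) / N] !![0, 0; 0, (γ : ℝ) * N]
      !![1, 0; 0, (δ : ℝ)], by
    have hN' : (N : ℝ) ≠ 0 := Nat.cast_ne_zero.2 hN
    have h' : (α : ℝ) * δ - β * γ = 1 := by exact_mod_cast h
    rw [SymplecticGroup.mem_iff]
    ext i j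
    revert i j
    simp only [forall_index]
    simp [Matrix.mul_apply, J, Matrix.one_apply]
    constructorm* _ ∧ _ <;> field_simp <;>
      first | ring1 | linear_combination h' | linear_combination -h'⟩

/-- An Atkin-Lehner matrix. -/
def levi (N d : ℕ) (hd : 0 < d) (α β γ δ : ℤ) (h : α * δ * d * d - β * γ * N = d) : Sp2 :=
  ⟨fromBlocks ((1 / Real.sqrt d) • !![(α : ℝ) * d, β * N; γ, δ * d]) 0 0
      ((1 / Real.sqrt d) • !![(δ : ℝ) * d, -γ; -(β * N), α * d]), by
    have h' : (α : ℝ) * δ * d * d - β * γ * N = d := by exact_mod_cast h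
    have hs : Real.sqrt d * Real.sqrt d = d := Real.mul_self_sqrt (Nat.cast_nonneg d)
    have hs0 : Real.sqrt d ≠ 0 := Real.sqrt_ne_zero'.2 (by exact_mod_cast hd)
    rw [SymplecticGroup.mem_iff]
    ext i j
    revert i j
    simp only [forall_index]
    simp [Matrix.mul_apply, J, Matrix.one_apply]
    constructorm* _ ∧ _ <;> field_simp <;>
      first | ring1 | linear_combination h' - hs | linear_combination hs - h'⟩

section entries

variable {N : ℕ} {hN : N ≠ 0} {α β γ δ : ℤ} (g : Sp2) (i j : Fin 2 ⊕ Fin 2)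

section
variable (h : α * δ - β * γ = 1)

theorem special13_mul₁ : ((special13 α β γ δ h * g : Sp2) : Mat4) e₁ j =
    α * (g : Mat4) e₁ j + β * (g : Mat4) e₃ j := by
  simp [special13, Matrix.mul_apply]
theorem special13_mul₂ : ((special13 α β γ δ h * g : Sp2) : Mat4) e₂ j = (g : Mat4) e₂ j := by
  simp [special13, Matrix.mul_apply]
theorem special13_mul₃ : ((special13 α β γ δ h * g : Sp2) : Mat4) e₃ j =
    γ * (g : Mat4) e₁ j + δ * (g : Mat4) e₃ j := by
  simp [special13, Matrix.mul_apply]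
theorem special13_mul₄ : ((special13 α β γ δ h * g : Sp2) : Mat4) e₄ j = (g : Mat4) e₄ j := by
  simp [special13, Matrix.mul_apply]
theorem mul_special13₁ : ((g * special13 α β γ δ h : Sp2) : Mat4) i e₁ =
    α * (g : Mat4) i e₁ + γ * (g : Mat4) i e₃ := by
  simp [special13, Matrix.mul_apply, mul_comm]
theorem mul_special13₂ : ((g * special13 α β γ δ h : Sp2) : Mat4) i e₂ = (g : Mat4) i e₂ := by
  simp [special13, Matrix.mul_apply]
theorem mul_special13₃ : ((g * special13 α β γ δ h : Sp2) : Mat4) i e₃ =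
    β * (g : Mat4) i e₁ + δ * (g : Mat4) i e₃ := by
  simp [special13, Matrix.mul_apply, mul_comm]
theorem mul_special13₄ : ((g * special13 α β γ δ h : Sp2) : Mat4) i e₄ = (g : Mat4) i e₄ := by
  simp [special13, Matrix.mul_apply]

theorem special24_mul₁ : ((special24 N hN α β γ δ h * g : Sp2) : Mat4) e₁ j = (g : Mat4) e₁ j := by
  simp [special24, Matrix.mul_apply]
theorem special24_mul₂ : ((special24 N hN α β γ δ h * g : Sp2) : Mat4) e₂ j =
    α * (g : Mat4) e₂ j + β / N * (g : Mat4) e₄ j := by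
  simp [special24, Matrix.mul_apply]
theorem special24_mul₃ : ((special24 N hN α β γ δ h * g : Sp2) : Mat4) e₃ j = (g : Mat4) e₃ j := by
  simp [special24, Matrix.mul_apply]
theorem special24_mul₄ : ((special24 N hN α β γ δ h * g : Sp2) : Mat4) e₄ j =
    γ * N * (g : Mat4) e₂ j + δ * (g : Mat4) e₄ j := by
  simp [special24, Matrix.mul_apply]
theorem mul_special24₁ : ((g * special24 N hN α β γ δ h : Sp2) : Mat4) i e₁ = (g : Mat4) i e₁ := by
  simp [special24, Matrix.mul_apply]
theorem mul_special24₂ : ((g * special24 N hN α β γ δ h : Sp2) : Mat4) i e₂ =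
    α * (g : Mat4) i e₂ + γ * N * (g : Mat4) i e₄ := by
  simp [special24, Matrix.mul_apply, mul_comm]
theorem mul_special24₃ : ((g * special24 N hN α β γ δ h : Sp2) : Mat4) i e₃ = (g : Mat4) i e₃ := by
  simp [special24, Matrix.mul_apply]
theorem mul_special24₄ : ((g * special24 N hN α β γ δ h : Sp2) : Mat4) i e₄ =
    β / N * (g : Mat4) i e₂ + δ * (g : Mat4) i e₄ := by
  simp [special24, Matrix.mul_apply, mul_comm]
end

variable {d : ℕ} {hd : 0 < d} (h : α * δ * d * d - β * γ * N = d)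

theorem levi_mul₁ : ((levi N d hd α β γ δ h * g : Sp2) : Mat4) e₁ j =
    (α * d * (g : Mat4) e₁ j + β * N * (g : Mat4) e₂ j) / Real.sqrt d := by
  simp [levi, Matrix.mul_apply]; ring
theorem levi_mul₂ : ((levi N d hd α β γ δ h * g : Sp2) : Mat4) e₂ j =
    (γ * (g : Mat4) e₁ j + δ * d * (g : Mat4) e₂ j) / Real.sqrt d := by
  simp [levi, Matrix.mul_apply]; ring
theorem levi_mul₄ : ((levi N d hd α β γ δ h * g : Sp2) : Mat4) e₄ j =
    (-(β * N) * (g : Mat4) e₃ j + α * d * (g : Mat4) e₄ j) / Real.sqrt d := by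
  simp [levi, Matrix.mul_apply]; ring
theorem mul_levi₁ : ((g * levi N d hd α β γ δ h : Sp2) : Mat4) i e₁ =
    (α * d * (g : Mat4) i e₁ + γ * (g : Mat4) i e₂) / Real.sqrt d := by
  simp [levi, Matrix.mul_apply]; ring
theorem mul_levi₂ : ((g * levi N d hd α β γ δ h : Sp2) : Mat4) i e₂ =
    (β * N * (g : Mat4) i e₁ + δ * d * (g : Mat4) i e₂) / Real.sqrt d := by
  simp [levi, Matrix.mul_apply]; ring
theorem mul_levi₄ : ((g * levi N d hd α β γ δ h : Sp2) : Mat4) i e₄ =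
    (-γ * (g : Mat4) i e₃ + α * d * (g : Mat4) i e₄) / Real.sqrt d := by
  simp [levi, Matrix.mul_apply]; ring

end entries

theorem mem_extendedParamodular_of_inOrder {N : ℕ} (hN : N ≠ 0) {g : Sp2}
    (hg : InOrder N (g : Mat4)) : g ∈ extendedParamodular N :=
  Subgroup.subset_closure (Or.inl ((hasParamodularForm_iff hN).2 hg))

theorem special13_mem {N : ℕ} {α β γ δ : ℤ} (h : α * δ - β * γ = 1) :
    special13 α β γ δ h ∈ extendedParamodular N :=
  Subgroup.subset_closure (Or.inl
    ⟨α, 0, 0, 1, β, 0, 0, 0, γ, 0, 0, 0, δ, 0, 0, 1, by simp [special13]⟩)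

theorem special24_mem {N : ℕ} (hN : N ≠ 0) {α β γ δ : ℤ} (h : α * δ - β * γ = 1) :
    special24 N hN α β γ δ h ∈ extendedParamodular N :=
  Subgroup.subset_closure (Or.inl
    ⟨1, 0, 0, α, 0, 0, 0, β, 0, 0, 0, γ, 1, 0, 0, δ, by simp [special24]⟩)

theorem levi_mem {N d : ℕ} (hd : 0 < d) (hdN : d ∣ N) {α β γ δ : ℤ}
    (h : α * δ * d * d - β * γ * N = d) : levi N d hd α β γ δ h ∈ extendedParamodular N := by
  have h' : (α : ℝ) * δ * d * d - β * γ * N = d := by exact_mod_cast h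
  have hs : Real.sqrt d * Real.sqrt d = d := Real.mul_self_sqrt (Nat.cast_nonneg d)
  have hs0 : Real.sqrt d ≠ 0 := Real.sqrt_ne_zero'.2 (by exact_mod_cast hd)
  have hdet : ((1 / Real.sqrt d) • !![(α : ℝ) * d, β * N; γ, δ * d]).det = 1 := by
    rw [Matrix.det_fin_two]
    simp
    field_simp
    linear_combination h' - hs
  refine Subgroup.subset_closure (Or.inr ⟨d, α, β, γ, δ, _, hdN, rfl, hdet, ?_⟩)
  rw [Matrix.inv_def, Matrix.det_transpose, hdet]
  ext i j
  revert i j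
  simp only [forall_index]
  simp [levi, Matrix.adjugate_fin_two]

/-- For an Atkin-Lehner matrix `W` of index `d`, the pattern of `√d W`. -/
theorem exists_pattern_of_mem_atkinLehner {N : ℕ} (hN : N ≠ 0) {g : Sp2} (hg : g ∈ atkinLehner N) :
    ∃ d : ℕ, 0 < d ∧ d ∣ N ∧ InPattern (wt N d) (Real.sqrt d • (g : Mat4)) := by
  obtain ⟨d, α, β, γ, δ, V, hd, rfl, hdet, hM⟩ := hg
  have hd0 : 0 < d := Nat.pos_of_dvd_of_pos hd (Nat.pos_of_ne_zero hN)
  have hs : Real.sqrt d ≠ 0 := Real.sqrt_ne_zero'.2 (by exact_mod_cast hd0)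
  have hN' : (N : ℝ) ≠ 0 := Nat.cast_ne_zero.2 hN
  refine ⟨d, hd0, hd, ?_⟩
  rw [hM, Matrix.inv_def, Matrix.det_transpose, hdet]
  simp only [InPattern, forall_index]
  refine ⟨⟨⟨α, ?_⟩, ⟨β, ?_⟩, ⟨0, ?_⟩, ⟨0, ?_⟩⟩, ⟨⟨γ, ?_⟩, ⟨δ, ?_⟩, ⟨0, ?_⟩, ⟨0, ?_⟩⟩,
    ⟨⟨0, ?_⟩, ⟨0, ?_⟩, ⟨δ, ?_⟩, ⟨-γ, ?_⟩⟩, ⟨⟨0, ?_⟩, ⟨0, ?_⟩, ⟨-β, ?_⟩, ⟨α, ?_⟩⟩⟩ <;>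
    simp [Matrix.adjugate_fin_two, wt, indexScale, indexBlock, blockWeight, hs, hN']

/-! ### Denominators of the conjugation action -/

/-- `n` is a denominator for the conjugation with `g` on the order of paramodular shape. -/
def IsDenominator (N n : ℕ) (g : Sp2) : Prop :=
  ∀ X, InOrder N X → InOrder N ((n : ℝ) • ((g : Mat4) * X * ((g⁻¹ : Sp2) : Mat4)))

/-- Matrices which are symmetric with respect to the symplectic adjoint. -/
def IsSympSymm (X : Mat4) : Prop := X * J (Fin 2) ℝ = J (Fin 2) ℝ * Xᵀ

/-- `n` is a denominator for the conjugation with `g` on the symmetric elements of the order of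
paramodular shape. -/
def IsSymmDenominator (N n : ℕ) (g : Sp2) : Prop :=
  ∀ X, InOrder N X → IsSympSymm X →
    InOrder N ((n : ℝ) • ((g : Mat4) * X * ((g⁻¹ : Sp2) : Mat4)))

variable {N : ℕ}

theorem coe_mul_coe_inv (g : Sp2) : (g : Mat4) * ((g⁻¹ : Sp2) : Mat4) = 1 := by
  rw [← Submonoid.coe_mul, mul_inv_cancel, Submonoid.coe_one]

theorem coe_inv_mul_coe (g : Sp2) : ((g⁻¹ : Sp2) : Mat4) * (g : Mat4) = 1 := by
  rw [← Submonoid.coe_mul, inv_mul_cancel, Submonoid.coe_one]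

theorem conj_conj (g h : Sp2) (X : Mat4) (m n : ℕ) :
    (((m * n : ℕ) : ℝ)) • (((g * h : Sp2) : Mat4) * X * (((g * h)⁻¹ : Sp2) : Mat4)) =
      (m : ℝ) • ((g : Mat4) * ((n : ℝ) • ((h : Mat4) * X * ((h⁻¹ : Sp2) : Mat4))) *
        ((g⁻¹ : Sp2) : Mat4)) := by
  rw [_root_.mul_inv_rev, Submonoid.coe_mul, Submonoid.coe_mul]
  simp only [Matrix.mul_smul, Matrix.smul_mul, smul_smul, Nat.cast_mul, Matrix.mul_assoc]

theorem IsSympSymm.smul {X : Mat4} (hX : IsSympSymm X) (c : ℝ) : IsSympSymm (c • X) := by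
  rw [IsSympSymm] at *
  rw [Matrix.smul_mul, hX, Matrix.transpose_smul, Matrix.mul_smul]

theorem IsSympSymm.conj {X : Mat4} (hX : IsSympSymm X) (g : Sp2) :
    IsSympSymm ((g : Mat4) * X * ((g⁻¹ : Sp2) : Mat4)) := by
  rw [IsSympSymm] at *
  have h1 : ((g⁻¹ : Sp2) : Mat4) * J (Fin 2) ℝ = J (Fin 2) ℝ * (g : Mat4)ᵀ := by
    have h := SymplecticGroup.mem_iff.1 g.2
    calc ((g⁻¹ : Sp2) : Mat4) * J (Fin 2) ℝ
        = ((g⁻¹ : Sp2) : Mat4) * ((g : Mat4) * J (Fin 2) ℝ * (g : Mat4)ᵀ) := by rw [h]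
      _ = (((g⁻¹ : Sp2) : Mat4) * (g : Mat4)) * J (Fin 2) ℝ * (g : Mat4)ᵀ := by
          simp only [Matrix.mul_assoc]
      _ = _ := by rw [coe_inv_mul_coe, Matrix.one_mul]
  have h2 : J (Fin 2) ℝ * ((g⁻¹ : Sp2) : Mat4)ᵀ = (g : Mat4) * J (Fin 2) ℝ := by
    have h := SymplecticGroup.mem_iff.1 (g⁻¹).2
    calc J (Fin 2) ℝ * ((g⁻¹ : Sp2) : Mat4)ᵀ
        = ((g : Mat4) * ((g⁻¹ : Sp2) : Mat4)) * (J (Fin 2) ℝ * ((g⁻¹ : Sp2) : Mat4)ᵀ) := by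
          rw [coe_mul_coe_inv, Matrix.one_mul]
      _ = (g : Mat4) * (((g⁻¹ : Sp2) : Mat4) * J (Fin 2) ℝ * ((g⁻¹ : Sp2) : Mat4)ᵀ) := by
          simp only [Matrix.mul_assoc]
      _ = _ := by rw [h]
  calc (g : Mat4) * X * ((g⁻¹ : Sp2) : Mat4) * J (Fin 2) ℝ
      = (g : Mat4) * (X * J (Fin 2) ℝ) * (g : Mat4)ᵀ := by
        rw [Matrix.mul_assoc _ _ (J (Fin 2) ℝ), h1]; simp only [Matrix.mul_assoc]
    _ = ((g : Mat4) * J (Fin 2) ℝ) * Xᵀ * (g : Mat4)ᵀ := by rw [hX]; simp only [Matrix.mul_assoc]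
    _ = _ := by
        rw [← h2, Matrix.transpose_mul, Matrix.transpose_mul]; simp only [Matrix.mul_assoc]

theorem IsDenominator.mul {m n : ℕ} {g h : Sp2} (hg : IsDenominator N m g)
    (hh : IsDenominator N n h) : IsDenominator N (m * n) (g * h) := fun X hX => by
  rw [conj_conj]
  exact hg _ (hh X hX)

theorem IsSymmDenominator.mul {m n : ℕ} {g h : Sp2} (hg : IsSymmDenominator N m g)
    (hh : IsSymmDenominator N n h) : IsSymmDenominator N (m * n) (g * h) := fun X hX hs => by
  rw [conj_conj]
  exact hg _ (hh X hX hs) ((hs.conj h).smul _)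

theorem IsDenominator.symm {n : ℕ} {g : Sp2} (hg : IsDenominator N n g) :
    IsSymmDenominator N n g := fun X hX _ => hg X hX

/-- If `√n g` has integral shape, then `n` is a denominator. -/
theorem isDenominator_of_sqrt_smul (hN : N ≠ 0) {n : ℕ} {g : Sp2}
    (hg : InOrder N (Real.sqrt n • (g : Mat4))) : IsDenominator N n g := fun X hX => by
  have h2 := hg.sympAdjoint hN
  rw [sympAdjoint_smul, ← coe_inv] at h2
  have h := (hg.mul hN hX).mul hN h2
  rwa [Matrix.smul_mul, Matrix.smul_mul, Matrix.mul_smul, smul_smul,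
    Real.mul_self_sqrt (Nat.cast_nonneg n)] at h

theorem isDenominator_one_of_mem_atkinLehner (hN : N ≠ 0) {g : Sp2} {d : ℕ} (hd : 0 < d)
    (hdN : d ∣ N) (hg : InPattern (wt N d) (Real.sqrt d • (g : Mat4))) :
    IsDenominator N 1 g := fun X hX => by
  have h2 := hg.sympAdjoint hN
  rw [sympAdjoint_smul, ← coe_inv] at h2
  have h := (hg.mul hX (wt_mul_wt_one hN hdN)).mul h2 (wt_mul_wt_self hN hdN)
  rw [Matrix.smul_mul, Matrix.smul_mul, Matrix.mul_smul, smul_smul,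
    Real.mul_self_sqrt (Nat.cast_nonneg d)] at h
  have hd' : (d : ℝ) ≠ 0 := by exact_mod_cast hd.ne'
  intro i j
  obtain ⟨z, hz⟩ := h i j
  refine ⟨z, mul_left_cancel₀ hd' ?_⟩
  rw [Nat.cast_one, one_smul]
  rw [Matrix.smul_apply, smul_eq_mul] at hz
  rw [hz]
  ring

/-- The extended paramodular group normalizes the order of paramodular shape. -/
theorem isDenominator_one_of_mem (hN : N ≠ 0) {g : Sp2} (hg : g ∈ extendedParamodular N) :
    IsDenominator N 1 g := by
  suffices h : IsDenominator N 1 g ∧ IsDenominator N 1 g⁻¹ from h.1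
  induction hg using Subgroup.closure_induction with
  | mem g hg =>
    rcases hg with hg | hg
    · have h1 : InOrder N (g : Mat4) := (hasParamodularForm_iff hN).1 hg
      have h2 := h1.sympAdjoint hN
      rw [← coe_inv] at h2
      exact ⟨isDenominator_of_sqrt_smul hN (by simpa using h1),
        isDenominator_of_sqrt_smul hN (by simpa using h2)⟩
    · obtain ⟨d, hd, hdN, h⟩ := exists_pattern_of_mem_atkinLehner hN hg
      have h2 := h.sympAdjoint hN
      rw [sympAdjoint_smul, ← coe_inv] at h2
      exact ⟨isDenominator_one_of_mem_atkinLehner hN hd hdN h,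
        isDenominator_one_of_mem_atkinLehner hN hd hdN h2⟩
  | one => exact ⟨fun X hX => by simpa using hX, fun X hX => by simpa using hX⟩
  | mul g h _ _ hg hh =>
    refine ⟨hg.1.mul hh.1, ?_⟩
    rw [_root_.mul_inv_rev]
    exact hh.2.mul hg.2
  | inv g _ hg => exact ⟨hg.2, by rw [inv_inv]; exact hg.1⟩

theorem IsDenominator.mul_mem (hN : N ≠ 0) {n : ℕ} {g u v : Sp2} (hg : IsDenominator N n g)
    (hu : u ∈ extendedParamodular N) (hv : v ∈ extendedParamodular N) :
    IsDenominator N n (u * g * v) := by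
  simpa using ((isDenominator_one_of_mem hN hu).mul hg).mul (isDenominator_one_of_mem hN hv)

theorem IsSymmDenominator.mul_mem (hN : N ≠ 0) {n : ℕ} {g u v : Sp2}
    (hg : IsSymmDenominator N n g)
    (hu : u ∈ extendedParamodular N) (hv : v ∈ extendedParamodular N) :
    IsSymmDenominator N n (u * g * v) := by
  simpa using ((isDenominator_one_of_mem hN hu).symm.mul hg).mul
    (isDenominator_one_of_mem hN hv).symm

theorem exists_isDenominator (hN : N ≠ 0) {g : Sp2} (hg : g ∈ bigG) :
    ∃ n, 0 < n ∧ IsDenominator N n g := by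
  obtain ⟨m, hm, A, hA⟩ := hg
  have hN' : (N : ℝ) ≠ 0 := Nat.cast_ne_zero.2 hN
  refine ⟨N ^ 2 * m, by positivity, isDenominator_of_sqrt_smul hN ?_⟩
  have e : Real.sqrt ((N ^ 2 * m : ℕ) : ℝ) • (g : Mat4) =
      (N : ℝ) • A.map (fun z : ℤ => (z : ℝ)) := by
    rw [Nat.cast_mul, Nat.cast_pow, Real.sqrt_mul (by positivity), Real.sqrt_sq (by positivity),
      mul_smul, hA]
  rw [e]
  have hw : ∀ i j, ∃ z : ℤ, (N : ℝ) = z * wt N 1 i j := by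
    simp only [forall_index]
    refine ⟨⟨⟨N, ?_⟩, ⟨1, ?_⟩, ⟨N, ?_⟩, ⟨N, ?_⟩⟩, ⟨⟨N, ?_⟩, ⟨N, ?_⟩, ⟨N, ?_⟩, ⟨N * N, ?_⟩⟩,
      ⟨⟨N, ?_⟩, ⟨1, ?_⟩, ⟨N, ?_⟩, ⟨N, ?_⟩⟩, ⟨⟨1, ?_⟩, ⟨1, ?_⟩, ⟨1, ?_⟩, ⟨N, ?_⟩⟩⟩ <;>
      simp [wt, indexScale, indexBlock, blockWeight, hN']
  intro i j
  obtain ⟨z, hz⟩ := hw i j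
  refine ⟨A i j * z, ?_⟩
  rw [Matrix.smul_apply, Matrix.map_apply, smul_eq_mul]
  push_cast
  linear_combination (A i j : ℝ) * hz

/-- The matrix unit in position `(1, 3)` as a test element. -/
theorem IsDenominator.column_one (hN : N ≠ 0) {n : ℕ} {g : Sp2} (hg : IsDenominator N n g)
    (i : Fin 2 ⊕ Fin 2) :
    ∃ z : ℤ, (n : ℝ) * ((g : Mat4) i e₁ * (g : Mat4) e₁ e₁) = z * wt N 1 i e₃ := by
  have hN' : (N : ℝ) ≠ 0 := Nat.cast_ne_zero.2 hN
  obtain ⟨z, hz⟩ := hg (Matrix.single e₁ e₃ 1) (by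
    simp only [InPattern, forall_index]
    refine ⟨⟨⟨0, ?_⟩, ⟨0, ?_⟩, ⟨1, ?_⟩, ⟨0, ?_⟩⟩, ⟨⟨0, ?_⟩, ⟨0, ?_⟩, ⟨0, ?_⟩, ⟨0, ?_⟩⟩,
      ⟨⟨0, ?_⟩, ⟨0, ?_⟩, ⟨0, ?_⟩, ⟨0, ?_⟩⟩, ⟨⟨0, ?_⟩, ⟨0, ?_⟩, ⟨0, ?_⟩, ⟨0, ?_⟩⟩⟩ <;>
      simp [wt, indexScale, indexBlock, blockWeight]) i e₃
  refine ⟨z, ?_⟩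
  rw [← hz, coe_inv, sympAdjoint_eq]
  simp [Matrix.mul_apply, Matrix.single_apply]

/-- The isotropic symmetric matrix with non-zero entries in the positions `(1, 4)` and `(2, 3)` as a
test element. -/
theorem IsSymmDenominator.minor (hN : N ≠ 0) {n : ℕ} {g : Sp2} (hg : IsSymmDenominator N n g)
    (i : Fin 2 ⊕ Fin 2) :
    ∃ z : ℤ, (n : ℝ) * ((g : Mat4) i e₂ * (g : Mat4) e₁ e₁ - (g : Mat4) i e₁ * (g : Mat4) e₁ e₂) =
      z * wt N 1 i e₃ := by
  have hN' : (N : ℝ) ≠ 0 := Nat.cast_ne_zero.2 hN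
  obtain ⟨z, hz⟩ := hg (Matrix.single e₂ e₃ 1 - Matrix.single e₁ e₄ 1) (by
    simp only [InPattern, forall_index]
    refine ⟨⟨⟨0, ?_⟩, ⟨0, ?_⟩, ⟨0, ?_⟩, ⟨-1, ?_⟩⟩, ⟨⟨0, ?_⟩, ⟨0, ?_⟩, ⟨1, ?_⟩, ⟨0, ?_⟩⟩,
      ⟨⟨0, ?_⟩, ⟨0, ?_⟩, ⟨0, ?_⟩, ⟨0, ?_⟩⟩, ⟨⟨0, ?_⟩, ⟨0, ?_⟩, ⟨0, ?_⟩, ⟨0, ?_⟩⟩⟩ <;>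
      simp [wt, indexScale, indexBlock, blockWeight, hN']) (by
    rw [IsSympSymm]
    ext i j
    revert i j
    simp only [forall_index]
    simp [Matrix.mul_apply, J, Matrix.single_apply]) i e₃
  refine ⟨z, ?_⟩
  rw [← hz, coe_inv, sympAdjoint_eq]
  simp [Matrix.mul_apply, Matrix.single_apply]
  left
  ring

end

section

/-! ### Arithmetic of integral vectors -/

theorem exists_special_row (a b : ℤ) :
    ∃ α β γ δ : ℤ, α * δ - β * γ = 1 ∧ α * a + β * b = 0 := by
  by_cases h : a = 0 ∧ b = 0
  · exact ⟨1, 0, 0, 1, by ring, by simp [h.1, h.2]⟩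
  · have hg : 0 < Int.gcd a b := Int.gcd_pos_iff.2 (by tauto)
    obtain ⟨g, a', b', -, hco, ha, hb⟩ := Int.exists_gcd_one' hg
    obtain ⟨x, y, hxy⟩ := Int.isCoprime_iff_gcd_eq_one.2 hco
    exact ⟨-b', a', -x, -y, by linear_combination hxy, by rw [ha, hb]; ring⟩

theorem exists_atkinLehner_vector {N : ℕ} (hN : Squarefree N) {a b : ℤ} (h : ¬(a = 0 ∧ b = 0)) :
    ∃ (d e : ℕ) (r s x y : ℤ), 0 < d ∧ d * e = N ∧ a * s = b * (r * d) ∧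
      r * d * x - s * e * y = 1 := by
  have hg : 0 < Int.gcd a b := Int.gcd_pos_iff.2 (by tauto)
  obtain ⟨g, R, s, -, hco, ha, hb⟩ := Int.exists_gcd_one' hg
  have hd : Int.gcd R N ∣ N := by exact_mod_cast Int.gcd_dvd_right R (N : ℤ)
  obtain ⟨r, hr⟩ := Int.gcd_dvd_left R (N : ℤ)
  set d := Int.gcd R N with hd_def
  obtain ⟨e, he⟩ := hd
  have hd0 : 0 < d := Nat.pos_of_ne_zero fun h0 => hN.ne_zero (by rw [he, h0, zero_mul])
  have hde : Nat.Coprime d e := Nat.coprime_of_squarefree_mul (he ▸ hN)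
  have hRe : IsCoprime R (e : ℤ) := by
    rw [Int.isCoprime_iff_gcd_eq_one]
    refine Nat.eq_one_of_dvd_coprimes hde ?_ ?_
    · refine Int.dvd_gcd (Int.gcd_dvd_left R (e : ℤ))
        ((Int.gcd_dvd_right R (e : ℤ)).trans ⟨d, ?_⟩)
      rw [he]; push_cast; ring
    · exact_mod_cast Int.gcd_dvd_right R (e : ℤ)
  obtain ⟨x, y, hxy⟩ := (Int.isCoprime_iff_gcd_eq_one.2 hco).mul_right hRe
  refine ⟨d, e, r, s, x, -y, hd0, he.symm, ?_, ?_⟩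
  · rw [ha, hb, hr]; ring
  · rw [hr] at hxy
    linear_combination hxy

/-! ### Elements of `𝔾` -/

theorem exists_rational_of_mem_bigG {g : Sp2} (hg : g ∈ bigG) :
    ∃ (c : ℝ) (A : Fin 2 ⊕ Fin 2 → Fin 2 ⊕ Fin 2 → ℤ), c ≠ 0 ∧ ∀ i j, (g : Mat4) i j = c * A i j := by
  obtain ⟨m, hm, A, hA⟩ := hg
  have hs : Real.sqrt m ≠ 0 := Real.sqrt_ne_zero'.2 (by exact_mod_cast hm)
  refine ⟨(Real.sqrt m)⁻¹, A, inv_ne_zero hs, fun i j => ?_⟩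
  have h := congrFun (congrFun hA i) j
  rw [Matrix.smul_apply, Matrix.map_apply, smul_eq_mul] at h
  rw [← h, inv_mul_cancel_left₀ hs]

variable {N : ℕ}

theorem mul_mem_bigG (hN : N ≠ 0) {g u v : Sp2} (hg : g ∈ bigG) (hu : u ∈ extendedParamodular N)
    (hv : v ∈ extendedParamodular N) : u * g * v ∈ bigG :=
  bigG.mul_mem (bigG.mul_mem (extendedParamodular_le_bigG hN hu) hg)
    (extendedParamodular_le_bigG hN hv)

/-- Lower triangular with respect to the ordering `1, 2, 4, 3` of the coordinates. -/
structure IsLowerTriangular (g : Sp2) : Prop where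
  h₁₂ : (g : Mat4) e₁ e₂ = 0
  h₁₃ : (g : Mat4) e₁ e₃ = 0
  h₁₄ : (g : Mat4) e₁ e₄ = 0
  h₂₃ : (g : Mat4) e₂ e₃ = 0
  h₂₄ : (g : Mat4) e₂ e₄ = 0
  h₄₃ : (g : Mat4) e₄ e₃ = 0

/-- The Iwasawa decomposition. -/
theorem exists_mul_isLowerTriangular (hN : Squarefree N) {g : Sp2} (hg : g ∈ bigG) :
    ∃ u ∈ extendedParamodular N, IsLowerTriangular (u * g) := by
  have hN0 := hN.ne_zero
  have hN' : (N : ℝ) ≠ 0 := Nat.cast_ne_zero.2 hN0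
  set U := extendedParamodular N with hU
  obtain ⟨u₁, hu₁, h₁⟩ : ∃ u ∈ U, ((u * g : Sp2) : Mat4) e₁ e₃ = 0 := by
    obtain ⟨c, A, -, hA⟩ := exists_rational_of_mem_bigG hg
    obtain ⟨α, β, γ, δ, h, h0⟩ := exists_special_row (A e₁ e₃) (A e₃ e₃)
    refine ⟨special13 α β γ δ h, special13_mem h, ?_⟩
    have h0' : (α : ℝ) * A e₁ e₃ + β * A e₃ e₃ = 0 := by exact_mod_cast h0
    rw [special13_mul₁, hA, hA]
    linear_combination c * h0'
  have hg₁ : u₁ * g ∈ bigG := by simpa using mul_mem_bigG hN0 hg hu₁ U.one_mem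
  have row2 : ∀ g ∈ bigG, ∀ j, ∃ (α β γ δ : ℤ) (h : α * δ - β * γ = 1),
      ((special24 N hN0 α β γ δ h * g : Sp2) : Mat4) e₂ j = 0 := by
    intro g hg j
    obtain ⟨c, A, -, hA⟩ := exists_rational_of_mem_bigG hg
    obtain ⟨α, β, γ, δ, h, h0⟩ := exists_special_row (A e₂ j * N) (A e₄ j)
    refine ⟨α, β, γ, δ, h, ?_⟩
    have h0' : (α : ℝ) * (A e₂ j * N) + β * A e₄ j = 0 := by exact_mod_cast h0
    rw [special24_mul₂, hA, hA]
    field_simp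
    linear_combination c * h0'
  obtain ⟨α, β, γ, δ, h, h₂⟩ := row2 _ hg₁ e₃
  set u₂ := special24 N hN0 α β γ δ h with hu₂_def
  have hu₂ : u₂ ∈ U := special24_mem hN0 h
  have h₁' : ((u₂ * (u₁ * g) : Sp2) : Mat4) e₁ e₃ = 0 := by rw [special24_mul₁, h₁]
  have hg₂ : u₂ * (u₁ * g) ∈ bigG := by simpa using mul_mem_bigG hN0 hg₁ hu₂ U.one_mem
  generalize hk : u₂ * (u₁ * g) = k at h₁' h₂ hg₂
  obtain ⟨u₃, hu₃, h₃₁, h₃₂, h₃₄⟩ : ∃ u ∈ U, ((u * k : Sp2) : Mat4) e₁ e₃ = 0 ∧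
      ((u * k : Sp2) : Mat4) e₂ e₃ = 0 ∧ ((u * k : Sp2) : Mat4) e₄ e₃ = 0 := by
    obtain ⟨c, A, -, hA⟩ := exists_rational_of_mem_bigG hg₂
    obtain ⟨d, e, r, s, x, y, hd, rfl, has, hdet⟩ :=
      exists_atkinLehner_vector hN (a := A e₃ e₃ * N) (b := A e₄ e₃) (by
        rintro ⟨ha, hb⟩
        have ha' := (mul_eq_zero.1 ha).resolve_right (by exact_mod_cast hN0)
        have h := column_relation k e₁ e₃
        rw [h₁', h₂, hA e₃ e₃, hA e₄ e₃, ha', hb] at h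
        simp [J] at h)
    have hs0 : Real.sqrt d ≠ 0 := Real.sqrt_ne_zero'.2 (by exact_mod_cast hd)
    refine ⟨levi (d * e) d hd r s y x (by push_cast; linear_combination (d : ℤ) * hdet),
      levi_mem hd (Dvd.intro _ rfl) _, ?_, ?_, ?_⟩
    · rw [levi_mul₁, h₁', h₂]; simp
    · rw [levi_mul₂, h₁', h₂]; simp
    · rw [levi_mul₄, hA, hA, div_eq_zero_iff]
      left
      have has' : (A e₃ e₃ : ℝ) * ((d * e : ℕ) : ℝ) * s = A e₄ e₃ * (r * d) := by
        exact_mod_cast has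
      linear_combination -c * has'
  have hg₃ : u₃ * k ∈ bigG := by simpa using mul_mem_bigG hN0 hg₂ hu₃ U.one_mem
  have hmem : u₃ * (u₂ * u₁) ∈ U := U.mul_mem hu₃ (U.mul_mem hu₂ hu₁)
  have hk' : u₃ * k = u₃ * (u₂ * u₁) * g := by rw [← hk]; group
  generalize u₃ * k = l at h₃₁ h₃₂ h₃₄ hg₃ hk'
  have hcol : ∀ i, -((l : Mat4) e₁ i * (l : Mat4) e₃ e₃) = J (Fin 2) ℝ i e₃ := fun i => by
    have h := column_relation l i e₃
    rw [h₃₁, h₃₂, h₃₄] at h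
    linear_combination h
  have h33 : (l : Mat4) e₃ e₃ ≠ 0 := fun h0 => by
    have h := hcol e₁
    rw [h0] at h
    simp [J] at h
  have h12 : (l : Mat4) e₁ e₂ = 0 := by
    have h := hcol e₂
    simpa [J, h33] using h
  have h14 : (l : Mat4) e₁ e₄ = 0 := by
    have h := hcol e₄
    simpa [J, h33] using h
  obtain ⟨α', β', γ', δ', h', h₄⟩ := row2 _ hg₃ e₄
  refine ⟨special24 N hN0 α' β' γ' δ' h' * (u₃ * (u₂ * u₁)),
    U.mul_mem (special24_mem hN0 h') hmem, ?_⟩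
  rw [mul_assoc, ← hk']
  refine ⟨?_, ?_, ?_, ?_, h₄, ?_⟩
  · rw [special24_mul₁, h12]
  · rw [special24_mul₁, h₃₁]
  · rw [special24_mul₁, h14]
  · rw [special24_mul₂, h₃₂, h₃₄]; simp
  · rw [special24_mul₄, h₃₂, h₃₄]; simp

/-! ### Elementary divisors -/

/-- The entry in position `(1, 1)` is non-zero and minimal in the double coset. -/
def IsMinimal (N : ℕ) (g : Sp2) : Prop :=
  (g : Mat4) e₁ e₁ ≠ 0 ∧ ∀ u ∈ extendedParamodular N, ∀ v ∈ extendedParamodular N,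
    ((u * g * v : Sp2) : Mat4) e₁ e₁ ≠ 0 → |(g : Mat4) e₁ e₁| ≤ |((u * g * v : Sp2) : Mat4) e₁ e₁|

theorem IsMinimal.mul_mem {g u v : Sp2} (hg : IsMinimal N g) (hu : u ∈ extendedParamodular N)
    (hv : v ∈ extendedParamodular N) (h : ((u * g * v : Sp2) : Mat4) e₁ e₁ = (g : Mat4) e₁ e₁) :
    IsMinimal N (u * g * v) := by
  refine ⟨h ▸ hg.1, fun u' hu' v' hv' h0 => ?_⟩
  have e : u' * (u * g * v) * v' = (u' * u) * g * (v * v') := by group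
  rw [h]
  rw [e] at h0 ⊢
  exact hg.2 _ (Subgroup.mul_mem _ hu' hu) _ (Subgroup.mul_mem _ hv hv') h0

theorem IsMinimal.mul_right {g v : Sp2} (hg : IsMinimal N g)
    (hv : v ∈ extendedParamodular N) (h : ((g * v : Sp2) : Mat4) e₁ e₁ = (g : Mat4) e₁ e₁) :
    IsMinimal N (g * v) := by
  simpa using hg.mul_mem (one_mem _) hv (by simpa using h)

theorem IsMinimal.mul_left {g u : Sp2} (hg : IsMinimal N g)
    (hu : u ∈ extendedParamodular N) (h : ((u * g : Sp2) : Mat4) e₁ e₁ = (g : Mat4) e₁ e₁) :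
    IsMinimal N (u * g) := by
  simpa using hg.mul_mem hu (one_mem _) (by simpa using h)

theorem IsMinimal.le_right {g v : Sp2} (hg : IsMinimal N g) (hv : v ∈ extendedParamodular N)
    (h : ((g * v : Sp2) : Mat4) e₁ e₁ ≠ 0) :
    |(g : Mat4) e₁ e₁| ≤ |((g * v : Sp2) : Mat4) e₁ e₁| := by
  simpa using hg.2 1 (one_mem _) v hv (by simpa using h)

theorem IsMinimal.le_left {g u : Sp2} (hg : IsMinimal N g) (hu : u ∈ extendedParamodular N)
    (h : ((u * g : Sp2) : Mat4) e₁ e₁ ≠ 0) :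
    |(g : Mat4) e₁ e₁| ≤ |((u * g : Sp2) : Mat4) e₁ e₁| := by
  simpa using hg.2 u hu 1 (one_mem _) (by simpa using h)

theorem exists_entry_ne_zero (hN : N ≠ 0) (g : Sp2) :
    ∃ v ∈ extendedParamodular N, ((g * v : Sp2) : Mat4) e₁ e₁ ≠ 0 := by
  have hN' : (N : ℝ) ≠ 0 := Nat.cast_ne_zero.2 hN
  have hs : Real.sqrt N ≠ 0 := Real.sqrt_ne_zero'.2 (by exact_mod_cast Nat.pos_of_ne_zero hN)
  by_cases h1 : (g : Mat4) e₁ e₁ = 0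
  swap
  · exact ⟨1, one_mem _, by simpa using h1⟩
  by_cases h3 : (g : Mat4) e₁ e₃ = 0
  swap
  · exact ⟨special13 0 (-1) 1 0 (by norm_num), special13_mem _, by
      rw [mul_special13₁]; simpa using h3⟩
  have key : ∀ g : Sp2, (g : Mat4) e₁ e₂ ≠ 0 →
      ∃ v ∈ extendedParamodular N, ((g * v : Sp2) : Mat4) e₁ e₁ ≠ 0 := fun g h =>
    ⟨levi N N (Nat.pos_of_ne_zero hN) 0 1 (-1) 0 (by ring), levi_mem _ dvd_rfl _, by
      rw [mul_levi₁]; simp [h, hs]⟩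
  by_cases h2 : (g : Mat4) e₁ e₂ = 0
  swap
  · exact key g h2
  obtain ⟨v, hv, h⟩ := key (g * special24 N hN 0 (-1) 1 0 (by norm_num)) (by
    rw [mul_special24₂]
    have h := row_relation g e₁ e₃
    rw [h1, h2, h3] at h
    have h4 : (g : Mat4) e₁ e₄ ≠ 0 := fun h0 => by
      rw [h0] at h
      simp [J] at h
    simp [hN', h4])
  exact ⟨_, mul_mem (special24_mem hN _) hv, by rwa [← mul_assoc]⟩

theorem exists_isMinimal (hN : N ≠ 0) {g : Sp2} (hg : g ∈ bigG) :
    ∃ u ∈ extendedParamodular N, ∃ v ∈ extendedParamodular N, IsMinimal N (u * g * v) := by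
  classical
  obtain ⟨n, hn, hden⟩ := exists_isDenominator hN hg
  have hn' : (0 : ℝ) < n := by exact_mod_cast hn
  have hint : ∀ u ∈ extendedParamodular N, ∀ v ∈ extendedParamodular N,
      ∃ z : ℕ, (n : ℝ) * ((u * g * v : Sp2) : Mat4) e₁ e₁ ^ 2 = z := by
    intro u hu v hv
    obtain ⟨z, hz⟩ := (hden.mul_mem hN hu hv).column_one hN e₁
    have hw : wt N 1 e₁ e₃ = 1 := by simp [wt, indexScale, indexBlock, blockWeight]
    rw [hw, mul_one, ← sq] at hz
    have hz0 : 0 ≤ z := by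
      have : (0 : ℝ) ≤ z := by rw [← hz]; positivity
      exact_mod_cast this
    lift z to ℕ using hz0
    exact ⟨z, by rw [hz]; simp⟩
  have hex : ∃ z : ℕ, ∃ u ∈ extendedParamodular N, ∃ v ∈ extendedParamodular N,
      ((u * g * v : Sp2) : Mat4) e₁ e₁ ≠ 0 ∧ (n : ℝ) * ((u * g * v : Sp2) : Mat4) e₁ e₁ ^ 2 = z := by
    obtain ⟨v, hv, h⟩ := exists_entry_ne_zero hN g
    obtain ⟨z, hz⟩ := hint 1 (one_mem _) v hv
    exact ⟨z, 1, one_mem _, v, hv, by simpa using h, hz⟩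
  obtain ⟨u, hu, v, hv, h0, hz⟩ := Nat.find_spec hex
  refine ⟨u, hu, v, hv, h0, fun u' hu' v' hv' h' => ?_⟩
  have e : u' * (u * g * v) * v' = (u' * u) * g * (v * v') := by group
  rw [e] at h' ⊢
  obtain ⟨z', hz'⟩ := hint _ (mul_mem hu' hu) _ (mul_mem hv hv')
  have hle : Nat.find hex ≤ z' :=
    Nat.find_min' hex ⟨_, mul_mem hu' hu, _, mul_mem hv hv', h', hz'⟩
  have hle' : ((Nat.find hex : ℕ) : ℝ) ≤ z' := by exact_mod_cast hle
  rw [← hz, ← hz'] at hle'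
  exact sq_le_sq.1 (le_of_mul_le_mul_left hle' hn')

/-- Division with remainder by a minimal element. -/
theorem exists_int_mul_of_forall_le {x y : ℝ} (hx : x ≠ 0)
    (h : ∀ q : ℤ, y - q * x ≠ 0 → |x| ≤ |y - q * x|) : ∃ q : ℤ, y = q * x := by
  refine ⟨⌊y / x⌋, ?_⟩
  by_contra hne
  have h1 := h ⌊y / x⌋ (sub_ne_zero.2 hne)
  have h2 : y - ⌊y / x⌋ * x = Int.fract (y / x) * x := by
    rw [Int.fract]; field_simp
  rw [h2, abs_mul, abs_of_nonneg (Int.fract_nonneg (y / x))] at h1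
  have h3 : 0 < |x| := abs_pos.2 hx
  nlinarith [Int.fract_lt_one (y / x)]

theorem IsMinimal.row₃ {g : Sp2} (hg : IsMinimal N g) :
    ∃ q : ℤ, (g : Mat4) e₁ e₃ = q * (g : Mat4) e₁ e₁ := by
  refine exists_int_mul_of_forall_le hg.1 fun q hq => ?_
  have e : ((g * special13 (-q) (-1) 1 0 (by ring) : Sp2) : Mat4) e₁ e₁ =
      (g : Mat4) e₁ e₃ - q * (g : Mat4) e₁ e₁ := by
    rw [mul_special13₁]; push_cast; ring
  rw [← e] at hq ⊢
  exact hg.le_right (special13_mem _) hq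

theorem IsMinimal.column₃ {g : Sp2} (hg : IsMinimal N g) :
    ∃ q : ℤ, (g : Mat4) e₃ e₁ = q * (g : Mat4) e₁ e₁ := by
  refine exists_int_mul_of_forall_le hg.1 fun q hq => ?_
  have e : ((special13 (-q) 1 (-1) 0 (by ring) * g : Sp2) : Mat4) e₁ e₁ =
      (g : Mat4) e₃ e₁ - q * (g : Mat4) e₁ e₁ := by
    rw [special13_mul₁]; push_cast; ring
  rw [← e] at hq ⊢
  exact hg.le_left (special13_mem _) hq

/-- If an entry `w` with `x = r √d w` satisfies `|x| ≤ |w|`, then `d = 1` and `r = ±1`. -/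
theorem eq_one_of_abs_le {x w : ℝ} {r : ℤ} {d : ℕ} (hd : 0 < d) (hx : x ≠ 0)
    (h : x = r * Real.sqrt d * w) (hle : w ≠ 0 → |x| ≤ |w|) : d = 1 ∧ r * r = 1 := by
  have hw : w ≠ 0 := fun h0 => hx (by rw [h, h0, mul_zero])
  have hr : r ≠ 0 := fun h0 => hx (by rw [h, h0]; simp)
  have h1 := sq_le_sq.2 (hle hw)
  rw [h, mul_pow, mul_pow, Real.sq_sqrt (Nat.cast_nonneg d)] at h1
  have h2 : 0 < w ^ 2 := by positivity
  have h3 : (r : ℝ) ^ 2 * d ≤ 1 := by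
    by_contra h4
    push Not at h4
    nlinarith
  have h4 : r ^ 2 * d ≤ 1 := by exact_mod_cast h3
  have h5 : 0 < r ^ 2 := by positivity
  have h6 : (0 : ℤ) < d := by exact_mod_cast hd
  have h7 : (d : ℤ) = 1 := by nlinarith
  refine ⟨by exact_mod_cast h7, ?_⟩
  rw [h7] at h4
  nlinarith

theorem IsMinimal.row₂ (hN : Squarefree N) {g : Sp2} (hG : g ∈ bigG) (hg : IsMinimal N g) :
    ∃ q : ℤ, (g : Mat4) e₁ e₂ = q * (N * (g : Mat4) e₁ e₁) := by
  obtain ⟨c, A, hc, hA⟩ := exists_rational_of_mem_bigG hG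
  have hN' : (N : ℤ) ≠ 0 := by exact_mod_cast hN.ne_zero
  obtain ⟨d, e, r, s, x, y, hd, hde, has, hdet⟩ :=
    exists_atkinLehner_vector hN (a := A e₁ e₁ * N) (b := A e₁ e₂) (by
      rintro ⟨ha, -⟩
      apply hg.1
      rw [hA, (mul_eq_zero.1 ha).resolve_right hN']
      simp)
  have hs0 : Real.sqrt d ≠ 0 := Real.sqrt_ne_zero'.2 (by exact_mod_cast hd)
  have hss : Real.sqrt d * Real.sqrt d = d := Real.mul_self_sqrt (Nat.cast_nonneg d)
  have hd' : (d : ℝ) ≠ 0 := by exact_mod_cast hd.ne'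
  have hlev : x * r * d * d - (-s) * (-y) * N = d := by
    rw [← hde]; push_cast; linear_combination (d : ℤ) * hdet
  have hdet' : (r : ℝ) * d * x - s * e * y = 1 := by exact_mod_cast hdet
  have hde' : (d : ℝ) * e = N := by exact_mod_cast hde
  have has' : (A e₁ e₁ : ℝ) * N * s = A e₁ e₂ * (r * d) := by exact_mod_cast has
  have hrel : (r : ℝ) * (g : Mat4) e₁ e₂ = e * s * (g : Mat4) e₁ e₁ := by
    refine mul_left_cancel₀ hd' ?_
    rw [hA, hA]
    linear_combination -c * has' - c * A e₁ e₁ * s * hde'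
  obtain ⟨rfl, hr⟩ := eq_one_of_abs_le (r := r) hd hg.1
    (w := ((g * levi N d hd x (-s) (-y) r hlev : Sp2) : Mat4) e₁ e₁) (by
      rw [mul_levi₁]
      field_simp
      push_cast
      linear_combination (-(g : Mat4) e₁ e₁) * hdet' + y * hrel)
    (fun h => hg.le_right (levi_mem hd (Dvd.intro _ hde) _) h)
  refine ⟨s * r, ?_⟩
  have hr' : (r : ℝ) * r = 1 := by exact_mod_cast hr
  rw [Nat.cast_one, one_mul] at hde'
  rw [← hde']
  push_cast
  linear_combination (-(g : Mat4) e₁ e₂) * hr' + r * hrel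

theorem IsMinimal.column₂ (hN : Squarefree N) {g : Sp2} (hG : g ∈ bigG) (hg : IsMinimal N g) :
    ∃ q : ℤ, (g : Mat4) e₂ e₁ = q * (g : Mat4) e₁ e₁ := by
  obtain ⟨c, A, hc, hA⟩ := exists_rational_of_mem_bigG hG
  obtain ⟨d, e, r, s, x, y, hd, hde, has, hdet⟩ :=
    exists_atkinLehner_vector hN (a := A e₁ e₁) (b := A e₂ e₁) (by
      rintro ⟨ha, -⟩
      apply hg.1
      rw [hA, ha]
      simp)
  have hs0 : Real.sqrt d ≠ 0 := Real.sqrt_ne_zero'.2 (by exact_mod_cast hd)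
  have hss : Real.sqrt d * Real.sqrt d = d := Real.mul_self_sqrt (Nat.cast_nonneg d)
  have hd' : (d : ℝ) ≠ 0 := by exact_mod_cast hd.ne'
  have hlev : x * r * d * d - (-y) * (-s) * N = d := by
    rw [← hde]; push_cast; linear_combination (d : ℤ) * hdet
  have hdet' : (r : ℝ) * d * x - s * e * y = 1 := by exact_mod_cast hdet
  have hde' : (d : ℝ) * e = N := by exact_mod_cast hde
  have has' : (A e₁ e₁ : ℝ) * s = A e₂ e₁ * (r * d) := by exact_mod_cast has
  have hrel : (r : ℝ) * d * (g : Mat4) e₂ e₁ = s * (g : Mat4) e₁ e₁ := by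
    rw [hA, hA]
    linear_combination -c * has'
  obtain ⟨rfl, hr⟩ := eq_one_of_abs_le (r := r) hd hg.1
    (w := ((levi N d hd x (-y) (-s) r hlev * g : Sp2) : Mat4) e₁ e₁) (by
      rw [levi_mul₁]
      field_simp
      push_cast
      rw [← hde']
      linear_combination (-(g : Mat4) e₁ e₁) * hdet' + y * e * hrel)
    (fun h => hg.le_left (levi_mem hd (Dvd.intro _ hde) _) h)
  refine ⟨s * r, ?_⟩
  have hr' : (r : ℝ) * r = 1 := by exact_mod_cast hr
  rw [Nat.cast_one, mul_one] at hrel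
  push_cast
  linear_combination (-(g : Mat4) e₂ e₁) * hr' + r * hrel

end

section

variable {N : ℕ}

/-- The first row vanishes outside the diagonal. -/
structure HasClearRow (g : Sp2) : Prop where
  h₂ : (g : Mat4) e₁ e₂ = 0
  h₃ : (g : Mat4) e₁ e₃ = 0
  h₄ : (g : Mat4) e₁ e₄ = 0

/-- The first column vanishes outside the diagonal. -/
structure HasClearColumn (g : Sp2) : Prop where
  h₂ : (g : Mat4) e₂ e₁ = 0
  h₃ : (g : Mat4) e₃ e₁ = 0
  h₄ : (g : Mat4) e₄ e₁ = 0

theorem mul_mem_bigG_right (hN : N ≠ 0) {g v : Sp2} (hg : g ∈ bigG)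
    (hv : v ∈ extendedParamodular N) : g * v ∈ bigG :=
  bigG.mul_mem hg (extendedParamodular_le_bigG hN hv)

theorem mul_mem_bigG_left (hN : N ≠ 0) {g u : Sp2} (hg : g ∈ bigG)
    (hu : u ∈ extendedParamodular N) : u * g ∈ bigG :=
  bigG.mul_mem (extendedParamodular_le_bigG hN hu) hg

theorem IsMinimal.exists_hasClearRow (hN : Squarefree N) {g : Sp2} (hG : g ∈ bigG)
    (hg : IsMinimal N g) : ∃ v ∈ extendedParamodular N,
      ((g * v : Sp2) : Mat4) e₁ e₁ = (g : Mat4) e₁ e₁ ∧ HasClearRow (g * v) := by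
  have hN0 := hN.ne_zero
  have hN' : (N : ℝ) ≠ 0 := Nat.cast_ne_zero.2 hN0
  obtain ⟨v₁, hv₁, h11, h14⟩ : ∃ v ∈ extendedParamodular N,
      ((g * v : Sp2) : Mat4) e₁ e₁ = (g : Mat4) e₁ e₁ ∧ ((g * v : Sp2) : Mat4) e₁ e₄ = 0 := by
    obtain ⟨c, A, -, hA⟩ := exists_rational_of_mem_bigG hG
    obtain ⟨α, β, γ, δ, h, h0⟩ := exists_special_row (A e₁ e₂) (A e₁ e₄ * N)
    refine ⟨special24 N hN0 (-γ) α (-δ) β (by linear_combination h), special24_mem hN0 _,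
      mul_special24₁ _ _ _, ?_⟩
    have h0' : (α : ℝ) * A e₁ e₂ + β * (A e₁ e₄ * N) = 0 := by exact_mod_cast h0
    rw [mul_special24₄, hA, hA]
    field_simp
    linear_combination c * h0'
  have hg₁ := hg.mul_right hv₁ h11
  have hG₁ := mul_mem_bigG_right hN0 hG hv₁
  obtain ⟨q, hq⟩ := hg₁.row₂ hN hG₁
  set v₂ := levi N 1 one_pos 1 (-q) 0 1 (by simp) with hv₂_def
  have hv₂ : v₂ ∈ extendedParamodular N := levi_mem _ (one_dvd N) _
  have h11₂ : ((g * v₁ * v₂ : Sp2) : Mat4) e₁ e₁ = ((g * v₁ : Sp2) : Mat4) e₁ e₁ := by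
    rw [mul_levi₁]; simp
  have h12₂ : ((g * v₁ * v₂ : Sp2) : Mat4) e₁ e₂ = 0 := by
    rw [mul_levi₂, hq]; simp; ring
  have h14₂ : ((g * v₁ * v₂ : Sp2) : Mat4) e₁ e₄ = 0 := by
    rw [mul_levi₄, h14]; simp
  have hg₂ := hg₁.mul_right hv₂ h11₂
  obtain ⟨q', hq'⟩ := hg₂.row₃
  refine ⟨v₁ * v₂ * special13 1 (-q') 0 1 (by ring),
    Subgroup.mul_mem _ (Subgroup.mul_mem _ hv₁ hv₂) (special13_mem _), ?_⟩
  rw [← mul_assoc, ← mul_assoc]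
  refine ⟨?_, ?_, ?_, ?_⟩
  · rw [mul_special13₁, h11₂, h11]; simp
  · rw [mul_special13₂, h12₂]
  · rw [mul_special13₃, hq']; push_cast; ring
  · rw [mul_special13₄, h14₂]

theorem IsMinimal.exists_hasClearColumn (hN : Squarefree N) {g : Sp2} (hG : g ∈ bigG)
    (hg : IsMinimal N g) (hrow : HasClearRow g) : ∃ u ∈ extendedParamodular N,
      ((u * g : Sp2) : Mat4) e₁ e₁ = (g : Mat4) e₁ e₁ ∧ HasClearRow (u * g) ∧
        HasClearColumn (u * g) := by
  have hN0 := hN.ne_zero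
  have hN' : (N : ℝ) ≠ 0 := Nat.cast_ne_zero.2 hN0
  obtain ⟨u₁, hu₁, h1, h41⟩ : ∃ u ∈ extendedParamodular N,
      (∀ j, ((u * g : Sp2) : Mat4) e₁ j = (g : Mat4) e₁ j) ∧ ((u * g : Sp2) : Mat4) e₄ e₁ = 0 := by
    obtain ⟨c, A, -, hA⟩ := exists_rational_of_mem_bigG hG
    obtain ⟨α, β, γ, δ, h, h0⟩ := exists_special_row (A e₂ e₁ * N) (A e₄ e₁)
    refine ⟨special24 N hN0 (-γ) (-δ) α β (by linear_combination h), special24_mem hN0 _,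
      fun j => special24_mul₁ _ j _, ?_⟩
    have h0' : (α : ℝ) * (A e₂ e₁ * N) + β * A e₄ e₁ = 0 := by exact_mod_cast h0
    rw [special24_mul₄, hA, hA]
    linear_combination c * h0'
  have hg₁ := hg.mul_left hu₁ (h1 _)
  have hG₁ := mul_mem_bigG_left hN0 hG hu₁
  obtain ⟨q, hq⟩ := hg₁.column₂ hN hG₁
  set u₂ := levi N 1 one_pos 1 0 (-q) 1 (by simp) with hu₂_def
  have hu₂ : u₂ ∈ extendedParamodular N := levi_mem _ (one_dvd N) _
  have h1₂ : ∀ j, ((u₂ * (u₁ * g) : Sp2) : Mat4) e₁ j = (g : Mat4) e₁ j := fun j => by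
    rw [levi_mul₁, h1]; simp
  have h21₂ : ((u₂ * (u₁ * g) : Sp2) : Mat4) e₂ e₁ = 0 := by
    rw [levi_mul₂, hq]; simp
  have h41₂ : ((u₂ * (u₁ * g) : Sp2) : Mat4) e₄ e₁ = 0 := by
    rw [levi_mul₄, h41]; simp
  have hg₂ := hg₁.mul_left hu₂ (by rw [h1₂, h1])
  obtain ⟨q', hq'⟩ := hg₂.column₃
  refine ⟨special13 1 0 (-q') 1 (by ring) * (u₂ * u₁),
    Subgroup.mul_mem _ (special13_mem _) (Subgroup.mul_mem _ hu₂ hu₁), ?_⟩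
  rw [mul_assoc, mul_assoc]
  have h1₃ : ∀ j, ((special13 1 0 (-q') 1 (by ring) * (u₂ * (u₁ * g)) : Sp2) : Mat4) e₁ j =
      (g : Mat4) e₁ j := fun j => by
    rw [special13_mul₁, h1₂]; simp
  refine ⟨h1₃ _, ⟨?_, ?_, ?_⟩, ?_, ?_, ?_⟩
  · rw [h1₃, hrow.h₂]
  · rw [h1₃, hrow.h₃]
  · rw [h1₃, hrow.h₄]
  · rw [special13_mul₂, h21₂]
  · rw [special13_mul₃, hq']; push_cast; ring
  · rw [special13_mul₄, h41₂]

/-- An element of block form with minimal entries in the positions `(1, 1)` and `(2, 2)`. -/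
structure IsReduced (N : ℕ) (g : Sp2) : Prop where
  minimal : IsMinimal N g
  row : HasClearRow g
  column : HasClearColumn g
  ne_zero : (g : Mat4) e₂ e₂ ≠ 0
  le : ∀ u ∈ extendedParamodular N, ∀ v ∈ extendedParamodular N,
    ((u * g * v : Sp2) : Mat4) e₁ e₁ = (g : Mat4) e₁ e₁ → HasClearRow (u * g * v) →
      HasClearColumn (u * g * v) → ((u * g * v : Sp2) : Mat4) e₂ e₂ ≠ 0 →
        |(g : Mat4) e₂ e₂| ≤ |((u * g * v : Sp2) : Mat4) e₂ e₂|

theorem exists_isReduced (hN : Squarefree N) {g : Sp2} (hG : g ∈ bigG) :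
    ∃ u ∈ extendedParamodular N, ∃ v ∈ extendedParamodular N, IsReduced N (u * g * v) := by
  classical
  have hN0 := hN.ne_zero
  have hN' : (N : ℝ) ≠ 0 := Nat.cast_ne_zero.2 hN0
  obtain ⟨u₀, hu₀, v₀, hv₀, hmin₀⟩ := exists_isMinimal hN0 hG
  set a := ((u₀ * g * v₀ : Sp2) : Mat4) e₁ e₁ with ha
  obtain ⟨n, hn, hden⟩ := exists_isDenominator hN0 hG
  have hna : (0 : ℝ) < n * |a| := mul_pos (by exact_mod_cast hn) (abs_pos.2 hmin₀.1)
  have hint : ∀ u ∈ extendedParamodular N, ∀ v ∈ extendedParamodular N,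
      ((u * g * v : Sp2) : Mat4) e₁ e₁ = a → HasClearRow (u * g * v) →
      ∃ z : ℕ, n * |a| * |((u * g * v : Sp2) : Mat4) e₂ e₂| = z := by
    intro u hu v hv h11 hrow
    obtain ⟨z, hz⟩ := (hden.mul_mem hN0 hu hv).symm.minor hN0 e₂
    have hw : wt N 1 e₂ e₃ = 1 := by simp [wt, indexScale, indexBlock, blockWeight]
    rw [hw, mul_one, hrow.h₂, h11, mul_zero, sub_zero] at hz
    refine ⟨z.natAbs, ?_⟩
    rw [Nat.cast_natAbs, Int.cast_abs, ← hz, abs_mul, abs_mul, Nat.abs_cast]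
    ring
  have hex : ∃ z : ℕ, ∃ u ∈ extendedParamodular N, ∃ v ∈ extendedParamodular N,
      ((u * g * v : Sp2) : Mat4) e₁ e₁ = a ∧ HasClearRow (u * g * v) ∧ HasClearColumn (u * g * v) ∧
      ((u * g * v : Sp2) : Mat4) e₂ e₂ ≠ 0 ∧ n * |a| * |((u * g * v : Sp2) : Mat4) e₂ e₂| = z := by
    have hG₀ := mul_mem_bigG hN0 hG hu₀ hv₀
    obtain ⟨v₁, hv₁, h11, hrow⟩ := hmin₀.exists_hasClearRow hN hG₀
    obtain ⟨u₁, hu₁, h11', hrow', hcol⟩ := (hmin₀.mul_right hv₁ h11).exists_hasClearColumn hN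
      (mul_mem_bigG_right hN0 hG₀ hv₁) hrow
    have e : u₁ * (u₀ * g * v₀ * v₁) = u₁ * u₀ * g * (v₀ * v₁) := by group
    rw [e] at h11' hrow' hcol
    have hu := mul_mem hu₁ hu₀
    have hv := mul_mem hv₀ hv₁
    rw [h11] at h11'
    by_cases h22 : ((u₁ * u₀ * g * (v₀ * v₁) : Sp2) : Mat4) e₂ e₂ = 0
    · set k := u₁ * u₀ * g * (v₀ * v₁) with hk
      set w := special24 N hN0 0 (-1) 1 0 (by norm_num) with hw
      have hwm : w ∈ extendedParamodular N := special24_mem hN0 _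
      have h1 : ((k * w : Sp2) : Mat4) e₁ e₁ = a := by rw [mul_special24₁, h11']
      have hrow₂ : HasClearRow (k * w) := by
        refine ⟨?_, ?_, ?_⟩
        · rw [mul_special24₂, hrow'.h₂, hrow'.h₄]; simp
        · rw [mul_special24₃, hrow'.h₃]
        · rw [mul_special24₄, hrow'.h₂, hrow'.h₄]; simp
      have hcol₂ : HasClearColumn (k * w) := by
        refine ⟨?_, ?_, ?_⟩
        · rw [mul_special24₁, hcol.h₂]
        · rw [mul_special24₁, hcol.h₃]
        · rw [mul_special24₁, hcol.h₄]
      have h22' : ((k * w : Sp2) : Mat4) e₂ e₂ ≠ 0 := by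
        have h := row_relation k e₂ e₄
        rw [h22, hcol.h₂, hcol.h₄] at h
        have h24 : (k : Mat4) e₂ e₄ ≠ 0 := fun h0 => by
          rw [h0] at h
          simp [J] at h
        rw [mul_special24₂, h22]
        simp [hN', h24]
      have e' : k * w = u₁ * u₀ * g * (v₀ * v₁ * w) := by rw [hk, mul_assoc]
      rw [e'] at h1 hrow₂ hcol₂ h22'
      have hvw := mul_mem hv hwm
      obtain ⟨z, hz⟩ := hint _ hu _ hvw h1 hrow₂
      exact ⟨z, _, hu, _, hvw, h1, hrow₂, hcol₂, h22', hz⟩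
    · obtain ⟨z, hz⟩ := hint _ hu _ hv h11' hrow'
      exact ⟨z, _, hu, _, hv, h11', hrow', hcol, h22, hz⟩
  obtain ⟨u, hu, v, hv, h11, hrow, hcol, h22, hz⟩ := Nat.find_spec hex
  refine ⟨u, hu, v, hv, ?_, hrow, hcol, h22, ?_⟩
  · have e : u * g * v = (u * u₀⁻¹) * (u₀ * g * v₀) * (v₀⁻¹ * v) := by group
    rw [e] at h11 ⊢
    exact hmin₀.mul_mem (mul_mem hu (inv_mem hu₀)) (mul_mem (inv_mem hv₀) hv) h11
  · intro u' hu' v' hv' h11' hrow' hcol' h22'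
    have e : u' * (u * g * v) * v' = (u' * u) * g * (v * v') := by group
    rw [e] at h11' hrow' hcol' h22' ⊢
    rw [h11] at h11'
    obtain ⟨z', hz'⟩ := hint _ (mul_mem hu' hu) _ (mul_mem hv hv') h11' hrow'
    have hle : Nat.find hex ≤ z' :=
      Nat.find_min' hex ⟨_, mul_mem hu' hu, _, mul_mem hv hv', h11', hrow', hcol', h22', hz'⟩
    have hle' : ((Nat.find hex : ℕ) : ℝ) ≤ z' := by exact_mod_cast hle
    rw [← hz, ← hz'] at hle'
    exact le_of_mul_le_mul_left hle' hna

theorem HasClearRow.special24_mul {g : Sp2} (h : HasClearRow g) {hN : N ≠ 0} {α β γ δ : ℤ}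
    (hdet : α * δ - β * γ = 1) : HasClearRow (special24 N hN α β γ δ hdet * g) :=
  ⟨by rw [special24_mul₁, h.h₂], by rw [special24_mul₁, h.h₃], by rw [special24_mul₁, h.h₄]⟩

theorem HasClearRow.mul_special24 {g : Sp2} (h : HasClearRow g) {hN : N ≠ 0} {α β γ δ : ℤ}
    (hdet : α * δ - β * γ = 1) : HasClearRow (g * special24 N hN α β γ δ hdet) :=
  ⟨by rw [mul_special24₂, h.h₂, h.h₄]; simp, by rw [mul_special24₃, h.h₃],
    by rw [mul_special24₄, h.h₂, h.h₄]; simp⟩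

theorem HasClearColumn.special24_mul {g : Sp2} (h : HasClearColumn g) {hN : N ≠ 0} {α β γ δ : ℤ}
    (hdet : α * δ - β * γ = 1) : HasClearColumn (special24 N hN α β γ δ hdet * g) :=
  ⟨by rw [special24_mul₂, h.h₂, h.h₄]; simp, by rw [special24_mul₃, h.h₃],
    by rw [special24_mul₄, h.h₂, h.h₄]; simp⟩

theorem HasClearColumn.mul_special24 {g : Sp2} (h : HasClearColumn g) {hN : N ≠ 0} {α β γ δ : ℤ}
    (hdet : α * δ - β * γ = 1) : HasClearColumn (g * special24 N hN α β γ δ hdet) :=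
  ⟨by rw [mul_special24₁, h.h₂], by rw [mul_special24₁, h.h₃], by rw [mul_special24₁, h.h₄]⟩

theorem IsReduced.mul_right {g v : Sp2} (hg : IsReduced N g) (hv : v ∈ extendedParamodular N)
    (h11 : ((g * v : Sp2) : Mat4) e₁ e₁ = (g : Mat4) e₁ e₁) (hrow : HasClearRow (g * v))
    (hcol : HasClearColumn (g * v)) (h22 : ((g * v : Sp2) : Mat4) e₂ e₂ = (g : Mat4) e₂ e₂) :
    IsReduced N (g * v) := by
  refine ⟨hg.minimal.mul_right hv h11, hrow, hcol, h22 ▸ hg.ne_zero, ?_⟩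
  intro u' hu' v' hv'
  have e : u' * (g * v) * v' = u' * g * (v * v') := by group
  rw [e, h11, h22]
  exact hg.le u' hu' _ (mul_mem hv hv')

theorem IsReduced.mul_left {g u : Sp2} (hg : IsReduced N g) (hu : u ∈ extendedParamodular N)
    (h11 : ((u * g : Sp2) : Mat4) e₁ e₁ = (g : Mat4) e₁ e₁) (hrow : HasClearRow (u * g))
    (hcol : HasClearColumn (u * g)) (h22 : ((u * g : Sp2) : Mat4) e₂ e₂ = (g : Mat4) e₂ e₂) :
    IsReduced N (u * g) := by
  refine ⟨hg.minimal.mul_left hu h11, hrow, hcol, h22 ▸ hg.ne_zero, ?_⟩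
  intro u' hu' v' hv'
  have e : u' * (u * g) * v' = (u' * u) * g * v' := by group
  rw [e, h11, h22]
  exact hg.le _ (mul_mem hu' hu) v' hv'

theorem IsReduced.row₄ (hN : N ≠ 0) {g : Sp2} (hg : IsReduced N g) :
    ∃ q : ℤ, N * (g : Mat4) e₂ e₄ = q * (g : Mat4) e₂ e₂ := by
  refine exists_int_mul_of_forall_le hg.ne_zero fun q hq => ?_
  set v := special24 N hN (-q) (-1) 1 0 (by ring) with hv
  have e : ((1 * g * v : Sp2) : Mat4) e₂ e₂ = N * (g : Mat4) e₂ e₄ - q * (g : Mat4) e₂ e₂ := by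
    rw [one_mul, mul_special24₂]; push_cast; ring
  rw [← e] at hq ⊢
  refine hg.le 1 (one_mem _) v (special24_mem hN _) ?_ ?_ ?_ hq
  · rw [one_mul, mul_special24₁]
  · rw [one_mul]; exact hg.row.mul_special24 _
  · rw [one_mul]; exact hg.column.mul_special24 _

theorem IsReduced.column₄ (hN : N ≠ 0) {g : Sp2} (hg : IsReduced N g) :
    ∃ q : ℤ, (g : Mat4) e₄ e₂ / N = q * (g : Mat4) e₂ e₂ := by
  refine exists_int_mul_of_forall_le hg.ne_zero fun q hq => ?_
  set u := special24 N hN (-q) 1 (-1) 0 (by ring) with hu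
  have e : ((u * g * 1 : Sp2) : Mat4) e₂ e₂ = (g : Mat4) e₄ e₂ / N - q * (g : Mat4) e₂ e₂ := by
    rw [mul_one, special24_mul₂]; push_cast; ring
  rw [← e] at hq ⊢
  refine hg.le u (special24_mem hN _) 1 (one_mem _) ?_ ?_ ?_ hq
  · rw [mul_one, special24_mul₁]
  · rw [mul_one]; exact hg.row.special24_mul _
  · rw [mul_one]; exact hg.column.special24_mul _

theorem IsReduced.exists_diagonal (hN : N ≠ 0) {g : Sp2} (hg : IsReduced N g) :
    ∃ u ∈ extendedParamodular N, ∃ v ∈ extendedParamodular N, IsReduced N (u * g * v) ∧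
      ((u * g * v : Sp2) : Mat4) e₂ e₄ = 0 ∧ ((u * g * v : Sp2) : Mat4) e₄ e₂ = 0 := by
  have hN' : (N : ℝ) ≠ 0 := Nat.cast_ne_zero.2 hN
  obtain ⟨q, hq⟩ := hg.row₄ hN
  set v := special24 N hN 1 (-q) 0 1 (by ring) with hv
  have hvm : v ∈ extendedParamodular N := special24_mem hN _
  have h24 : ((g * v : Sp2) : Mat4) e₂ e₄ = 0 := by
    rw [mul_special24₄]
    field_simp
    push_cast
    linear_combination hq
  have hg₁ : IsReduced N (g * v) := hg.mul_right hvm (mul_special24₁ _ _ _)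
    (hg.row.mul_special24 _) (hg.column.mul_special24 _) (by rw [mul_special24₂]; simp)
  obtain ⟨q', hq'⟩ := hg₁.column₄ hN
  set u := special24 N hN 1 0 (-q') 1 (by ring) with hu
  have hum : u ∈ extendedParamodular N := special24_mem hN _
  refine ⟨u, hum, v, hvm, ?_⟩
  rw [mul_assoc]
  refine ⟨hg₁.mul_left hum (special24_mul₁ _ _ _) (hg₁.row.special24_mul _)
    (hg₁.column.special24_mul _) (by rw [special24_mul₂]; simp), ?_, ?_⟩
  · rw [special24_mul₂, h24]; simp
  · rw [special24_mul₄]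
    push_cast
    rw [div_eq_iff hN'] at hq'
    linear_combination hq'

/-- The representative `(1 / √m) diag(1, k, m, s k)`, `m = s k²`, of a double coset. -/
def elementaryDivisor (i : ℕ+ × ℕ+) : bigG :=
  diagElement ((i.1 : ℕ) * (i.2 : ℕ) ^ 2) (Nat.mul_pos i.1.pos (pow_pos i.2.pos 2))
    ![1, (i.2 : ℕ)] ![((i.1 : ℕ) * (i.2 : ℕ) ^ 2 : ℕ), ((i.1 : ℕ) * (i.2 : ℕ) : ℕ)] (by
      intro j
      fin_cases j <;> simp
      ring)

/-- The diagonal of `elementaryDivisor`. -/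
def divisorEntry (i : ℕ+ × ℕ+) : Fin 2 ⊕ Fin 2 → ℝ :=
  Sum.elim ![1 / (Real.sqrt i.1 * i.2), 1 / Real.sqrt i.1] ![Real.sqrt i.1 * i.2, Real.sqrt i.1]

theorem coe_elementaryDivisor (i : ℕ+ × ℕ+) :
    ((elementaryDivisor i : Sp2) : Mat4) = Matrix.diagonal (divisorEntry i) := by
  have h1 : Real.sqrt (i.1 : ℕ) ≠ 0 := Real.sqrt_ne_zero'.2 (by exact_mod_cast i.1.pos)
  have h2 : ((i.2 : ℕ) : ℝ) ≠ 0 := by exact_mod_cast i.2.ne_zero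
  have h3 : Real.sqrt (i.1 : ℕ) ^ 2 = (i.1 : ℕ) := Real.sq_sqrt (Nat.cast_nonneg _)
  have hs : Real.sqrt (((i.1 : ℕ) * (i.2 : ℕ) ^ 2 : ℕ) : ℝ) = Real.sqrt (i.1 : ℕ) * (i.2 : ℕ) := by
    rw [Nat.cast_mul, Nat.cast_pow, Real.sqrt_mul (Nat.cast_nonneg _),
      Real.sqrt_sq (Nat.cast_nonneg _)]
  ext a b
  revert a b
  simp only [forall_index, elementaryDivisor, diagElement, divisorEntry, hs]
  simp
  refine ⟨?_, ?_, ?_⟩ <;> field_simp <;> simp [h3]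

/-- The elementary divisor theorem. -/
theorem exists_elementaryDivisor (hN : Squarefree N) {g : Sp2} (hG : g ∈ bigG) :
    ∃ u ∈ extendedParamodular N, ∃ v ∈ extendedParamodular N, ∃ i,
      u * g * v = elementaryDivisor i := by
  have hN0 := hN.ne_zero
  have hN' : (N : ℝ) ≠ 0 := Nat.cast_ne_zero.2 hN0
  obtain ⟨u₀, hu₀, v₀, hv₀, h₀⟩ := exists_isReduced hN hG
  obtain ⟨u₁, hu₁, v₁, hv₁, hk, h24, h42⟩ := h₀.exists_diagonal hN0
  have e : u₁ * (u₀ * g * v₀) * v₁ = (u₁ * u₀) * g * (v₀ * v₁) := by group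
  have hu := mul_mem hu₁ hu₀
  have hv := mul_mem hv₀ hv₁
  rw [e] at hk h24 h42
  have hGk := mul_mem_bigG hN0 hG hu hv
  clear e h₀
  generalize u₁ * u₀ = u at *
  generalize v₀ * v₁ = v at *
  set k := u * g * v with hk_def
  have h11 := hk.minimal.1
  have h22 := hk.ne_zero
  have hr : ∀ j, -((k : Mat4) e₁ e₁ * (k : Mat4) j e₃) = J (Fin 2) ℝ e₁ j := fun j => by
    have h := row_relation k e₁ j
    rw [hk.row.h₂, hk.row.h₃, hk.row.h₄] at h
    linear_combination h
  have hc : ∀ j, -((k : Mat4) e₁ e₁ * (k : Mat4) e₃ j) = J (Fin 2) ℝ e₁ j := fun j => by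
    have h := column_relation k e₁ j
    rw [hk.column.h₂, hk.column.h₃, hk.column.h₄] at h
    linear_combination h
  have h23 : (k : Mat4) e₂ e₃ = 0 := by simpa [J, h11] using hr e₂
  have h43 : (k : Mat4) e₄ e₃ = 0 := by simpa [J, h11] using hr e₄
  have h33 : (k : Mat4) e₁ e₁ * (k : Mat4) e₃ e₃ = 1 := by simpa [J] using hr e₃
  have h32 : (k : Mat4) e₃ e₂ = 0 := by simpa [J, h11] using hc e₂
  have h34 : (k : Mat4) e₃ e₄ = 0 := by simpa [J, h11] using hc e₄
  have h44 : (k : Mat4) e₂ e₂ * (k : Mat4) e₄ e₄ = 1 := by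
    have h := row_relation k e₂ e₄
    rw [h24, h23, hk.column.h₂] at h
    simpa [J] using h
  obtain ⟨q₁, hq₁⟩ : ∃ q : ℤ, (k : Mat4) e₃ e₃ = q * (k : Mat4) e₁ e₁ := by
    set w := special13 1 1 0 1 (by ring) with hw
    have h1 : ((w * k : Sp2) : Mat4) e₁ e₁ = (k : Mat4) e₁ e₁ := by
      rw [special13_mul₁, hk.column.h₃]; simp
    obtain ⟨q, hq⟩ := (hk.minimal.mul_left (special13_mem _) h1).row₃
    refine ⟨q, ?_⟩
    rw [h1, special13_mul₁, hk.row.h₃] at hq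
    simpa using hq
  obtain ⟨q₂, hq₂⟩ : ∃ q : ℤ, (k : Mat4) e₂ e₂ = q * (k : Mat4) e₁ e₁ := by
    set w := levi N 1 one_pos 1 1 0 1 (by simp) with hw
    have hwm : w ∈ extendedParamodular N := levi_mem _ (one_dvd N) _
    have h1 : ((w * k : Sp2) : Mat4) e₁ e₁ = (k : Mat4) e₁ e₁ := by
      rw [levi_mul₁, hk.column.h₂]; simp
    obtain ⟨q, hq⟩ := (hk.minimal.mul_left hwm h1).row₂ hN (mul_mem_bigG_left hN0 hGk hwm)
    refine ⟨q, mul_left_cancel₀ hN' ?_⟩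
    rw [h1, levi_mul₁, hk.row.h₂] at hq
    simp at hq
    linear_combination hq
  obtain ⟨q₃, hq₃⟩ : ∃ q : ℤ, (k : Mat4) e₄ e₄ = q * (k : Mat4) e₂ e₂ := by
    set w := special24 N hN0 1 1 0 1 (by ring) with hw
    have h2 : ((w * k : Sp2) : Mat4) e₂ e₂ = (k : Mat4) e₂ e₂ := by
      rw [special24_mul₂, h42]; simp
    obtain ⟨q, hq⟩ := (hk.mul_left (special24_mem hN0 _) (special24_mul₁ _ _ _)
      (hk.row.special24_mul _) (hk.column.special24_mul _) h2).row₄ hN0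
    refine ⟨q, ?_⟩
    rw [h2, special24_mul₂, h24] at hq
    field_simp at hq
    simpa using hq
  set a := (k : Mat4) e₁ e₁ with ha
  set b := (k : Mat4) e₂ e₂ with hb
  have hb2 : (q₃ : ℝ) * b ^ 2 = 1 := by rw [hq₃] at h44; linear_combination h44
  have hq₃0 : 0 < q₃ := by
    have h : (0 : ℝ) < q₃ := by
      by_contra hle
      nlinarith [sq_nonneg b]
    exact_mod_cast h
  have hq₂0 : q₂ ≠ 0 := fun h0 => h22 (by rw [hq₂, h0]; simp)
  obtain ⟨s, rfl⟩ : ∃ s : ℕ+, q₃ = (s : ℕ) := ⟨⟨q₃.toNat, by omega⟩, by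
    simp only [PNat.mk_coe]; omega⟩
  obtain ⟨l, hl⟩ : ∃ l : ℕ+, |q₂| = (l : ℕ) := ⟨⟨q₂.natAbs, Int.natAbs_pos.2 hq₂0⟩, by
    rw [PNat.mk_coe, Int.natCast_natAbs]⟩
  have hs0 : Real.sqrt (s : ℕ) ≠ 0 := Real.sqrt_ne_zero'.2 (by exact_mod_cast s.pos)
  have hspos : 0 < Real.sqrt (s : ℕ) := Real.sqrt_pos.2 (by exact_mod_cast s.pos)
  have hs2 : Real.sqrt (s : ℕ) ^ 2 = (s : ℕ) := Real.sq_sqrt (Nat.cast_nonneg _)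
  have hl0 : ((l : ℕ) : ℝ) ≠ 0 := by exact_mod_cast l.ne_zero
  have habsb : |b| = 1 / Real.sqrt (s : ℕ) := by
    rw [eq_div_iff hs0]
    have h1 : (|b| * Real.sqrt (s : ℕ)) ^ 2 = 1 := by
      rw [mul_pow, sq_abs, hs2]; push_cast at hb2; linear_combination hb2
    have h2 : 0 ≤ |b| * Real.sqrt (s : ℕ) := by positivity
    exact (pow_eq_one_iff_of_nonneg h2 two_ne_zero).1 h1
  have habsa : |a| = 1 / (Real.sqrt (s : ℕ) * (l : ℕ)) := by
    have h1 : |b| = (l : ℕ) * |a| := by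
      rw [hq₂, abs_mul, ← Int.cast_abs, hl, Int.cast_natCast]
    rw [habsb] at h1
    field_simp at h1 ⊢
    linear_combination -h1
  obtain ⟨σ, hσ, hσa⟩ : ∃ σ : ℤ, σ * σ = 1 ∧ σ * a = |a| := by
    rcases abs_choice a with h | h
    · exact ⟨1, by norm_num, by rw [h]; simp⟩
    · exact ⟨-1, by norm_num, by rw [h]; simp⟩
  obtain ⟨τ, hτ, hτb⟩ : ∃ τ : ℤ, τ * τ = 1 ∧ τ * b = |b| := by
    rcases abs_choice b with h | h
    · exact ⟨1, by norm_num, by rw [h]; simp⟩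
    · exact ⟨-1, by norm_num, by rw [h]; simp⟩
  have hσ' : (σ : ℝ) * σ = 1 := by exact_mod_cast hσ
  have hτ' : (τ : ℝ) * τ = 1 := by exact_mod_cast hτ
  set w₁ := special13 σ 0 0 σ (by linear_combination hσ) with hw₁
  set w₂ := special24 N hN0 τ 0 0 τ (by linear_combination hτ) with hw₂
  refine ⟨w₁ * w₂ * u, mul_mem (mul_mem (special13_mem _) (special24_mem hN0 _)) hu, v, hv,
    (s, l), ?_⟩
  have e : w₁ * w₂ * u * g * v = w₁ * (w₂ * k) := by rw [hk_def]; group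
  rw [e]
  refine Subtype.ext ?_
  rw [coe_elementaryDivisor]
  have h33' : σ * (k : Mat4) e₃ e₃ = Real.sqrt (s : ℕ) * (l : ℕ) := by
    rw [eq_comm, ← one_div_one_div (Real.sqrt (s : ℕ) * ((l : ℕ) : ℝ)), ← habsa, ← hσa,
      div_eq_iff (mul_ne_zero (by rintro h; rw [h] at hσ'; simp at hσ') h11)]
    linear_combination -σ * σ * h33 - hσ'
  have h44' : τ * (k : Mat4) e₄ e₄ = Real.sqrt (s : ℕ) := by
    rw [eq_comm, ← one_div_one_div (Real.sqrt (s : ℕ)), ← habsb, ← hτb,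
      div_eq_iff (mul_ne_zero (by rintro h; rw [h] at hτ'; simp at hτ') h22)]
    linear_combination -τ * τ * h44 - hτ'
  ext i j
  revert i j
  simp only [forall_index, special13_mul₁, special13_mul₂, special13_mul₃, special13_mul₄,
    special24_mul₁, special24_mul₂, special24_mul₃, special24_mul₄, hw₁, hw₂, hk.row.h₂, hk.row.h₃,
    hk.row.h₄, hk.column.h₂, hk.column.h₃, hk.column.h₄, h23, h43, h32, h34, h24, h42]
  simp [divisorEntry, h33', h44', ← ha, ← hb, hσa, hτb, habsa, habsb]

end

section

variable {N : ℕ}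

/-! ### Denominators of the representatives -/

/-- The denominator of the representative on the symmetric elements. -/
def symmDegree (i : ℕ+ × ℕ+) : ℕ := i.1 * i.2

/-- The denominator of the representative. -/
def degree (i : ℕ+ × ℕ+) : ℕ := i.1 * i.2 ^ 2

theorem symmDegree_mul (i j : ℕ+ × ℕ+) : symmDegree (i * j) = symmDegree i * symmDegree j := by
  simp [symmDegree]; ring

theorem degree_mul (i j : ℕ+ × ℕ+) : degree (i * j) = degree i * degree j := by
  simp [degree]; ring

theorem symmDegree_pos (i : ℕ+ × ℕ+) : 0 < symmDegree i := Nat.mul_pos i.1.pos i.2.pos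

theorem degree_pos (i : ℕ+ × ℕ+) : 0 < degree i := Nat.mul_pos i.1.pos (pow_pos i.2.pos 2)

theorem eq_of_degree_eq {i j : ℕ+ × ℕ+} (h₁ : symmDegree i = symmDegree j)
    (h₂ : degree i = degree j) : i = j := by
  have e : ∀ i, degree i = symmDegree i * (i.2 : ℕ) := fun i => by rw [degree, symmDegree]; ring
  have h2 : (i.2 : ℕ) = j.2 := by
    rw [e, e, h₁] at h₂
    exact Nat.eq_of_mul_eq_mul_left (symmDegree_pos j) h₂
  have h1 : (i.1 : ℕ) = j.1 := by
    rw [symmDegree, symmDegree, h2] at h₁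
    exact Nat.eq_of_mul_eq_mul_right j.2.pos h₁
  exact Prod.ext (PNat.coe_injective h1) (PNat.coe_injective h2)

theorem sqrt_fst_ne_zero (i : ℕ+ × ℕ+) : Real.sqrt (i.1 : ℕ) ≠ 0 :=
  Real.sqrt_ne_zero'.2 (by exact_mod_cast i.1.pos)

theorem sqrt_fst_sq (i : ℕ+ × ℕ+) : Real.sqrt (i.1 : ℕ) ^ 2 = (i.1 : ℕ) :=
  Real.sq_sqrt (Nat.cast_nonneg _)

theorem coe_snd_ne_zero (i : ℕ+ × ℕ+) : ((i.2 : ℕ) : ℝ) ≠ 0 := by exact_mod_cast i.2.ne_zero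

theorem divisorEntry_mul (i j : ℕ+ × ℕ+) (a : Fin 2 ⊕ Fin 2) :
    divisorEntry (i * j) a = divisorEntry i a * divisorEntry j a := by
  revert a
  simp only [forall_index]
  simp [divisorEntry, Real.sqrt_mul]
  refine ⟨?_, ?_, ?_⟩ <;> ring

theorem elementaryDivisor_mul (i j : ℕ+ × ℕ+) :
    elementaryDivisor (i * j) = elementaryDivisor i * elementaryDivisor j := by
  refine Subtype.ext (Subtype.ext ?_)
  rw [Subgroup.coe_mul, Submonoid.coe_mul, coe_elementaryDivisor, coe_elementaryDivisor,
    coe_elementaryDivisor, Matrix.diagonal_mul_diagonal]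
  congr 1
  funext a
  exact divisorEntry_mul i j a

theorem elementaryDivisor_one : elementaryDivisor 1 = 1 := by
  refine Subtype.ext (Subtype.ext ?_)
  rw [Subgroup.coe_one, Submonoid.coe_one, coe_elementaryDivisor, ← Matrix.diagonal_one]
  congr 1
  funext a
  revert a
  simp [divisorEntry]

/-- The diagonal of the inverse of `elementaryDivisor`. -/
def divisorEntryInv (i : ℕ+ × ℕ+) : Fin 2 ⊕ Fin 2 → ℝ :=
  Sum.elim ![Real.sqrt i.1 * i.2, Real.sqrt i.1] ![1 / (Real.sqrt i.1 * i.2), 1 / Real.sqrt i.1]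

theorem coe_elementaryDivisor_inv (i : ℕ+ × ℕ+) :
    (((elementaryDivisor i : Sp2)⁻¹ : Sp2) : Mat4) = Matrix.diagonal (divisorEntryInv i) := by
  rw [coe_inv, coe_elementaryDivisor, sympAdjoint_eq]
  ext a b
  revert a b
  simp only [forall_index]
  simp [divisorEntry, divisorEntryInv]

theorem exists_degree_mul_entries (i : ℕ+ × ℕ+) (a b : Fin 2 ⊕ Fin 2) :
    ∃ z : ℤ, (degree i : ℝ) * (divisorEntry i a * divisorEntryInv i b) = z := by
  have h1 := sqrt_fst_ne_zero i
  have h2 := sqrt_fst_sq i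
  have h3 := coe_snd_ne_zero i
  generalize hs : Real.sqrt (i.1 : ℕ) = σ at h1 h2
  have hd : ((degree i : ℕ) : ℝ) = σ ^ 2 * (i.2 : ℕ) ^ 2 := by
    rw [degree, h2]; push_cast; ring
  rw [hd]
  simp only [divisorEntry, divisorEntryInv, hs]
  generalize (i.1 : ℕ) = s at h2
  generalize (i.2 : ℕ) = k at h3
  revert a b
  simp only [forall_index]
  refine ⟨⟨⟨s * k ^ 2, ?_⟩, ⟨s * k, ?_⟩, ⟨1, ?_⟩, ⟨k, ?_⟩⟩,
    ⟨⟨s * k ^ 3, ?_⟩, ⟨s * k ^ 2, ?_⟩, ⟨k, ?_⟩, ⟨k ^ 2, ?_⟩⟩,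
    ⟨⟨s ^ 2 * k ^ 4, ?_⟩, ⟨s ^ 2 * k ^ 3, ?_⟩, ⟨s * k ^ 2, ?_⟩, ⟨s * k ^ 3, ?_⟩⟩,
    ⟨⟨s ^ 2 * k ^ 3, ?_⟩, ⟨s ^ 2 * k ^ 2, ?_⟩, ⟨s * k, ?_⟩, ⟨s * k ^ 2, ?_⟩⟩⟩ <;>
    simp [← h2] <;> field_simp

theorem isDenominator_elementaryDivisor (i : ℕ+ × ℕ+) :
    IsDenominator N (degree i) (elementaryDivisor i : Sp2) := by
  intro X hX a b
  obtain ⟨x, hx⟩ := hX a b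
  obtain ⟨z, hz⟩ := exists_degree_mul_entries i a b
  refine ⟨x * z, ?_⟩
  rw [coe_elementaryDivisor, coe_elementaryDivisor_inv, Matrix.smul_apply, Matrix.mul_diagonal,
    Matrix.diagonal_mul, hx, smul_eq_mul]
  push_cast
  rw [← hz]
  ring

theorem IsSympSymm.eq_zero {X : Mat4} (h : IsSympSymm X) :
    X e₁ e₃ = 0 ∧ X e₂ e₄ = 0 ∧ X e₃ e₁ = 0 ∧ X e₄ e₂ = 0 := by
  have h1 := congrFun (congrFun h e₁) e₁
  have h2 := congrFun (congrFun h e₂) e₂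
  have h3 := congrFun (congrFun h e₃) e₃
  have h4 := congrFun (congrFun h e₄) e₄
  simp [Matrix.mul_apply, J, Matrix.one_apply] at h1 h2 h3 h4
  refine ⟨?_, ?_, ?_, ?_⟩ <;> linarith

theorem exists_symmDegree_mul_entries (i : ℕ+ × ℕ+) {X : Mat4} (hX : IsSympSymm X)
    (a b : Fin 2 ⊕ Fin 2) :
    X a b = 0 ∨ ∃ z : ℤ, (symmDegree i : ℝ) * (divisorEntry i a * divisorEntryInv i b) = z := by
  have h1 := sqrt_fst_ne_zero i
  have h2 := sqrt_fst_sq i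
  have h3 := coe_snd_ne_zero i
  obtain ⟨h13, h24, h31, h42⟩ := hX.eq_zero
  generalize hs : Real.sqrt (i.1 : ℕ) = σ at h1 h2
  have hd : ((symmDegree i : ℕ) : ℝ) = σ ^ 2 * (i.2 : ℕ) := by
    rw [symmDegree, h2]; push_cast; ring
  rw [hd]
  simp only [divisorEntry, divisorEntryInv, hs]
  generalize (i.1 : ℕ) = s at h2
  generalize (i.2 : ℕ) = k at h3
  revert a b
  simp only [forall_index]
  refine ⟨⟨Or.inr ⟨s * k, ?_⟩, Or.inr ⟨s, ?_⟩, Or.inl h13, Or.inr ⟨1, ?_⟩⟩,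
    ⟨Or.inr ⟨s * k ^ 2, ?_⟩, Or.inr ⟨s * k, ?_⟩, Or.inr ⟨1, ?_⟩, Or.inl h24⟩,
    ⟨Or.inl h31, Or.inr ⟨s ^ 2 * k ^ 2, ?_⟩, Or.inr ⟨s * k, ?_⟩, Or.inr ⟨s * k ^ 2, ?_⟩⟩,
    ⟨Or.inr ⟨s ^ 2 * k ^ 2, ?_⟩, Or.inl h42, Or.inr ⟨s, ?_⟩, Or.inr ⟨s * k, ?_⟩⟩⟩ <;>
    simp [← h2] <;> field_simp

theorem isSymmDenominator_elementaryDivisor (i : ℕ+ × ℕ+) :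
    IsSymmDenominator N (symmDegree i) (elementaryDivisor i : Sp2) := by
  intro X hX hs a b
  rw [coe_elementaryDivisor, coe_elementaryDivisor_inv, Matrix.smul_apply, Matrix.mul_diagonal,
    Matrix.diagonal_mul, smul_eq_mul]
  rcases exists_symmDegree_mul_entries i hs a b with h0 | ⟨z, hz⟩
  · exact ⟨0, by rw [h0]; simp⟩
  · obtain ⟨x, hx⟩ := hX a b
    refine ⟨x * z, ?_⟩
    rw [hx]
    push_cast
    rw [← hz]
    ring

theorem degree_dvd_of_isDenominator (hN : N ≠ 0) {n : ℕ} {i : ℕ+ × ℕ+}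
    (h : IsDenominator N n (elementaryDivisor i : Sp2)) : degree i ∣ n := by
  obtain ⟨z, hz⟩ := h.column_one hN e₁
  have h1 := sqrt_fst_ne_zero i
  have h3 := coe_snd_ne_zero i
  have h2 := sqrt_fst_sq i
  rw [coe_elementaryDivisor, Matrix.diagonal_apply_eq] at hz
  simp [divisorEntry, wt, indexScale, indexBlock, blockWeight] at hz
  field_simp at hz
  have hz' : (n : ℤ) = degree i * z := by
    have : (n : ℝ) = degree i * z := by rw [degree]; push_cast; rw [hz, h2]; ring
    exact_mod_cast this
  exact_mod_cast (Dvd.intro _ hz'.symm : (degree i : ℤ) ∣ n)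

theorem symmDegree_dvd_of_isSymmDenominator (hN : N ≠ 0) {n : ℕ} {i : ℕ+ × ℕ+}
    (h : IsSymmDenominator N n (elementaryDivisor i : Sp2)) : symmDegree i ∣ n := by
  obtain ⟨z, hz⟩ := h.minor hN e₂
  have h1 := sqrt_fst_ne_zero i
  have h3 := coe_snd_ne_zero i
  have h2 := sqrt_fst_sq i
  rw [coe_elementaryDivisor, Matrix.diagonal_apply_eq, Matrix.diagonal_apply_eq] at hz
  simp [divisorEntry, wt, indexScale, indexBlock, blockWeight] at hz
  field_simp at hz
  have hz' : (n : ℤ) = symmDegree i * z := by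
    have : (n : ℝ) = symmDegree i * z := by rw [symmDegree]; push_cast; rw [hz, h2]
    exact_mod_cast this
  exact_mod_cast (Dvd.intro _ hz'.symm : (symmDegree i : ℤ) ∣ n)

/-- The elements of `𝔾` normalizing the order of paramodular shape are in `Σ*_N`. -/
theorem mem_of_isDenominator_one (hN : Squarefree N) {g : Sp2} (hG : g ∈ bigG)
    (h : IsDenominator N 1 g) : g ∈ extendedParamodular N := by
  obtain ⟨u, hu, v, hv, i, hi⟩ := exists_elementaryDivisor hN hG
  have h1 := h.mul_mem hN.ne_zero hu hv
  rw [hi] at h1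
  have h2 : i = 1 := by
    have h3 := Nat.dvd_one.1 (degree_dvd_of_isDenominator hN.ne_zero h1)
    have h4 := Nat.eq_one_of_mul_eq_one_right h3
    have h5 : (i.2 : ℕ) = 1 := by
      have := Nat.eq_one_of_mul_eq_one_left h3
      exact (Nat.pow_eq_one.1 this).resolve_right two_ne_zero
    exact Prod.ext (PNat.coe_injective h4) (PNat.coe_injective h5)
  rw [h2, elementaryDivisor_one] at hi
  have e : g = u⁻¹ * (u * g * v) * v⁻¹ := by group
  rw [e, hi]
  simpa using mul_mem (inv_mem hu) (inv_mem hv)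

/-- Inversion fixes the double cosets. -/
theorem exists_inv_eq (hN : Squarefree N) {g : Sp2} (hG : g ∈ bigG) :
    ∃ u ∈ extendedParamodular N, ∃ v ∈ extendedParamodular N, g⁻¹ = u * g * v := by
  have hN0 := hN.ne_zero
  have hN' : (N : ℝ) ≠ 0 := Nat.cast_ne_zero.2 hN0
  obtain ⟨u, hu, v, hv, i, hi⟩ := exists_elementaryDivisor hN hG
  set w := special13 0 (-1) 1 0 (by norm_num) * special24 N hN0 0 (-1) 1 0 (by norm_num) with hw
  have hwm : w ∈ extendedParamodular N := mul_mem (special13_mem _) (special24_mem hN0 _)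
  have hcomm : w * (elementaryDivisor i : Sp2) = (elementaryDivisor i : Sp2)⁻¹ * w := by
    refine Subtype.ext ?_
    change (w : Mat4) * ((elementaryDivisor i : Sp2) : Mat4) =
      (((elementaryDivisor i : Sp2)⁻¹ : Sp2) : Mat4) * (w : Mat4)
    rw [coe_elementaryDivisor, coe_elementaryDivisor_inv]
    ext a b
    rw [Matrix.mul_diagonal, Matrix.diagonal_mul]
    revert a b
    simp only [forall_index, hw, special13_mul₁, special13_mul₂, special13_mul₃, special13_mul₄]
    simp [special24, divisorEntry, divisorEntryInv]
    exact ⟨mul_comm _ _, mul_comm _ _⟩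
  refine ⟨v * w * u, mul_mem (mul_mem hv hwm) hu, v * w⁻¹ * u,
    mul_mem (mul_mem hv (inv_mem hwm)) hu, ?_⟩
  have e1 : g = u⁻¹ * (u * g * v) * v⁻¹ := by group
  have e2 : v * w * u * g * (v * w⁻¹ * u) = v * (w * (u * g * v)) * w⁻¹ * u := by group
  rw [e2, hi, hcomm]
  conv_lhs => rw [e1, hi]
  group

/-- A lower triangular element whose denominators divide those of `D_j`, and whose quotient into
`D_i D_j` has denominators dividing those of `D_i`, is in `Σ*_N D_j`. -/
theorem IsLowerTriangular.mul_inv_mem (hN : N ≠ 0) {g : Sp2} (hg : IsLowerTriangular g)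
    {i j : ℕ+ × ℕ+} (h₁ : IsSymmDenominator N (symmDegree j) g) (h₂ : IsDenominator N (degree j) g)
    (h₃ : IsSymmDenominator N (symmDegree i) (elementaryDivisor (i * j) * g⁻¹))
    (h₄ : IsDenominator N (degree i) (elementaryDivisor (i * j) * g⁻¹)) :
    g * (elementaryDivisor j : Sp2)⁻¹ ∈ extendedParamodular N := by
  have hN' : (N : ℝ) ≠ 0 := Nat.cast_ne_zero.2 hN
  obtain ⟨h12, h13, h14, h23, h24, h43⟩ := hg
  have r13 : (g : Mat4) e₁ e₁ * (g : Mat4) e₃ e₃ = 1 := by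
    have h := row_relation g e₁ e₃
    rw [h12, h13, h14] at h
    simpa [J] using h
  have r24 : (g : Mat4) e₂ e₂ * (g : Mat4) e₄ e₄ = 1 := by
    have h := row_relation g e₂ e₄
    rw [h43, h23, h24] at h
    simpa [J] using h
  -- the quotient
  have hx : ∀ a b, ((elementaryDivisor (i * j) * g⁻¹ : Sp2) : Mat4) a b =
      divisorEntry (i * j) a * sympAdjoint g a b := fun a b => by
    rw [Submonoid.coe_mul, coe_elementaryDivisor, Matrix.diagonal_mul, coe_inv]
  have hx11 : ((elementaryDivisor (i * j) * g⁻¹ : Sp2) : Mat4) e₁ e₁ =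
      divisorEntry (i * j) e₁ * (g : Mat4) e₃ e₃ := by rw [hx, sympAdjoint_eq]; simp
  have hx12 : ((elementaryDivisor (i * j) * g⁻¹ : Sp2) : Mat4) e₁ e₂ = 0 := by
    rw [hx, sympAdjoint_eq]; simp [h43]
  have hx22 : ((elementaryDivisor (i * j) * g⁻¹ : Sp2) : Mat4) e₂ e₂ =
      divisorEntry (i * j) e₂ * (g : Mat4) e₄ e₄ := by rw [hx, sympAdjoint_eq]; simp
  have hw1 : wt N 1 e₁ e₃ = 1 := by simp [wt, indexScale, indexBlock, blockWeight]
  have hw2 : wt N 1 e₂ e₃ = 1 := by simp [wt, indexScale, indexBlock, blockWeight]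
  have hw4 : wt N 1 e₄ e₃ = N := by simp [wt, indexScale, indexBlock, blockWeight]
  have hw3 : wt N 1 e₃ e₃ = 1 := by simp [wt, indexScale, indexBlock, blockWeight]
  have hσ0 := sqrt_fst_ne_zero j
  have hσ2 := sqrt_fst_sq j
  have hk0 := coe_snd_ne_zero j
  have hσ0' := sqrt_fst_ne_zero i
  have hσ2' := sqrt_fst_sq i
  have hk0' := coe_snd_ne_zero i
  have hy : ∀ a b, ((g * (elementaryDivisor j : Sp2)⁻¹ : Sp2) : Mat4) a b =
      (g : Mat4) a b * divisorEntryInv j b := fun a b => by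
    rw [Submonoid.coe_mul, coe_elementaryDivisor_inv, Matrix.mul_diagonal]
  have hD₁ : ((degree j : ℕ) : ℝ) = Real.sqrt (j.1 : ℕ) ^ 2 * (j.2 : ℕ) ^ 2 := by
    rw [degree, hσ2]; push_cast; ring
  have hS₁ : ((symmDegree j : ℕ) : ℝ) = Real.sqrt (j.1 : ℕ) ^ 2 * (j.2 : ℕ) := by
    rw [symmDegree, hσ2]; push_cast; ring
  have hD₂ : ((degree i : ℕ) : ℝ) = Real.sqrt (i.1 : ℕ) ^ 2 * (i.2 : ℕ) ^ 2 := by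
    rw [degree, hσ2']; push_cast; ring
  have hS₂ : ((symmDegree i : ℕ) : ℝ) = Real.sqrt (i.1 : ℕ) ^ 2 * (i.2 : ℕ) := by
    rw [symmDegree, hσ2']; push_cast; ring
  have hcol := fun a => h₂.column_one hN a
  have hmin := fun a => h₁.minor hN a
  obtain ⟨z₁, hz₁⟩ := h₄.column_one hN e₁
  obtain ⟨z₂, hz₂⟩ := h₃.minor hN e₂
  simp only [h12, mul_zero, sub_zero] at hmin
  rw [hw1, hx11, divisorEntry_mul, hD₂] at hz₁
  rw [hw2, hx11, hx12, hx22, divisorEntry_mul, divisorEntry_mul, hS₂] at hz₂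
  rw [hD₁] at hcol
  rw [hS₁] at hmin
  set y : Sp2 := g * (elementaryDivisor j : Sp2)⁻¹ with hy_def
  have hy₁ : ∀ a, (y : Mat4) a e₁ = (g : Mat4) a e₁ * (Real.sqrt (j.1 : ℕ) * (j.2 : ℕ)) :=
    fun a => by rw [hy]; simp [divisorEntryInv]
  have hy₂ : ∀ a, (y : Mat4) a e₂ = (g : Mat4) a e₂ * Real.sqrt (j.1 : ℕ) :=
    fun a => by rw [hy]; simp [divisorEntryInv]
  have hy₃ : ∀ a, (y : Mat4) a e₃ = (g : Mat4) a e₃ / (Real.sqrt (j.1 : ℕ) * (j.2 : ℕ)) :=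
    fun a => by rw [hy]; simp [divisorEntryInv, div_eq_mul_inv]
  have hy₄ : ∀ a, (y : Mat4) a e₄ = (g : Mat4) a e₄ / Real.sqrt (j.1 : ℕ) :=
    fun a => by rw [hy]; simp [divisorEntryInv, div_eq_mul_inv]
  simp only [divisorEntry, Sum.elim_inl, Matrix.cons_val_zero, Matrix.cons_val_one] at hz₁ hz₂
  obtain ⟨z₃, hz₃⟩ := hcol e₁
  obtain ⟨z₄, hz₄⟩ := hmin e₂
  obtain ⟨z₅, hz₅⟩ := hcol e₂
  obtain ⟨z₆, hz₆⟩ := hcol e₃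
  obtain ⟨z₇, hz₇⟩ := hcol e₄
  obtain ⟨z₈, hz₈⟩ := hmin e₄
  rw [hw1] at hz₃
  rw [hw2] at hz₄ hz₅
  rw [hw3] at hz₆
  rw [hw4] at hz₇ hz₈
  clear_value y
  clear hcol hmin hD₁ hS₁ hD₂ hS₂ hx hx11 hx12 hx22 h₁ h₂ h₃ h₄ hy hσ2 hσ2'
  generalize Real.sqrt (j.1 : ℕ) = σ at *
  generalize Real.sqrt (i.1 : ℕ) = σ' at *
  generalize ((j.2 : ℕ) : ℝ) = k at *
  generalize ((i.2 : ℕ) : ℝ) = k' at *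
  have p1 : (y : Mat4) e₁ e₁ * (y : Mat4) e₁ e₁ = z₃ := by rw [hy₁]; linear_combination hz₃
  have hz13 : z₁ * z₃ = 1 := by
    have h : (z₁ : ℝ) * z₃ = 1 := by
      rw [← mul_one (z₁ : ℝ), ← mul_one (z₃ : ℝ), ← hz₁, ← hz₃]
      field_simp
      linear_combination ((g : Mat4) e₁ e₁ * (g : Mat4) e₃ e₃ + 1) * r13
    exact_mod_cast h
  have hz3 : z₃ = 1 := by
    have h0 : 0 ≤ z₃ := by
      have : (0 : ℝ) ≤ z₃ := by rw [← p1]; exact mul_self_nonneg _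
      exact_mod_cast this
    exact Int.eq_one_of_mul_eq_one_left h0 hz13
  rw [hz3, Int.cast_one] at p1
  obtain ⟨P, hP⟩ : ∃ P : ℤ, (y : Mat4) e₁ e₁ = P := by
    rcases mul_self_eq_one_iff.1 p1 with h | h
    · exact ⟨1, by rw [h]; simp⟩
    · exact ⟨-1, by rw [h]; simp⟩
  have hz24 : z₂ * z₄ = 1 := by
    have h : (z₂ : ℝ) * z₄ = 1 := by
      rw [← mul_one (z₂ : ℝ), ← mul_one (z₄ : ℝ), ← hz₂, ← hz₄]
      field_simp
      linear_combination (g : Mat4) e₁ e₁ * (g : Mat4) e₃ e₃ * r24 + r13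
    exact_mod_cast h
  have hz44 : (z₄ : ℝ) * z₄ = 1 := by
    have h := Int.isUnit_mul_self (IsUnit.of_mul_eq_one z₂ (by rw [mul_comm]; exact hz24))
    exact_mod_cast h
  have hpr : (y : Mat4) e₁ e₁ * (y : Mat4) e₂ e₂ = z₄ := by
    rw [hy₁, hy₂]; linear_combination hz₄
  have hR : (y : Mat4) e₂ e₂ = ((P * z₄ : ℤ) : ℝ) := by
    push_cast
    rw [← hP, ← hpr]
    linear_combination (-(y : Mat4) e₂ e₂) * p1
  have r1 : (y : Mat4) e₂ e₂ * (y : Mat4) e₂ e₂ = 1 := by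
    linear_combination (-(y : Mat4) e₂ e₂ * (y : Mat4) e₂ e₂) * p1 +
      ((y : Mat4) e₁ e₁ * (y : Mat4) e₂ e₂ + z₄) * hpr + hz44
  have y12 : (y : Mat4) e₁ e₂ = 0 := by rw [hy₂, h12, zero_mul]
  have y13 : (y : Mat4) e₁ e₃ = 0 := by rw [hy₃, h13, zero_div]
  have y14 : (y : Mat4) e₁ e₄ = 0 := by rw [hy₄, h14, zero_div]
  have y23 : (y : Mat4) e₂ e₃ = 0 := by rw [hy₃, h23, zero_div]
  have y24 : (y : Mat4) e₂ e₄ = 0 := by rw [hy₄, h24, zero_div]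
  have y43 : (y : Mat4) e₄ e₃ = 0 := by rw [hy₃, h43, zero_div]
  have y21 : (y : Mat4) e₂ e₁ = ((P * z₅ : ℤ) : ℝ) := by
    have h : (y : Mat4) e₁ e₁ * (y : Mat4) e₂ e₁ = z₅ := by
      rw [hy₁, hy₁]; linear_combination hz₅
    push_cast
    rw [← hP, ← h]
    linear_combination (-(y : Mat4) e₂ e₁) * p1
  have y31 : (y : Mat4) e₃ e₁ = ((P * z₆ : ℤ) : ℝ) := by
    have h : (y : Mat4) e₁ e₁ * (y : Mat4) e₃ e₁ = z₆ := by
      rw [hy₁, hy₁]; linear_combination hz₆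
    push_cast
    rw [← hP, ← h]
    linear_combination (-(y : Mat4) e₃ e₁) * p1
  have y41 : (y : Mat4) e₄ e₁ = ((P * z₇ : ℤ) : ℝ) * N := by
    have h : (y : Mat4) e₁ e₁ * (y : Mat4) e₄ e₁ = z₇ * N := by
      rw [hy₁, hy₁]; linear_combination hz₇
    push_cast
    rw [← hP]
    linear_combination (-(y : Mat4) e₄ e₁) * p1 + (y : Mat4) e₁ e₁ * h
  have y42 : (y : Mat4) e₄ e₂ = ((P * z₈ : ℤ) : ℝ) * N := by
    have h : (y : Mat4) e₁ e₁ * (y : Mat4) e₄ e₂ = z₈ * N := by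
      rw [hy₁, hy₂]; linear_combination hz₈
    push_cast
    rw [← hP]
    linear_combination (-(y : Mat4) e₄ e₂) * p1 + (y : Mat4) e₁ e₁ * h
  have y33 : (y : Mat4) e₃ e₃ = P := by
    have h : (y : Mat4) e₁ e₁ * (y : Mat4) e₃ e₃ = 1 := by
      rw [hy₁, hy₃]; field_simp; exact r13
    rw [← hP]
    linear_combination (-(y : Mat4) e₃ e₃) * p1 + (y : Mat4) e₁ e₁ * h
  have y44 : (y : Mat4) e₄ e₄ = ((P * z₄ : ℤ) : ℝ) := by
    have h : (y : Mat4) e₂ e₂ * (y : Mat4) e₄ e₄ = 1 := by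
      rw [hy₂, hy₄]; field_simp; exact r24
    rw [← hR]
    linear_combination (-(y : Mat4) e₄ e₄) * r1 + (y : Mat4) e₂ e₂ * h
  have y34 : (y : Mat4) e₃ e₄ = ((-(P * z₄) * (P * z₅) * P : ℤ) : ℝ) := by
    have h := row_relation y e₂ e₃
    rw [y23, y24] at h
    simp [J] at h
    rw [Int.cast_mul, Int.cast_mul, Int.cast_neg, ← hR, ← y21, ← y33]
    linear_combination (-(y : Mat4) e₃ e₄) * r1 - (y : Mat4) e₂ e₂ * h
  have y32 : (y : Mat4) e₃ e₂ =
      ((P * z₄ * (P * (P * z₇) + (-(P * z₄) * (P * z₅) * P) * (P * z₈)) : ℤ) : ℝ) * N := by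
    have h := row_relation y e₃ e₄
    rw [y43] at h
    simp [J] at h
    have h' : ((P * z₄ * (P * (P * z₇) + (-(P * z₄) * (P * z₅) * P) * (P * z₈)) : ℤ) : ℝ) * N =
        (y : Mat4) e₂ e₂ * ((y : Mat4) e₃ e₃ * (y : Mat4) e₄ e₁ +
          (y : Mat4) e₃ e₄ * (y : Mat4) e₄ e₂) := by
      rw [hR, y33, y41, y34, y42]; push_cast; ring
    rw [h']
    have h44 : (y : Mat4) e₄ e₄ = (y : Mat4) e₂ e₂ := by rw [y44, hR]
    rw [h44] at h
    linear_combination (-(y : Mat4) e₃ e₂) * r1 - (y : Mat4) e₂ e₂ * h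
  refine mem_extendedParamodular_of_inOrder hN ?_
  simp only [InOrder, InPattern, forall_index]
  rw [hP, y12, y13, y14, y21, hR, y23, y24, y31, y32, y33, y34, y41, y42, y43, y44]
  refine ⟨⟨⟨P, ?_⟩, ⟨0, ?_⟩, ⟨0, ?_⟩, ⟨0, ?_⟩⟩, ⟨⟨P * z₅, ?_⟩, ⟨P * z₄, ?_⟩, ⟨0, ?_⟩, ⟨0, ?_⟩⟩,
    ⟨⟨P * z₆, ?_⟩, ⟨P * z₄ * (P * (P * z₇) + (-(P * z₄) * (P * z₅) * P) * (P * z₈)), ?_⟩, ⟨P, ?_⟩,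
      ⟨-(P * z₄) * (P * z₅) * P, ?_⟩⟩,
    ⟨⟨P * z₇, ?_⟩, ⟨P * z₈, ?_⟩, ⟨0, ?_⟩, ⟨P * z₄, ?_⟩⟩⟩ <;>
    simp [wt, indexScale, indexBlock, blockWeight, hN']

end

section

variable {N : ℕ}

/-! ### The Hecke pair -/

theorem InOrder.induction {P : Mat4 → Prop} (h0 : P 0) (hadd : ∀ X Y, P X → P Y → P (X + Y))
    (hsmul : ∀ (z : ℤ) X, P X → P ((z : ℝ) • X))
    (hsingle : ∀ i j, P (Matrix.single i j (wt N 1 i j))) {X : Mat4} (hX : InOrder N X) : P X := by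
  rw [Matrix.matrix_eq_sum_single X]
  refine Finset.sum_induction _ P hadd h0 fun i _ =>
    Finset.sum_induction _ P hadd h0 fun j _ => ?_
  obtain ⟨z, hz⟩ := hX i j
  have h := hsmul z _ (hsingle i j)
  rwa [Matrix.smul_single, smul_eq_mul, ← hz] at h

theorem inOrder_single (i j : Fin 2 ⊕ Fin 2) : InOrder N (Matrix.single i j (wt N 1 i j)) := by
  intro k l
  rw [Matrix.single_apply]
  split_ifs with h
  · exact ⟨1, by rw [← h.1, ← h.2]; simp⟩
  · exact ⟨0, by simp⟩

theorem inOrder_conj (hN : N ≠ 0) {u : Sp2} (hu : u ∈ extendedParamodular N) {X : Mat4}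
    (hX : InOrder N X) : InOrder N ((u : Mat4) * X * ((u⁻¹ : Sp2) : Mat4)) := by
  simpa using isDenominator_one_of_mem hN hu X hX

/-- If the conjugations with two elements of `Σ*_N` agree modulo the product of the denominators of
`g` and `g⁻¹`, the quotient of the elements normalizes the conjugate of the order under `g`. -/
theorem isDenominator_conj_of_congr {g y : Sp2} {n n' : ℕ} (hn' : 0 < n')
    (hg : IsDenominator N n g) (hg' : IsDenominator N n' g⁻¹)
    (h : ∀ Y, InOrder N Y → ∃ Z, InOrder N Z ∧
      (y : Mat4) * Y * ((y⁻¹ : Sp2) : Mat4) = Y + ((n * n' : ℕ) : ℝ) • Z) :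
    IsDenominator N 1 (g * y * g⁻¹) := by
  intro X hX
  obtain ⟨Z, hZ, h⟩ := h _ (hg' X hX)
  rw [inv_inv] at h
  have hn : (n' : ℝ) ≠ 0 := by exact_mod_cast hn'.ne'
  have e : (((1 : ℕ) : ℝ) • (((g * y * g⁻¹ : Sp2) : Mat4) * X *
      (((g * y * g⁻¹)⁻¹ : Sp2) : Mat4))) =
      X + (n : ℝ) • ((g : Mat4) * Z * ((g⁻¹ : Sp2) : Mat4)) := by
    refine smul_right_injective Mat4 hn ?_
    change (n' : ℝ) • _ = (n' : ℝ) • _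
    have e1 : (g * y * g⁻¹)⁻¹ = g * y⁻¹ * g⁻¹ := by group
    rw [e1]
    have e2 : (n' : ℝ) • (((1 : ℕ) : ℝ) • (((g * y * g⁻¹ : Sp2) : Mat4) * X *
        ((g * y⁻¹ * g⁻¹ : Sp2) : Mat4))) = (g : Mat4) * ((y : Mat4) *
        ((n' : ℝ) • (((g⁻¹ : Sp2) : Mat4) * X * (g : Mat4))) * ((y⁻¹ : Sp2) : Mat4)) *
        ((g⁻¹ : Sp2) : Mat4) := by
      simp only [Submonoid.coe_mul, Nat.cast_one, one_smul, Matrix.mul_smul, Matrix.smul_mul,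
        Matrix.mul_assoc]
    have e3 : (g : Mat4) * (((g⁻¹ : Sp2) : Mat4) * X * (g : Mat4)) * ((g⁻¹ : Sp2) : Mat4) = X := by
      calc _ = ((g : Mat4) * ((g⁻¹ : Sp2) : Mat4)) * X * ((g : Mat4) * ((g⁻¹ : Sp2) : Mat4)) := by
            simp only [Matrix.mul_assoc]
        _ = X := by rw [coe_mul_coe_inv, Matrix.one_mul, Matrix.mul_one]
    rw [e2, h, Matrix.mul_add, Matrix.add_mul, Matrix.mul_smul, Matrix.smul_mul, e3, smul_add,
      Matrix.mul_smul, Matrix.smul_mul, smul_smul, Nat.cast_mul, mul_comm (n : ℝ)]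
  rw [e]
  exact hX.add (hg Z hZ)

theorem finite_range_of_factorsThrough {α β γ : Type*} [Finite β] [Nonempty γ] (F : α → β)
    (φ : α → γ) (h : Function.FactorsThrough φ F) : (Set.range φ).Finite := by
  refine (Set.finite_range (Function.extend F φ fun _ => Classical.arbitrary γ)).subset ?_
  rintro _ ⟨a, rfl⟩
  exact ⟨F a, h.extend_apply _ a⟩

theorem isHeckePair (hN : Squarefree N) : Hecke.IsHeckePair (SigmaStar N) := by
  intro g
  have hN0 := hN.ne_zero
  obtain ⟨n, hn, hg⟩ := exists_isDenominator hN0 g.2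
  obtain ⟨n', hn', hg'⟩ := exists_isDenominator hN0 (inv_mem g.2)
  have hnn : NeZero (n * n') := ⟨(Nat.mul_pos hn hn').ne'⟩
  have hfin : Finite (ZMod (n * n')) := Finite.of_fintype _
  have hcoord : ∀ (u : SigmaStar N) i j, InOrder N ((((u : bigG) : Sp2)⁻¹ : Sp2) *
      Matrix.single i j (wt N 1 i j) * (((u : bigG) : Sp2) : Mat4)) := fun u i j => by
    simpa using inOrder_conj hN0 (inv_mem (Subgroup.mem_subgroupOf.1 u.2)) (inOrder_single i j)
  choose z hz using hcoord
  have hset : Hecke.cosetsIn (SigmaStar N) g =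
      Set.range fun u : SigmaStar N => Hecke.coset (SigmaStar N) (g * u) := by
    ext c
    constructor
    · rintro ⟨u, hu, rfl⟩
      exact ⟨⟨u, hu⟩, rfl⟩
    · rintro ⟨u, rfl⟩
      exact ⟨u, u.2, rfl⟩
  rw [hset]
  have hne : Nonempty (Hecke.RightCosets (SigmaStar N)) := ⟨Hecke.coset _ 1⟩
  refine finite_range_of_factorsThrough
    (fun u i j k l => (z u i j k l : ZMod (n * n'))) _ fun u u' huu' => ?_
  rw [Hecke.coset_eq_iff, Subgroup.mem_subgroupOf]
  have e : ((g * u' * (g * u)⁻¹ : bigG) : Sp2) = (g : Sp2) * (((u' : bigG) : Sp2) * ((u : bigG) : Sp2)⁻¹) *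
      (g : Sp2)⁻¹ := by
    push_cast
    group
  refine mem_of_isDenominator_one hN (g * u' * (g * u)⁻¹ : bigG).2 ?_
  rw [e]
  refine isDenominator_conj_of_congr hn' hg hg' fun Y hY => ?_
  have hu' : ((u' : bigG) : Sp2) ∈ extendedParamodular N := Subgroup.mem_subgroupOf.1 u'.2
  obtain ⟨Z, hZ, h⟩ : ∃ Z, InOrder N Z ∧
      (((u : bigG) : Sp2)⁻¹ : Sp2) * Y * (((u : bigG) : Sp2) : Mat4) =
      (((u' : bigG) : Sp2)⁻¹ : Sp2) * Y * (((u' : bigG) : Sp2) : Mat4) +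
        ((n * n' : ℕ) : ℝ) • Z := by
    refine hY.induction (P := fun Y => ∃ Z, InOrder N Z ∧
      (((u : bigG) : Sp2)⁻¹ : Sp2) * Y * (((u : bigG) : Sp2) : Mat4) =
      (((u' : bigG) : Sp2)⁻¹ : Sp2) * Y * (((u' : bigG) : Sp2) : Mat4) +
        ((n * n' : ℕ) : ℝ) • Z) ⟨0, fun i j => ⟨0, by simp⟩, by simp⟩ ?_ ?_ ?_
    · rintro X Y ⟨Z, hZ, h⟩ ⟨Z', hZ', h'⟩
      refine ⟨Z + Z', hZ.add hZ', ?_⟩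
      rw [Matrix.mul_add, Matrix.add_mul, h, h', Matrix.mul_add, Matrix.add_mul, smul_add]
      abel
    · rintro c X ⟨Z, hZ, h⟩
      refine ⟨(c : ℝ) • Z, hZ.intSmul c, ?_⟩
      rw [Matrix.mul_smul, Matrix.smul_mul, h, Matrix.mul_smul, Matrix.smul_mul, smul_add,
        smul_comm]
    · intro i j
      have hd : ∀ k l, ∃ t : ℤ, z u i j k l - z u' i j k l = (n * n' : ℕ) * t := fun k l => by
        have h1 : ((z u i j k l : ℤ) : ZMod (n * n')) = z u' i j k l :=
          congrFun (congrFun (congrFun (congrFun huu' i) j) k) l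
        exact (ZMod.intCast_eq_intCast_iff_dvd_sub _ _ _).1 h1.symm
      choose t ht using hd
      refine ⟨Matrix.of fun k l => (t k l : ℝ) * wt N 1 k l, fun k l => ⟨t k l, rfl⟩, ?_⟩
      ext k l
      have h1 : (z u i j k l : ℝ) - z u' i j k l = (n * n' : ℕ) * t k l := by exact_mod_cast ht k l
      rw [Matrix.add_apply, Matrix.smul_apply, hz, hz, Matrix.of_apply, smul_eq_mul]
      linear_combination wt N 1 k l * h1
  refine ⟨_, inOrder_conj hN0 hu' hZ, ?_⟩
  have h2 := congrArg (fun X : Mat4 => (((u' : bigG) : Sp2) : Mat4) * X *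
    ((((u' : bigG) : Sp2)⁻¹ : Sp2) : Mat4)) h
  simp only [Matrix.mul_add, Matrix.add_mul, Matrix.mul_smul, Matrix.smul_mul] at h2
  have e2 : (((u' : bigG) : Sp2) : Mat4) * (((((u' : bigG) : Sp2)⁻¹ : Sp2) : Mat4) * Y *
      (((u' : bigG) : Sp2) : Mat4)) * ((((u' : bigG) : Sp2)⁻¹ : Sp2) : Mat4) = Y := by
    calc _ = ((((u' : bigG) : Sp2) : Mat4) * ((((u' : bigG) : Sp2)⁻¹ : Sp2) : Mat4)) * Y *
          ((((u' : bigG) : Sp2) : Mat4) * ((((u' : bigG) : Sp2)⁻¹ : Sp2) : Mat4)) := by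
            simp only [Matrix.mul_assoc]
      _ = Y := by rw [coe_mul_coe_inv, Matrix.one_mul, Matrix.mul_one]
  rw [e2] at h2
  rw [← h2, _root_.mul_inv_rev, inv_inv, Submonoid.coe_mul, Submonoid.coe_mul]
  simp only [Matrix.mul_assoc]

end

section

variable {N : ℕ}

/-! ### Leading terms in the Hecke algebra -/

/-- The double coset of `elementaryDivisor i` occurs in `T` with coefficient `1`, and all double
cosets occuring in `T` have denominators dividing those of `elementaryDivisor i`. -/
structure IsLeading (T : HeckeAlg N) (i : ℕ+ × ℕ+) : Prop where
  coeff_self : Hecke.coeff T (elementaryDivisor i) = 1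
  isDenominator : ∀ g, Hecke.coeff T g ≠ 0 → IsDenominator N (degree i) (g : Sp2)
  isSymmDenominator : ∀ g, Hecke.coeff T g ≠ 0 → IsSymmDenominator N (symmDegree i) (g : Sp2)

theorem IsLeading.one (hN : N ≠ 0) : IsLeading (1 : HeckeAlg N) 1 := by
  classical
  have h : ∀ g, Hecke.coeff (1 : HeckeAlg N) g ≠ 0 → IsDenominator N 1 (g : Sp2) := by
    intro g hg
    rw [Hecke.coeff_one] at hg
    exact isDenominator_one_of_mem hN (Subgroup.mem_subgroupOf.1 (ite_ne_right_iff.1 hg).1)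
  refine ⟨?_, fun g hg => by simpa [degree] using h g hg,
    fun g hg => by simpa [symmDegree] using (h g hg).symm⟩
  rw [elementaryDivisor_one, Hecke.coeff_one, if_pos (one_mem _)]

theorem IsLeading.mul (hN : Squarefree N) {T S : HeckeAlg N} {i j : ℕ+ × ℕ+}
    (hT : IsLeading T i) (hS : IsLeading S j) : IsLeading (T * S) (i * j) := by
  have hN0 := hN.ne_zero
  refine ⟨?_, fun k hk => ?_, fun k hk => ?_⟩
  · rw [Hecke.coeff_product_of_unique T S _ (elementaryDivisor j), hS.coeff_self,
      elementaryDivisor_mul, mul_inv_cancel_right, hT.coeff_self, one_mul]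
    intro h' h1 h2
    obtain ⟨u, hu, htri⟩ := exists_mul_isLowerTriangular hN h'.2
    set v : bigG := ⟨u, extendedParamodular_le_bigG hN0 hu⟩ with hv
    have hvU : v ∈ SigmaStar N := Subgroup.mem_subgroupOf.2 hu
    rw [← Hecke.coeff_mul_left S hvU] at h1
    have e : elementaryDivisor (i * j) * (v * h')⁻¹ =
        elementaryDivisor (i * j) * h'⁻¹ * v⁻¹ := by group
    rw [← Hecke.coeff_mul_right T (inv_mem hvU), ← e] at h2
    have hvh : ((v * h' : bigG) : Sp2) = u * (h' : Sp2) := rfl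
    have hd := hT.isDenominator _ h2
    have hs := hT.isSymmDenominator _ h2
    rw [Subgroup.coe_mul, Subgroup.coe_inv, hvh] at hd hs
    have hd' := hS.isDenominator _ h1
    have hs' := hS.isSymmDenominator _ h1
    rw [hvh] at hd' hs'
    have hmem : v * (h' * (elementaryDivisor j)⁻¹) ∈ SigmaStar N := by
      rw [← mul_assoc, Subgroup.mem_subgroupOf, Subgroup.coe_mul, Subgroup.coe_inv, hvh]
      exact htri.mul_inv_mem hN0 hs' hd' hs hd
    exact ((SigmaStar N).mul_mem_cancel_left hvU).1 hmem
  · obtain ⟨h', h1, h2⟩ := Hecke.exists_of_coeff_product_ne_zero hk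
    have h := (hT.isDenominator _ h2).mul (hS.isDenominator _ h1)
    rw [← Subgroup.coe_mul, inv_mul_cancel_right] at h
    rwa [degree_mul]
  · obtain ⟨h', h1, h2⟩ := Hecke.exists_of_coeff_product_ne_zero hk
    have h := (hT.isSymmDenominator _ h2).mul (hS.isSymmDenominator _ h1)
    rw [← Subgroup.coe_mul, inv_mul_cancel_right] at h
    rwa [symmDegree_mul]

theorem exists_eq_of_coeff_doubleCoset_ne_zero (hN : Squarefree N) {g h : bigG}
    (hne : Hecke.coeff (Hecke.doubleCoset (SigmaStar N) g) h ≠ 0) :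
    ∃ u ∈ SigmaStar N, ∃ v ∈ SigmaStar N, h = u * g * v := by
  classical
  rw [Hecke.coeff_doubleCoset (isHeckePair hN)] at hne
  exact (ite_ne_right_iff.1 hne).1

theorem IsLeading.doubleCoset (hN : Squarefree N) (i : ℕ+ × ℕ+) :
    IsLeading (Hecke.doubleCoset (SigmaStar N) (elementaryDivisor i)) i := by
  refine ⟨?_, fun g hg => ?_, fun g hg => ?_⟩
  · rw [Hecke.coeff_doubleCoset (isHeckePair hN),
      if_pos ⟨1, one_mem _, 1, one_mem _, by simp⟩]
  · obtain ⟨u, hu, v, hv, rfl⟩ := exists_eq_of_coeff_doubleCoset_ne_zero hN hg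
    exact (isDenominator_elementaryDivisor i).mul_mem hN.ne_zero (Subgroup.mem_subgroupOf.1 hu)
      (Subgroup.mem_subgroupOf.1 hv)
  · obtain ⟨u, hu, v, hv, rfl⟩ := exists_eq_of_coeff_doubleCoset_ne_zero hN hg
    exact (isSymmDenominator_elementaryDivisor i).mul_mem hN.ne_zero
      (Subgroup.mem_subgroupOf.1 hu) (Subgroup.mem_subgroupOf.1 hv)

theorem diagElement_congr {m m' : ℕ} {hm : 0 < m} {hm' : 0 < m'} {a a' d d' : Fin 2 → ℤ}
    {h : ∀ i, a i * d i = m} {h' : ∀ i, a' i * d' i = m'} (hmm : m = m') (haa : a = a')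
    (hdd : d = d') : diagElement m hm a d h = diagElement m' hm' a' d' h' := by
  subst hmm haa hdd
  rfl

/-- A prime as a positive integer. -/
def primeToPNat (p : Nat.Primes) : ℕ+ := ⟨p, p.2.pos⟩

theorem T1_eq (p : Nat.Primes) :
    T1 N p = Hecke.doubleCoset (SigmaStar N) (elementaryDivisor (primeToPNat p, 1)) := by
  rw [T1, elementaryDivisor]
  congr 1
  refine diagElement_congr ?_ ?_ ?_ <;> simp [primeToPNat]

theorem T2_eq (p : Nat.Primes) :
    T2 N p = Hecke.doubleCoset (SigmaStar N) (elementaryDivisor (1, primeToPNat p)) := by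
  rw [T2, elementaryDivisor]
  congr 1
  refine diagElement_congr ?_ ?_ ?_ <;> simp [primeToPNat]

instance commRing [hN : Fact (Squarefree N)] : CommRing (HeckeAlg N) where
  mul_comm := Hecke.mul_comm_of_inv_mem fun g => by
    obtain ⟨u, hu, v, hv, h⟩ := exists_inv_eq hN.out g.2
    exact ⟨⟨u, extendedParamodular_le_bigG hN.out.ne_zero hu⟩, Subgroup.mem_subgroupOf.2 hu,
      ⟨v, extendedParamodular_le_bigG hN.out.ne_zero hv⟩, Subgroup.mem_subgroupOf.2 hv,
      Subtype.ext h⟩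

/-! ### Exponents -/

/-- The generators of the Hecke algebra. -/
def generator (N : ℕ) (x : Nat.Primes × Fin 2) : HeckeAlg N := ![T1 N x.1, T2 N x.1] x.2

/-- The indices of the double cosets of the generators. -/
def generatorIndex (x : Nat.Primes × Fin 2) : ℕ+ × ℕ+ :=
  ![(primeToPNat x.1, 1), (1, primeToPNat x.1)] x.2

theorem generator_eq (x : Nat.Primes × Fin 2) : generator N x =
    Hecke.doubleCoset (SigmaStar N) (elementaryDivisor (generatorIndex x)) := by
  obtain ⟨p, c⟩ := x
  fin_cases c
  · exact T1_eq p
  · exact T2_eq p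

/-- The index of the leading double coset of a monomial in the generators. -/
def monomialIndex (e : Nat.Primes × Fin 2 →₀ ℕ) : ℕ+ × ℕ+ := e.prod fun x n => generatorIndex x ^ n

theorem monomialIndex_zero : monomialIndex 0 = 1 := Finsupp.prod_zero_index

theorem monomialIndex_add (e e' : Nat.Primes × Fin 2 →₀ ℕ) :
    monomialIndex (e + e') = monomialIndex e * monomialIndex e' :=
  Finsupp.prod_add_index' (fun _ => pow_zero _) fun _ _ _ => pow_add _ _ _

theorem monomialIndex_single (x : Nat.Primes × Fin 2) (n : ℕ) :
    monomialIndex (Finsupp.single x n) = generatorIndex x ^ n :=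
  Finsupp.prod_single_index (pow_zero _)

theorem factorization_coe_primeToPNat (p q : Nat.Primes) :
    (primeToPNat p : ℕ).factorization q = if p = q then 1 else 0 := by
  have h : (primeToPNat p : ℕ) = (p : ℕ) := rfl
  rw [h, p.2.factorization, Finsupp.single_apply]
  simp [Nat.Primes.coe_nat_inj]

theorem factorization_monomialIndex (e : Nat.Primes × Fin 2 →₀ ℕ) (p : Nat.Primes) :
    ((monomialIndex e).1 : ℕ).factorization p = e (p, 0) ∧
      ((monomialIndex e).2 : ℕ).factorization p = e (p, 1) := by
  induction e using Finsupp.induction_linear with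
  | zero => simp [monomialIndex_zero]
  | add e e' h h' =>
    simp [monomialIndex_add, Nat.factorization_mul, h, h']
  | single x n =>
    obtain ⟨q, c⟩ := x
    rw [monomialIndex_single]
    fin_cases c <;>
      simp [generatorIndex, factorization_coe_primeToPNat, Finsupp.single_apply]

theorem monomialIndex_injective : Function.Injective monomialIndex := by
  intro e e' h
  ext ⟨p, c⟩
  have h1 := factorization_monomialIndex e p
  have h2 := factorization_monomialIndex e' p
  rw [h] at h1
  fin_cases c
  · exact h1.1.symm.trans h2.1
  · exact h1.2.symm.trans h2.2

theorem exists_monomialIndex_eq (i : ℕ+ × ℕ+) : ∃ e, monomialIndex e = i := by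
  have h : ∀ n : ℕ, ∀ hn : 0 < n, (∃ e, monomialIndex e = (⟨n, hn⟩, 1)) ∧
      ∃ e, monomialIndex e = (1, ⟨n, hn⟩) := by
    intro n
    induction n using induction_on_primes with
    | zero => exact fun hn => absurd hn (lt_irrefl 0)
    | one => exact fun hn => ⟨⟨0, monomialIndex_zero⟩, ⟨0, monomialIndex_zero⟩⟩
    | prime_mul p a hp ih =>
      intro hn
      have ha : 0 < a := Nat.pos_of_mul_pos_left hn
      obtain ⟨⟨e, he⟩, e', he'⟩ := ih ha
      refine ⟨⟨Finsupp.single (⟨p, hp⟩, 0) 1 + e, ?_⟩, ⟨Finsupp.single (⟨p, hp⟩, 1) 1 + e', ?_⟩⟩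
      · rw [monomialIndex_add, monomialIndex_single, he]
        exact Prod.ext (PNat.coe_injective (by simp [generatorIndex, primeToPNat]; rfl)) (by
          simp [generatorIndex])
      · rw [monomialIndex_add, monomialIndex_single, he']
        exact Prod.ext (by simp [generatorIndex]) (PNat.coe_injective (by
          simp [generatorIndex, primeToPNat]; rfl))
  obtain ⟨s, k⟩ := i
  obtain ⟨e, he⟩ := (h s s.pos).1
  obtain ⟨e', he'⟩ := (h k k.pos).2
  refine ⟨e + e', ?_⟩
  rw [monomialIndex_add, he, he']
  exact Prod.ext (mul_one _) (one_mul _)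

end

section

open MvPolynomial

variable {N : ℕ}

/-! ### The structure of the Hecke algebra -/

theorem degree_dvd_degree (hN : N ≠ 0) {i j : ℕ+ × ℕ+} {T : HeckeAlg N} (hT : IsLeading T i)
    (h : Hecke.coeff T (elementaryDivisor j) ≠ 0) :
    degree j ∣ degree i ∧ symmDegree j ∣ symmDegree i :=
  ⟨degree_dvd_of_isDenominator hN (hT.isDenominator _ h),
    symmDegree_dvd_of_isSymmDenominator hN (hT.isSymmDenominator _ h)⟩

theorem coset_elementaryDivisor_injective (hN : Squarefree N) :
    Function.Injective fun i => Hecke.coset (SigmaStar N) (elementaryDivisor i) := by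
  have h : ∀ i j, Hecke.coset (SigmaStar N) (elementaryDivisor i) =
      Hecke.coset (SigmaStar N) (elementaryDivisor j) →
      degree j ∣ degree i ∧ symmDegree j ∣ symmDegree i := fun i j hij => by
    refine degree_dvd_degree hN.ne_zero (IsLeading.doubleCoset hN i) ?_
    rw [Hecke.coeff, ← hij, ← Hecke.coeff, (IsLeading.doubleCoset hN i).coeff_self]
    exact one_ne_zero
  intro i j hij
  obtain ⟨h1, h2⟩ := h i j hij
  obtain ⟨h3, h4⟩ := h j i hij.symm
  exact eq_of_degree_eq (Nat.dvd_antisymm h4 h2) (Nat.dvd_antisymm h3 h1)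

theorem diagElement_mem_primaryGroup (p : Nat.Primes) (r : ℕ) {hm : 0 < (p : ℕ) ^ r}
    (a d : Fin 2 → ℤ) (h : ∀ i, a i * d i = ((p : ℕ) ^ r : ℕ)) :
    diagElement ((p : ℕ) ^ r) hm a d h ∈ primaryGroup N p := by
  refine (le_sup_right : _ ≤ primaryGroup N p) (Subgroup.subset_closure
    ⟨r, a 0, 0, 0, a 1, 0, 0, 0, 0, 0, 0, 0, 0, d 0, 0, 0, d 1, ?_⟩)
  have hs : Real.sqrt (((p : ℕ) ^ r : ℕ) : ℝ) ≠ 0 := Real.sqrt_ne_zero'.2 (by exact_mod_cast hm)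
  rw [diagElement, smul_smul, mul_one_div_cancel hs, one_smul]
  ext i j
  rcases i with i | i <;> rcases j with j | j <;> fin_cases i <;> fin_cases j <;> simp

section

variable [hN : Fact (Squarefree N)]

/-- The monomials in the generators. -/
def heckeMonomial (N : ℕ) [Fact (Squarefree N)] (e : Nat.Primes × Fin 2 →₀ ℕ) : HeckeAlg N :=
  aeval (generator N) (monomial e (1 : ℤ))

theorem isLeading_heckeMonomial (e : Nat.Primes × Fin 2 →₀ ℕ) :
    IsLeading (heckeMonomial N e) (monomialIndex e) := by
  induction e using Finsupp.induction_linear with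
  | zero =>
    rw [monomialIndex_zero, heckeMonomial, monomial_zero', map_one, map_one]
    exact IsLeading.one hN.out.ne_zero
  | add e e' h h' =>
    have e1 : heckeMonomial N (e + e') = heckeMonomial N e * heckeMonomial N e' := by
      rw [heckeMonomial, heckeMonomial, heckeMonomial, ← map_mul, monomial_mul, one_mul]
    rw [e1, monomialIndex_add]
    exact h.mul hN.out h'
  | single x n =>
    have e1 : heckeMonomial N (Finsupp.single x n) = generator N x ^ n := by
      rw [heckeMonomial, ← X_pow_eq_monomial, map_pow, aeval_X]
    rw [e1, monomialIndex_single]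
    induction n with
    | zero => exact IsLeading.one hN.out.ne_zero
    | succ n ih =>
      rw [pow_succ, pow_succ]
      refine IsLeading.mul hN.out (ih ?_) ?_
      · rw [heckeMonomial, ← X_pow_eq_monomial, map_pow, aeval_X]
      · rw [generator_eq]
        exact IsLeading.doubleCoset hN.out _

/-- The coefficient of the leading double coset of a monomial. -/
def leadingCoeff (N : ℕ) (e : Nat.Primes × Fin 2 →₀ ℕ) : HeckeAlg N →+ ℤ :=
  Hecke.coeffHom (elementaryDivisor (monomialIndex e))

theorem leadingCoeff_heckeMonomial_self (e : Nat.Primes × Fin 2 →₀ ℕ) :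
    leadingCoeff N e (heckeMonomial N e) = 1 :=
  (isLeading_heckeMonomial e).coeff_self

theorem dvd_of_leadingCoeff_ne_zero {e e' : Nat.Primes × Fin 2 →₀ ℕ}
    (h : leadingCoeff N e' (heckeMonomial N e) ≠ 0) :
    degree (monomialIndex e') ∣ degree (monomialIndex e) ∧
      symmDegree (monomialIndex e') ∣ symmDegree (monomialIndex e) :=
  degree_dvd_degree hN.out.ne_zero (isLeading_heckeMonomial e) h

theorem leadingCoeff_triangular (e e' : Nat.Primes × Fin 2 →₀ ℕ)
    (h : leadingCoeff N e' (heckeMonomial N e) ≠ 0) :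
    e' = e ∨ degree (monomialIndex e') * symmDegree (monomialIndex e') <
      degree (monomialIndex e) * symmDegree (monomialIndex e) := by
  obtain ⟨h1, h2⟩ := dvd_of_leadingCoeff_ne_zero h
  have l1 := Nat.le_of_dvd (degree_pos _) h1
  have l2 := Nat.le_of_dvd (symmDegree_pos _) h2
  rcases (Nat.mul_le_mul l1 l2).lt_or_eq with hlt | heq
  · exact Or.inr hlt
  · left
    obtain ⟨e1, e2⟩ := (mul_eq_mul_iff_eq_and_eq_of_pos' l1 l2 (degree_pos _)
      (symmDegree_pos _)).1 heq
    exact monomialIndex_injective (eq_of_degree_eq e2 e1)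

theorem finite_leadingCoeff_ne_zero (T : HeckeAlg N) : {e | leadingCoeff N e T ≠ 0}.Finite :=
  Hecke.finite_support_coeff T (fun e => elementaryDivisor (monomialIndex e))
    ((coset_elementaryDivisor_injective hN.out).comp monomialIndex_injective)

theorem eq_zero_of_leadingCoeff (T : HeckeAlg N) (h : ∀ e, leadingCoeff N e T = 0) : T = 0 := by
  refine Hecke.ext_coeff fun g => ?_
  obtain ⟨u, hu, v, hv, i, hi⟩ := exists_elementaryDivisor hN.out g.2
  obtain ⟨e, rfl⟩ := exists_monomialIndex_eq i
  have hB := fun {u} (hu : u ∈ extendedParamodular N) =>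
    extendedParamodular_le_bigG hN.out.ne_zero hu
  have hi' : (⟨u, hB hu⟩ * g * ⟨v, hB hv⟩ : bigG) = elementaryDivisor (monomialIndex e) :=
    Subtype.ext hi
  have h0 := h e
  rw [leadingCoeff, Hecke.coeffHom_apply, ← hi',
    Hecke.coeff_mul_right T (Subgroup.mem_subgroupOf.2 hv),
    Hecke.coeff_mul_left T (Subgroup.mem_subgroupOf.2 hu)] at h0
  exact h0

/-- An element of the Hecke algebra is in a subalgebra if the monomials with the exponents
selected by a hereditary predicate are. -/
theorem mem_of_leadingCoeff (P : (Nat.Primes × Fin 2 →₀ ℕ) → Prop)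
    (hP : ∀ e e', P e → leadingCoeff N e' (heckeMonomial N e) ≠ 0 → P e')
    (B : Subalgebra ℤ (HeckeAlg N)) (hB : ∀ e, P e → heckeMonomial N e ∈ B) (T : HeckeAlg N)
    (hT : ∀ e, leadingCoeff N e T ≠ 0 → P e) : T ∈ B :=
  mem_of_unitriangular (leadingCoeff N) finite_leadingCoeff_ne_zero eq_zero_of_leadingCoeff
    (heckeMonomial N) (fun e => degree (monomialIndex e) * symmDegree (monomialIndex e))
    leadingCoeff_heckeMonomial_self leadingCoeff_triangular P hP B.toSubring.toAddSubgroup hB T hT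

theorem aeval_generator_bijective :
    Function.Bijective (aeval (generator N) : MvPolynomial _ ℤ →ₐ[ℤ] HeckeAlg N) := by
  refine aeval_bijective_of_monomials _ ?_ fun T => ?_
  · exact linearIndependent_of_unitriangular (leadingCoeff N) (heckeMonomial N)
      (fun e => degree (monomialIndex e) * symmDegree (monomialIndex e))
      leadingCoeff_heckeMonomial_self leadingCoeff_triangular
  · exact mem_of_leadingCoeff (fun _ => True) (fun _ _ _ _ => trivial)
      (aeval (generator N) : MvPolynomial _ ℤ →ₐ[ℤ] HeckeAlg N).range (fun e _ => ⟨monomial e 1, rfl⟩) T fun _ _ => trivial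

theorem noZeroDivisors : NoZeroDivisors (HeckeAlg N) :=
  (RingEquiv.ofBijective (aeval (generator N) : MvPolynomial _ ℤ →ₐ[ℤ] HeckeAlg N)
    aeval_generator_bijective).symm.injective.noZeroDivisors _ (map_zero _) (map_mul _)

/-! ### The primary components -/

theorem exists_isDenominator_of_mem_primaryGroup {p : Nat.Primes} {g : bigG}
    (hg : g ∈ primaryGroup N p) : ∃ r, IsDenominator N ((p : ℕ) ^ r) (g : Sp2) := by
  have hN0 := hN.out.ne_zero
  let Q : Subgroup bigG :=
    { carrier := {g | ∃ r, IsDenominator N ((p : ℕ) ^ r) (g : Sp2)}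
      one_mem' := ⟨0, by
        rw [pow_zero]
        exact isDenominator_one_of_mem hN0 (one_mem _)⟩
      mul_mem' := by
        rintro a b ⟨r, hr⟩ ⟨s, hs⟩
        exact ⟨r + s, by rw [pow_add]; exact hr.mul hs⟩
      inv_mem' := by
        rintro a ⟨r, hr⟩
        obtain ⟨u, hu, v, hv, h⟩ := exists_inv_eq hN.out a.2
        refine ⟨r, ?_⟩
        rw [Subgroup.coe_inv, h]
        exact hr.mul_mem hN0 hu hv }
  have hQ : primaryGroup N p ≤ Q := by
    refine sup_le (fun u hu => ⟨0, ?_⟩) ((Subgroup.closure_le _).2 ?_)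
    · rw [pow_zero]
      exact isDenominator_one_of_mem hN0 (Subgroup.mem_subgroupOf.1 hu)
    · rintro M ⟨r, hr⟩
      exact ⟨r, isDenominator_of_sqrt_smul hN0 ((hasParamodularForm_iff hN0).1 hr)⟩
  exact hQ hg

theorem doubleCoset_mem_primaryComponent {p : Nat.Primes} {g : bigG} (hg : g ∈ primaryGroup N p) :
    Hecke.doubleCoset (SigmaStar N) g ∈ primaryComponent N p := by
  refine (Hecke.mem_heckeSubalgebra _ _).2 fun h hh => ?_
  obtain ⟨u, hu, v, hv, rfl⟩ := exists_eq_of_coeff_doubleCoset_ne_zero hN.out hh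
  have hle : SigmaStar N ≤ primaryGroup N p := le_sup_left
  exact mul_mem (mul_mem (hle hu) hg) (hle hv)

theorem generator_mem_primaryComponent (p : Nat.Primes) (c : Fin 2) :
    generator N (p, c) ∈ primaryComponent N p := by
  fin_cases c
  · have h : generator N (p, 0) = Hecke.doubleCoset (SigmaStar N) (diagElement ((p : ℕ) ^ 1)
        (pow_pos p.2.pos 1) ![1, 1] ![(p : ℕ), (p : ℕ)] (by
          intro i
          fin_cases i <;> simp)) := by
      change T1 N p = _
      rw [T1]
      congr 1
      exact diagElement_congr (pow_one _).symm rfl rfl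
    exact h ▸ doubleCoset_mem_primaryComponent (diagElement_mem_primaryGroup p 1 _ _ _)
  · exact doubleCoset_mem_primaryComponent (diagElement_mem_primaryGroup p 2 _ _ _)

theorem eq_of_degree_monomialIndex_dvd {p : Nat.Primes} {r : ℕ} {e : Nat.Primes × Fin 2 →₀ ℕ}
    (h : degree (monomialIndex e) ∣ (p : ℕ) ^ r) {x : Nat.Primes × Fin 2} (hx : e x ≠ 0) :
    x.1 = p := by
  obtain ⟨q, c⟩ := x
  have hq : (q : ℕ) ∣ degree (monomialIndex e) := by
    have hf := factorization_monomialIndex e q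
    fin_cases c
    · refine Dvd.dvd.mul_right (Nat.dvd_of_factorization_pos ?_) _
      rw [hf.1]
      exact hx
    · refine Dvd.dvd.mul_left (Dvd.dvd.pow (Nat.dvd_of_factorization_pos ?_) two_ne_zero) _
      rw [hf.2]
      exact hx
  exact Subtype.ext ((Nat.prime_dvd_prime_iff_eq q.2 p.2).1
    (q.2.dvd_of_dvd_pow (hq.trans h)))

theorem primaryComponent_eq (p : Nat.Primes) : primaryComponent N p =
    (aeval (fun c => generator N (p, c)) : MvPolynomial (Fin 2) ℤ →ₐ[ℤ] HeckeAlg N).range := by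
  refine le_antisymm (fun T hT => ?_) ?_
  · refine mem_of_leadingCoeff (fun e => ∃ r, degree (monomialIndex e) ∣ (p : ℕ) ^ r) ?_ _ ?_ T ?_
    · rintro e e' ⟨r, hr⟩ h
      exact ⟨r, (dvd_of_leadingCoeff_ne_zero h).1.trans hr⟩
    · rintro e ⟨r, hr⟩
      rw [heckeMonomial, aeval_monomial, map_one, one_mul]
      refine Subalgebra.prod_mem _ fun x hx => Subalgebra.pow_mem _ ?_ _
      obtain ⟨q, c⟩ := x
      have hq : q = p := eq_of_degree_monomialIndex_dvd hr (Finsupp.mem_support_iff.1 hx)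
      subst hq
      exact ⟨X c, aeval_X _ _⟩
    · intro e he
      obtain ⟨r, hr⟩ := exists_isDenominator_of_mem_primaryGroup
        ((Hecke.mem_heckeSubalgebra _ T).1 hT _ he)
      exact ⟨r, degree_dvd_of_isDenominator hN.out.ne_zero hr⟩
  · rw [← Algebra.adjoin_range_eq_range_aeval]
    refine Algebra.adjoin_le ?_
    rintro _ ⟨c, rfl⟩
    exact generator_mem_primaryComponent p c

theorem exists_primaryComponent_equiv (p : Nat.Primes) :
    ∃ φ : MvPolynomial (Fin 2) ℤ ≃ₐ[ℤ] primaryComponent N p,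
      (φ (X 0) : HeckeAlg N) = T1 N p ∧ (φ (X 1) : HeckeAlg N) = T2 N p := by
  rw [primaryComponent_eq p]
  refine ⟨sliceEquiv (generator N) aeval_generator_bijective.1 p, ?_, ?_⟩
  · rw [coe_sliceEquiv, aeval_X]
    rfl
  · rw [coe_sliceEquiv, aeval_X]
    rfl

theorem isInternalTensorProduct_primaryComponent :
    IsInternalTensorProduct fun p : Nat.Primes => primaryComponent N p := by
  simp only [primaryComponent_eq]
  exact isInternalTensorProduct_slices (generator N) aeval_generator_bijective

end

end

end Paramodular

end

theorem theorem4 (N : ℕ) (hN : Squarefree N) :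
    Hecke.IsHeckePair (Paramodular.SigmaStar N) ∧
    (∀ S T : Paramodular.HeckeAlg N, S * T = T * S) ∧
    NoZeroDivisors (Paramodular.HeckeAlg N) ∧
    IsInternalTensorProduct (fun p : Nat.Primes => Paramodular.primaryComponent N p) ∧
    ∀ p : Nat.Primes,
      ∃ φ : MvPolynomial (Fin 2) ℤ ≃ₐ[ℤ] Paramodular.primaryComponent N p,
        (φ (MvPolynomial.X 0) : Paramodular.HeckeAlg N) = Paramodular.T1 N p ∧
        (φ (MvPolynomial.X 1) : Paramodular.HeckeAlg N) = Paramodular.T2 N p := by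
  have : Fact (Squarefree N) := ⟨hN⟩
  exact ⟨Paramodular.isHeckePair hN, fun S T => mul_comm S T, Paramodular.noZeroDivisors,
    Paramodular.isInternalTensorProduct_primaryComponent, Paramodular.exists_primaryComponent_equiv⟩
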